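/- **Conventions.** An MPS tensor $A=(A^i)_i$ with bond dimension $D$ and physical dimension $d$ is a family of $D\times D$ complex matrices $A^1,\dots,A^d$. It generates $V_n(A)=\sum \mathrm{Tr}(A^{i_1}\cdots A^{i_n})|i_1\dots i_n\rangle$, $n\ge 1$. For $A^i\in\mathbb C^{D_1\times D_2}$ and $B^j\in\mathbb C^{D_2\times D_1}$, $AB$ denotes the tensor with matrices $A^iB^j$ and physical index $(i,j)$. An MPO tensor is an MPS tensor with a row and a column physical index ranging over the same set; $V_n(X)$ is then the operator $\sum \mathrm{Tr}(X^{i_1j_1}\cdots X^{i_nj_n})|i_1\dots i_n\rangle\langle j_1\dots j_n|$, and $XY$ (with $X$ acting on $\mathbb C^{d_1}$ and $Y$ on $\mathbb C^{d_2}$) is the two-site tensor with matrices $X^{ij}Y^{i'j'}$ and row and column indices $(i,i')$, $(j,j')$. A tensor $A$ is *normal* if $T_A(\rho)=\sum_i A^i\rho (A^i)^\dagger$ is primitive, i.e. for some $n\ge1$, $T_A^n(\rho)>0$ for all $\rho\ge0$, $\rho\ne0$. A *reduction* from a tensor $B$ to a tensor $A$ with the same physical index is a pair of matrices $V,W$ with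 $VW=\mathrm{Id}$ and $VB^{i_1}\cdots B^{i_n}W=A^{i_1}\cdots A^{i_n}$ for all $n$ and all $i_1,\dots,i_n$. Let $G$ be a group. A family of MPO tensors $g\mapsto T_g$ (bond dimensions may depend on $g$) is a *one-block projective MPO representation* of $G$ if all $V_n(T_g)$, $n\ge1$, are invertible and there are $\lambda(g,h)\in\mathbb C$ with $V_n(T_g)V_n(T_h)=\lambda(g,h)^nV_n(T_{gh})$ for all $g,h\in G$ and $n\ge1$. *Third cohomology label.* Choose normal tensors $A_g$ with $V_n(A_g)=V_n(T_g)$ for all $n\ge 1$, and $\lambda(g,h)$ with $V_n(A_g)V_n(A_h)=\lambda(g,h)^nV_n(A_{gh})$ for all $n\ge 1$, and reductions $V(g,h),W(g,h)$ from $A_{g,h}=\big(\sum_j A_g^{ij}\otimes A_h^{jk}\big)_{ik}$ to $\lambda(g,h)A_{gh}$. Let $A_{g,h,k}$ be the triple product tensor. An *associator* of these choices is a function $\omega:G^3\to\mathbb C^*$ such that for all $g,h,k$, all sufficiently large $n$ and all values $s_1,\dots,s_n$ of the pair of physical indices $$A_{g,h,k}^{s_1}\cdots A_{g,h,k}^{s_n}\,(\mathrm{Id}\otimes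 W(h,k))\,W(g,hk)=\omega(g,h,k)\;A_{g,h,k}^{s_1}\cdots A_{g,h,k}^{s_n}\,(W(g,h)\otimes\mathrm{Id})\,W(gh,k).$$ A class $c\in H^3(G,\mathbb C^*)$ (trivial action) is *the third cohomology label* of $g\mapsto T_g$ if such choices exist and, for every such choice, there is exactly one associator $\omega$ and it is a 3-cocycle of class $c$. **Statement.** Let $G$ be a group. (1) Let $d_1,d_2\ge1$ and for $g\in G$ let $X_g$, $Y_g$ be tensors with matrices $X_g^{ij}\in\mathbb C^{D_1(g)\times D_2(g)}$ ($1\le i,j\le d_1$) and $Y_g^{i'j'}\in\mathbb C^{D_2(g)\times D_1(g)}$ ($1\le i',j'\le d_2$). If $V_n(X_gY_g)$ is a one-block projective MPO representation of $G$, then so is $V_n(Y_gX_g)$, and there is a class $c\in H^3(G,\mathbb C^*)$ that is the third cohomology label of both $g\mapsto X_gY_g$ and $g\mapsto Y_gX_g$. (2) Let $A,B$ be tensors with matrices $A^i\in\mathbb C^{D_1\times D_2}$, $B^j\in\mathbb C^{D_2\times D_1}$ ($1\le i\le d_1$, $1\le j\le d_2$) such that $AB$ and $BA$ are normal, and let $C,D$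 be tensors with matrices $C^i\in\mathbb C^{\tilde D_1\times\tilde D_2}$, $D^j\in\mathbb C^{\tilde D_2\times\tilde D_1}$ over the same physical indices such that $V_n(CD)=V_n(AB)$ for all $n\ge1$. Then $V_n(BA)=V_n(DC)$ for all $n\ge1$. Moreover, if $(V,W)$ is a reduction from $CD$ to $AB$ and $(\tilde V,\tilde W)$ is a reduction from $DC$ to $BA$, then there are scalars $\lambda,\mu\in\mathbb C$ such that for all sufficiently large $k$, and for all values of the physical indices, $$(AB)^kA=\lambda\,V(CD)^kC\tilde W,\qquad (BA)^kB=\mu\,\tilde V(DC)^kDW .$$ Here $(AB)^kA$ and the like stand for products of matrices with $2k+1$ independent physical indices. -/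

import Mathlib

open scoped Kronecker ComplexOrder

noncomputable section

namespace TensorNetwork

/-! ### Matrix product states -/

/-- The matrix product `A^{i₁} ⋯ A^{iₙ}` of the MPS tensor `A` (physical index in `σ`, virtual
indices in `ι`) along the word `w = (i₁, …, iₙ)`. -/
def chain {σ ι : Type*} [Fintype ι] [DecidableEq ι] (A : σ → Matrix ι ι ℂ) {n : ℕ}
    (w : Fin n → σ) : Matrix ι ι ℂ :=
  (List.ofFn fun k => A (w k)).prod

/-- The matrix product state `V_n(A)`, given by its coefficients `Tr (A^{i₁} ⋯ A^{iₙ})`. -/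
def mpsState {σ ι : Type*} [Fintype ι] [DecidableEq ι] (A : σ → Matrix ι ι ℂ) (n : ℕ) :
    (Fin n → σ) → ℂ :=
  fun w => (chain A w).trace

/-- The blocked tensor `A B` with physical index `(i, j)` and matrices `A^i B^j`; the bond
spaces of `A` and `B` may differ. -/
def concat {σ τ ι κ : Type*} [Fintype κ] (A : σ → Matrix ι κ ℂ) (B : τ → Matrix κ ι ℂ) :
    σ × τ → Matrix ι ι ℂ :=
  fun s => A s.1 * B s.2

/-- The transfer map `ρ ↦ ∑ᵢ Aⁱ ρ (Aⁱ)†`. -/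
def transfer {σ ι : Type*} [Fintype σ] [Fintype ι] (A : σ → Matrix ι ι ℂ) :
    Matrix ι ι ℂ → Matrix ι ι ℂ :=
  fun ρ => ∑ s, A s * ρ * (A s).conjTranspose

/-- A tensor is normal if its transfer map is primitive: some positive power of the transfer map
sends every nonzero positive semidefinite matrix to a positive definite one. -/
def IsNormal {σ ι : Type*} [Fintype σ] [Fintype ι] (A : σ → Matrix ι ι ℂ) : Prop :=
  ∃ n : ℕ, 0 < n ∧ ∀ ρ : Matrix ι ι ℂ, ρ.PosSemidef → ρ ≠ 0 → ((transfer A)^[n] ρ).PosDef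

/-- `(V, W)` is a reduction from the tensor `B` to the tensor `A`. -/
def IsReduction {σ ι κ : Type*} [Fintype ι] [DecidableEq ι] [Fintype κ] [DecidableEq κ]
    (B : σ → Matrix κ κ ℂ) (A : σ → Matrix ι ι ℂ) (V : Matrix ι κ ℂ) (W : Matrix κ ι ℂ) : Prop :=
  V * W = 1 ∧ ∀ (n : ℕ) (w : Fin n → σ), V * chain B w * W = chain A w

/-! ### Matrix product operators

An MPO tensor with physical index set `p` is an MPS tensor with physical index set `p × p`
(row index, column index). -/

/-- The matrix product operator `V_n(X)`. -/
def mpoOp {p ι : Type*} [Fintype ι] [DecidableEq ι] (X : p × p → Matrix ι ι ℂ) (n : ℕ) :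
    Matrix (Fin n → p) (Fin n → p) ℂ :=
  Matrix.of fun i j => (chain X fun k => (i k, j k)).trace

/-- The two-site MPO tensor `X Y`: an operator tensor with physical index set `p × q`. -/
def mpoConcat {p q ι κ : Type*} [Fintype κ]
    (X : p × p → Matrix ι κ ℂ) (Y : q × q → Matrix κ ι ℂ) :
    (p × q) × (p × q) → Matrix ι ι ℂ :=
  fun s => X (s.1.1, s.2.1) * Y (s.1.2, s.2.2)

/-- The tensor `∑ⱼ X^{ij} ⊗ Y^{jk}` that generates the operator product `V_n(X) V_n(Y)`. -/
def mpoMul {p ι κ : Type*} [Fintype p] (X : p × p → Matrix ι ι ℂ) (Y : p × p → Matrix κ κ ℂ) :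
    p × p → Matrix (ι × κ) (ι × κ) ℂ :=
  fun s => ∑ j, X (s.1, j) ⊗ₖ Y (j, s.2)

/-- One-block projective MPO representation of `G`: the operators `V_n(X_g)` are invertible and
`V_n(X_g) V_n(X_h) = λ(g,h)ⁿ V_n(X_{gh})` for all chain lengths `n ≥ 1`. -/
def IsOneBlockProjRep {G p : Type*} [Group G] [Fintype p] [DecidableEq p] {D : G → ℕ}
    (X : ∀ g, p × p → Matrix (Fin (D g)) (Fin (D g)) ℂ) : Prop :=
  (∀ g (n : ℕ), 0 < n → IsUnit (mpoOp (X g) n)) ∧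
  ∃ lam : G → G → ℂ, ∀ g h (n : ℕ), 0 < n →
    mpoOp (X g) n * mpoOp (X h) n = lam g h ^ n • mpoOp (X (g * h)) n

/-! ### The third cohomology label -/

/-- `ℂ*` with trivial `G`-action, written additively. -/
abbrev unitsRep (G : Type*) [Group G] :=
  Rep.trivial (ULift ℤ) G (ULift (Additive ℂˣ))

/-- `H³(G, ℂ*)` for the trivial action. -/
abbrev H3 (G : Type*) [Group G] := groupCohomology (unitsRep G) 3

/-- A function `G³ → ℂ*` as an inhomogeneous 3-cochain. -/
def cochain {G : Type*} [Group G] (ω : G → G → G → ℂˣ) : (Fin 3 → G) → unitsRep G :=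
  fun x => ULift.up (Additive.ofMul (ω (x 0) (x 1) (x 2)))

/-- `ω` is a 3-cocycle whose class in `H³(G, ℂ*)` is `c`. -/
def IsCocycleOfClass {G : Type*} [Group G] (ω : G → G → G → ℂˣ) (c : H3 G) : Prop :=
  ∃ hω : inhomogeneousCochains.d (unitsRep G) 3 (cochain ω) = 0,
    groupCohomology.π (unitsRep G) 3 (groupCohomology.cocyclesMk (cochain ω) hω) = c

/-- The choices entering the construction of the label of `g ↦ T_g`: normal tensors `A_g`
generating the same operators, and for each pair `g, h` a reduction from the product tensor of
`A_g` and `A_h` to `λ(g,h) A_{gh}`. -/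
structure LabelingData {G p : Type*} [Group G] [Fintype p] [DecidableEq p] {E : G → ℕ}
    (T : ∀ g, p × p → Matrix (Fin (E g)) (Fin (E g)) ℂ) where
  D : G → ℕ
  A : ∀ g, p × p → Matrix (Fin (D g)) (Fin (D g)) ℂ
  isNormal : ∀ g, IsNormal (A g)
  mpoOp_eq : ∀ g (n : ℕ), 0 < n → mpoOp (A g) n = mpoOp (T g) n
  lam : G → G → ℂ
  mpoOp_mul : ∀ g h (n : ℕ), 0 < n →
    mpoOp (A g) n * mpoOp (A h) n = lam g h ^ n • mpoOp (A (g * h)) n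
  V : ∀ g h, Matrix (Fin (D (g * h))) (Fin (D g) × Fin (D h)) ℂ
  W : ∀ g h, Matrix (Fin (D g) × Fin (D h)) (Fin (D (g * h))) ℂ
  isReduction : ∀ g h,
    IsReduction (mpoMul (A g) (A h)) (fun s => lam g h • A (g * h) s) (V g h) (W g h)

namespace LabelingData

variable {G p : Type*} [Group G] [Fintype p] [DecidableEq p] {E : G → ℕ}
  {T : ∀ g, p × p → Matrix (Fin (E g)) (Fin (E g)) ℂ} (d : LabelingData T)

/-- A chain of product tensors for `g, h, k`, closed on the right by `W(h,k)`, then `W(g,hk)`. -/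
def rightNested (g h k : G) {n : ℕ} (w : Fin n → p × p) :
    Matrix (Fin (d.D g) × Fin (d.D h) × Fin (d.D k)) (Fin (d.D (g * (h * k)))) ℂ :=
  chain (mpoMul (d.A g) (mpoMul (d.A h) (d.A k))) w *
    ((1 : Matrix (Fin (d.D g)) (Fin (d.D g)) ℂ) ⊗ₖ d.W h k) * d.W g (h * k)

/-- A chain of product tensors for `g, h, k`, closed on the right by `W(g,h)`, then `W(gh,k)`. -/
def leftNested (g h k : G) {n : ℕ} (w : Fin n → p × p) :
    Matrix ((Fin (d.D g) × Fin (d.D h)) × Fin (d.D k)) (Fin (d.D (g * h * k))) ℂ :=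
  chain (mpoMul (mpoMul (d.A g) (d.A h)) (d.A k)) w *
    (d.W g h ⊗ₖ (1 : Matrix (Fin (d.D k)) (Fin (d.D k)) ℂ)) * d.W (g * h) k

/-- `ω(g,h,k)` is the ratio of the two nested reductions of sufficiently long chains. The
`submatrix` only identifies the index sets through associativity. -/
def IsAssociator (ω : G → G → G → ℂˣ) : Prop :=
  ∀ g h k, ∃ N : ℕ, ∀ n ≥ N, ∀ w : Fin n → p × p,
    d.rightNested g h k w =
      (ω g h k : ℂ) • (d.leftNested g h k w).submatrix (Equiv.prodAssoc _ _ _).symm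
        (Fin.cast (congrArg d.D (mul_assoc g h k).symm))

end LabelingData

/-- `c ∈ H³(G, ℂ*)` is the third cohomology label of `g ↦ T_g`: labeling data exist, and for
every choice of them there is exactly one associator, which is a 3-cocycle of class `c`. -/
def IsThirdCohomologyLabel {G p : Type*} [Group G] [Fintype p] [DecidableEq p] {E : G → ℕ}
    (T : ∀ g, p × p → Matrix (Fin (E g)) (Fin (E g)) ℂ) (c : H3 G) : Prop :=
  Nonempty (LabelingData T) ∧
  ∀ d : LabelingData T, ∃ ω : G → G → G → ℂˣ,
    (∀ ω', d.IsAssociator ω' ↔ ω' = ω) ∧ IsCocycleOfClass ω c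

end TensorNetwork

end

open TensorNetwork

noncomputable section

open scoped Matrix

set_option linter.unusedSectionVars false

namespace TensorNetwork

/-! ### Nilpotent matrices and Burnside's theorem -/

/-! Everything rests on one comparison principle. Let the words of `A` span the full matrix algebra,
as they do for a normal tensor, and let `B` generate the same states. Then `B` reduces to `A`, and
two reductions agree up to one scalar behind sufficiently long words. For existence, take the
algebra spanned by the pairs (B_w, A_w) over nonempty words. Equality of traces makes every element
(x, 0) nilpotent, so the kernel of the projection to `A` is nilpotent. A rank one idempotent
therefore lifts to some p qᵀ, and lifts of matrix units spread p and q into matrices P and Q with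
B_u (1 - PQ) B_v = 0 for long u, v (`exists_isCanonical`). For uniqueness, a reduction (V, W)
satisfies V B_u P A_v Q B_w W = A_u A_v A_w; the A_v span, so V B_u P and Q B_w W are proportional
to A_u and A_w (`IsCanonical.compare`).

The two nestings for g, h, k both reduce the triple product to the same multiple of A_{ghk}, so they
differ by a unique scalar ω(g,h,k). The cocycle equation is the pentagon for four factors
(`EvEq.pentagon`).

Normal tensors exist because V_n(T_g) V_n(T_{g⁻¹}) = μⁿ. If T_g has an invariant subspace, reducing
the product with T_{g⁻¹} to bond dimension one shows that one diagonal block contributes nothing, so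
the bond dimension can be lowered until T_g is irreducible (`exists_generates_of_invertible`). A
zigzag through T_g T_{g⁻¹} T_g then excludes periodicity (`isNormal_of_invertible`).

For the shift, canonical reductions P, Q of XY and P', Q' of YX turn X and Y into X' = Q X P' and Y'
= Q' Y P, which factorize both normal tensors, A = X'Y' and A' = Y'X' (`exists_factorization`). By
the comparison principle for alternating chains, W(x,y) X'_{xy} agrees, behind long words, with
c(x,y) times the product of X'_x and X'_y followed by W'(x,y). Pushing X' through both nestings
shows that ω and ω' differ by the coboundary of c (`exists_coboundary`). The same principle for
alternating chains gives the second half of the theorem. -/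

theorem trace_idempotent_eq_zero {κ : Type*} [Fintype κ] [DecidableEq κ] {e : Matrix κ κ ℂ}
    (he : IsIdempotentElem e) (ht : e.trace = 0) : e = 0 := by
  have h1 : IsIdempotentElem (Matrix.toLin' e) := by
    unfold IsIdempotentElem
    rw [Module.End.mul_eq_comp, ← Matrix.toLin'_mul, he.eq]
  have h2 := (LinearMap.IsIdempotentElem.trace_eq_zero_iff h1).1 (by
    rw [Matrix.trace_toLin'_eq, ht])
  simpa using h2

-- Write the minimal polynomial as X^a q with q prime to X. Bézout gives the spectral idempotent e
-- for the nonzero eigenvalues as a polynomial in x divisible by X^(a+1). Its trace is a combination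
-- of traces of positive powers of x, so e has trace zero and vanishes.
open Polynomial in
theorem isNilpotent_of_trace_pow_eq_zero {κ : Type*} [Fintype κ] [DecidableEq κ]
    {x : Matrix κ κ ℂ} (hx : ∀ k : ℕ, 0 < k → (x ^ k).trace = 0) : IsNilpotent x := by
  have hint : IsIntegral ℂ x := Algebra.IsIntegral.isIntegral x
  have hmin : minpoly ℂ x ≠ 0 := minpoly.ne_zero hint
  obtain ⟨q, hq, hq0⟩ := Polynomial.exists_eq_pow_rootMultiplicity_mul_and_not_dvd
    (minpoly ℂ x) hmin 0
  set a := (minpoly ℂ x).rootMultiplicity 0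
  simp only [map_zero, sub_zero] at hq hq0
  have hcop : IsCoprime ((X : ℂ[X]) ^ (a + 1)) q :=
    (((Polynomial.irreducible_X).coprime_iff_not_dvd).2 hq0).pow_left
  obtain ⟨u, v, huv⟩ := hcop
  have hzero : x ^ a * aeval x q = 0 := by
    have := minpoly.aeval ℂ x
    rw [hq] at this
    simpa using this
  have hsum : aeval x (u * X ^ (a + 1)) + aeval x (v * q) = 1 := by
    rw [← map_add, huv, map_one]
  set e := aeval x (u * X ^ (a + 1)) with he
  have hev : e * aeval x (v * q) = 0 := by
    have : u * X ^ (a + 1) * (v * q) = u * X * v * (X ^ a * q) := by ring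
    rw [he, ← map_mul, this, map_mul, map_mul (aeval x) (X ^ a), map_pow, aeval_X, hzero, mul_zero]
  have hidem : IsIdempotentElem e := by
    unfold IsIdempotentElem
    calc e * e = e * (1 - aeval x (v * q)) := by rw [← hsum, add_sub_cancel_right]
      _ = e := by rw [mul_sub, hev, mul_one, sub_zero]
  have htr : e.trace = 0 := by
    rw [he, map_mul, Polynomial.aeval_eq_sum_range, Finset.sum_mul, Matrix.trace_sum]
    refine Finset.sum_eq_zero fun i _ => ?_
    rw [smul_mul_assoc, Matrix.trace_smul, map_pow, aeval_X, ← pow_add, hx _ (by omega), smul_zero]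
  have h0 := trace_idempotent_eq_zero hidem htr
  refine ⟨a, ?_⟩
  calc x ^ a = x ^ a * (e + aeval x (v * q)) := by rw [hsum, mul_one]
    _ = x ^ a * aeval x q * aeval x v := by
      rw [h0, zero_add, mul_comm v q, map_mul, mul_assoc]
    _ = 0 := by rw [hzero, zero_mul]

/-- In the unital algebra S generated by K, K is a nil left ideal and so lies in the Jacobson
radical. The radical is nilpotent because S is finite dimensional, hence Artinian. -/
theorem exists_prod_eq_zero_of_nil {κ : Type*} [Fintype κ] [DecidableEq κ]
    (K : NonUnitalSubalgebra ℂ (Matrix κ κ ℂ)) (hK : ∀ x ∈ K, IsNilpotent x) :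
    ∃ m : ℕ, ∀ l : List (Matrix κ κ ℂ), (∀ x ∈ l, x ∈ K) → m ≤ l.length → l.prod = 0 := by
  let S := Algebra.adjoin ℂ (K : Set (Matrix κ κ ℂ))
  have hSK : ∀ y ∈ S, ∀ x ∈ K, y * x ∈ K := by
    intro y hy
    refine Algebra.adjoin_induction (p := fun y _ => ∀ x ∈ K, y * x ∈ K) ?_ ?_ ?_ ?_ hy
    · intro a ha x hx
      exact K.mul_mem ha hx
    · intro r x hx
      rw [← Algebra.smul_def]
      exact K.toSubmodule.smul_mem r hx
    · intro a b _ _ ha hb x hx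
      rw [add_mul]
      exact K.add_mem (ha x hx) (hb x hx)
    · intro a b _ _ ha hb x hx
      rw [mul_assoc]
      exact ha _ (hb x hx)
  have hmem : ∀ x ∈ K, x ∈ S := fun x hx => Algebra.subset_adjoin hx
  have : IsArtinianRing S := IsArtinianRing.of_finite ℂ S
  obtain ⟨m, hm⟩ := IsArtinianRing.isNilpotent_jacobson_bot (R := S)
  have hJ : ∀ (x) (hx : x ∈ K), (⟨x, hmem x hx⟩ : S) ∈ Ideal.jacobson (⊥ : Ideal S) := by
    intro x hx
    rw [Ideal.mem_jacobson_iff]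
    intro y
    have hn : IsNilpotent (y * ⟨x, hmem x hx⟩ : S) := by
      obtain ⟨k, hk⟩ := hK _ (hSK y y.2 x hx)
      exact ⟨k, Subtype.ext (by simpa using hk)⟩
    obtain ⟨z, hz⟩ := hn.isUnit_add_one
    refine ⟨(z⁻¹ : Sˣ), ?_⟩
    have : ((z⁻¹ : Sˣ) : S) * (y * ⟨x, hmem x hx⟩ + 1) = 1 := by rw [← hz]; simp
    rw [mul_add, mul_one, ← mul_assoc] at this
    rw [this]
    simp
  have hprod : ∀ l : List (Matrix κ κ ℂ), (∀ x ∈ l, x ∈ K) →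
      ∃ y : S, y ∈ Ideal.jacobson (⊥ : Ideal S) ^ l.length ∧ (y : Matrix κ κ ℂ) = l.prod := by
    intro l
    induction l using List.reverseRecOn with
    | nil => intro _; exact ⟨1, by simp [Submodule.pow_zero, Ideal.one_eq_top], by simp⟩
    | append_singleton l a ih =>
      intro h
      obtain ⟨y, hy, hyl⟩ := ih fun x hx => h x (by simp [hx])
      have ha : a ∈ K := h a (by simp)
      refine ⟨y * ⟨a, hmem a ha⟩, ?_, by simp [hyl]⟩
      rw [List.length_append, List.length_singleton, Submodule.pow_succ]
      exact Ideal.mul_mem_mul hy (hJ a ha)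
  refine ⟨m, fun l hl hlen => ?_⟩
  obtain ⟨y, hy, hyl⟩ := hprod l hl
  have h0 : y ∈ (⊥ : Ideal S) := by
    have := Ideal.pow_le_pow_right hlen hy
    rwa [hm] at this
  rw [← hyl, (Submodule.mem_bot S).1 h0]
  rfl

/-- Burnside's theorem on matrix algebras. -/
theorem subalgebra_eq_top_of_irreducible {ι : Type*} [Fintype ι] [DecidableEq ι] [Nonempty ι]
    (S : Subalgebra ℂ (Matrix ι ι ℂ))
    (hS : ∀ U : Submodule ℂ (ι → ℂ), (∀ x ∈ S, ∀ v ∈ U, x.mulVec v ∈ U) → U = ⊥ ∨ U = ⊤) :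
    S = ⊤ := by
  let S' : Subalgebra ℂ (Module.End ℂ (ι → ℂ)) := S.map (Matrix.toLinAlgEquiv' (R := ℂ)).toAlgHom
  have hsimple : IsSimpleModule S' (ι → ℂ) := by
    rw [isSimpleModule_iff]
    refine { exists_pair_ne := ⟨⊥, ⊤, bot_ne_top⟩, eq_bot_or_eq_top := fun U => ?_ }
    have hU : ∀ x ∈ S, ∀ v ∈ U.restrictScalars ℂ, x.mulVec v ∈ U.restrictScalars ℂ :=
      fun x hx v hv => U.smul_mem (⟨Matrix.toLinAlgEquiv' x, ⟨x, hx, rfl⟩⟩ : S') hv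
    rcases hS (U.restrictScalars ℂ) hU with h | h
    · left
      rwa [Submodule.restrictScalars_eq_bot_iff] at h
    · right
      rwa [Submodule.restrictScalars_eq_top_iff] at h
  rw [eq_top_iff]
  intro x _
  -- By Schur, the commutant consists of scalars, so every matrix x is linear over it. Density then
  -- matches x on the standard basis with an element of S.
  have hschur := IsSimpleModule.algebraMap_end_bijective_of_isAlgClosed (A := S') (V := ι → ℂ) ℂ
  let f : Module.End (Module.End S' (ι → ℂ)) (ι → ℂ) :=
    { toFun := x.mulVec
      map_add' := Matrix.mulVec_add x
      map_smul' := fun r v => by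
        obtain ⟨c, rfl⟩ := hschur.2 r
        simp [Matrix.mulVec_smul] }
  obtain ⟨r, hr⟩ := jacobson_density (R := S') f (Finset.univ.image fun i => Pi.single i (1 : ℂ))
  obtain ⟨_, y, hy, rfl⟩ := r
  have : x = y := by
    refine Matrix.ext_of_mulVec_single fun i => ?_
    exact hr (Pi.single i 1) (by simp)
  rw [this]
  exact hy

/-! ### Words -/

/-- The product of the values of `a` along a list of letters. -/
def word {σ R : Type*} [Monoid R] (a : σ → R) (w : List σ) : R := (w.map a).prod

section word

variable {σ R : Type*} [Monoid R] (a : σ → R)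

@[simp] theorem word_nil : word a [] = 1 := rfl

@[simp] theorem word_cons (s : σ) (w : List σ) : word a (s :: w) = a s * word a w := by
  simp [word]

theorem word_append (u w : List σ) : word a (u ++ w) = word a u * word a w := by
  simp [word]

theorem word_singleton (s : σ) : word a [s] = a s := by simp

theorem word_flatten_replicate (w : List σ) (k : ℕ) :
    word a (List.replicate k w).flatten = word a w ^ k := by
  induction k with
  | zero => simp
  | succ k ih => rw [List.replicate_succ, List.flatten_cons, word_append, ih, pow_succ']

end word

theorem word_smul {σ R : Type*} [Ring R] [Algebra ℂ R] (c : ℂ) (a : σ → R) (w : List σ) :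
    word (fun s => c • a s) w = c ^ w.length • word a w := by
  induction w with
  | nil => simp
  | cons s w ih => simp [ih, pow_succ', smul_smul, mul_comm]

theorem word_prodMk {σ R S : Type*} [Monoid R] [Monoid S] (a : σ → R) (b : σ → S) (w : List σ) :
    word (fun s => (a s, b s)) w = (word a w, word b w) := by
  induction w with
  | nil => rfl
  | cons s w ih => simp [ih]

theorem chain_eq_word {σ ι : Type*} [Fintype ι] [DecidableEq ι] (A : σ → Matrix ι ι ℂ) {n : ℕ}
    (w : Fin n → σ) : chain A w = word A (List.ofFn w) := by
  simp only [chain, word, List.map_ofFn]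
  rfl

theorem word_eq_chain {σ ι : Type*} [Fintype ι] [DecidableEq ι] (A : σ → Matrix ι ι ℂ)
    (w : List σ) : word A w = chain A w.get := by
  rw [chain_eq_word, List.ofFn_get]

/-- The span of the words of length at least `N`. -/
def wordSpan {σ R : Type*} [Ring R] [Algebra ℂ R] (a : σ → R) (N : ℕ) : Submodule ℂ R :=
  Submodule.span ℂ {x | ∃ w : List σ, N ≤ w.length ∧ word a w = x}

section wordSpan

variable {σ R : Type*} [Ring R] [Algebra ℂ R] {a : σ → R}

theorem word_mem_wordSpan (w : List σ) {N : ℕ} (h : N ≤ w.length) : word a w ∈ wordSpan a N :=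
  Submodule.subset_span ⟨w, h, rfl⟩

theorem wordSpan_mono {M N : ℕ} (h : M ≤ N) : wordSpan a N ≤ wordSpan a M :=
  Submodule.span_mono fun _ ⟨w, hw, e⟩ => ⟨w, h.trans hw, e⟩

theorem mul_mem_wordSpan {M N : ℕ} {x y : R} (hx : x ∈ wordSpan a M) (hy : y ∈ wordSpan a N) :
    x * y ∈ wordSpan a (M + N) := by
  have := Submodule.mul_mem_mul hx hy
  rw [wordSpan, wordSpan, Submodule.span_mul_span] at this
  refine Submodule.span_mono ?_ this
  rintro _ ⟨_, ⟨u, hu, rfl⟩, _, ⟨w, hw, rfl⟩, rfl⟩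
  exact ⟨u ++ w, by rw [List.length_append]; omega, word_append a u w⟩

theorem one_mem_wordSpan : (1 : R) ∈ wordSpan a 0 := word_mem_wordSpan [] le_rfl

theorem pow_mem_wordSpan {x : R} (hx : x ∈ wordSpan a 1) (k : ℕ) : x ^ k ∈ wordSpan a k := by
  induction k with
  | zero => rw [pow_zero]; exact one_mem_wordSpan
  | succ k ih => rw [pow_succ]; exact mul_mem_wordSpan ih hx

/-- This polynomial in x has no constant term, so idempotent lifting stays inside the span of
nonempty words. -/
theorem one_sub_one_sub_pow_mem_wordSpan {x : R} (hx : x ∈ wordSpan a 1) (k : ℕ) :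
    1 - (1 - x) ^ k ∈ wordSpan a 1 := by
  induction k with
  | zero => simp
  | succ k ih =>
    have : 1 - (1 - x) ^ (k + 1) = (1 - (1 - x) ^ k) + x - (1 - (1 - x) ^ k) * x := by
      rw [pow_succ]; noncomm_ring
    rw [this]
    exact Submodule.sub_mem _ (Submodule.add_mem _ ih hx)
      (wordSpan_mono (by omega) (mul_mem_wordSpan ih hx))

end wordSpan

/-- The words of positive length span the whole matrix algebra. -/
def Generates {σ ι : Type*} [Fintype ι] [DecidableEq ι] (A : σ → Matrix ι ι ℂ) : Prop :=
  wordSpan A 1 = ⊤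

/-- The identity is a combination of nonempty words, so multiplying by 1 = 1^N lengthens any
combination of words by at least N letters. -/
theorem Generates.wordSpan_eq_top {σ ι : Type*} [Fintype ι] [DecidableEq ι]
    {A : σ → Matrix ι ι ℂ} (hA : Generates A) (N : ℕ) : wordSpan A N = ⊤ := by
  rw [eq_top_iff]
  intro x _
  have h1 : ∀ y, y ∈ wordSpan A 1 := fun y => by rw [hA]; trivial
  have := mul_mem_wordSpan (h1 x) (pow_mem_wordSpan (h1 1) N)
  rw [one_pow, mul_one] at this
  exact wordSpan_mono (by omega) this

/-- Equality of the coefficients of the generated states, for all positive lengths. -/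
def SameTrace {σ ι κ : Type*} [Fintype ι] [DecidableEq ι] [Fintype κ] [DecidableEq κ]
    (B : σ → Matrix κ κ ℂ) (A : σ → Matrix ι ι ℂ) : Prop :=
  ∀ w : List σ, w ≠ [] → (word B w).trace = (word A w).trace

theorem sameTrace_iff_mpsState {σ ι κ : Type*} [Fintype ι] [DecidableEq ι] [Fintype κ]
    [DecidableEq κ] {B : σ → Matrix κ κ ℂ} {A : σ → Matrix ι ι ℂ} :
    SameTrace B A ↔ ∀ n : ℕ, 0 < n → mpsState B n = mpsState A n := by
  constructor
  · intro h n hn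
    funext w
    simp only [mpsState, chain_eq_word]
    refine h _ fun h0 => ?_
    have := congrArg List.length h0
    simp at this
    omega
  · intro h w hw
    have := congrFun (h w.length (List.length_pos_iff.2 hw)) w.get
    simpa only [mpsState, ← word_eq_chain] using this

/-- A reduction `(Q, P)` from `B` to `A` that is supported in the bulk of long chains. -/
structure IsCanonical {σ ι κ : Type*} [Fintype ι] [DecidableEq ι] [Fintype κ] [DecidableEq κ]
    (B : σ → Matrix κ κ ℂ) (A : σ → Matrix ι ι ℂ) (Q : Matrix ι κ ℂ) (P : Matrix κ ι ℂ) :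
    Prop where
  word_eq : ∀ w, Q * word B w * P = word A w
  bulk : ∃ N, ∀ u v : List σ, N ≤ u.length → N ≤ v.length →
    word B u * (1 - P * Q) * word B v = 0
  left_ext : ∀ (N : ℕ) (z : κ → ℂ), (∀ u : List σ, N ≤ u.length → (word B u).mulVec z = 0) →
    Q.mulVec z = 0
  right_ext : ∀ (N : ℕ) (z : κ → ℂ), (∀ u : List σ, N ≤ u.length → (word B u).vecMul z = 0) →
    P.vecMul z = 0

/-! ### Existence of canonical reductions. -/

section existence

variable {σ ι κ : Type*} [Fintype ι] [DecidableEq ι] [Fintype κ] [DecidableEq κ]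
  {B : σ → Matrix κ κ ℂ} {A : σ → Matrix ι ι ℂ}

theorem SameTrace.trace_eq (h : SameTrace B A) {x : Matrix κ κ ℂ × Matrix ι ι ℂ}
    (hx : x ∈ wordSpan (fun s => (B s, A s)) 1) : x.1.trace = x.2.trace := by
  induction hx using Submodule.span_induction with
  | mem x hx =>
    obtain ⟨w, hw, rfl⟩ := hx
    rw [word_prodMk]
    exact h w (by rintro rfl; simp at hw)
  | zero => simp
  | add x y _ _ hx hy => simp [hx, hy]
  | smul c x _ hx => simp [hx]

theorem fst_mem_wordSpan {N : ℕ} {x : Matrix κ κ ℂ × Matrix ι ι ℂ}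
    (hx : x ∈ wordSpan (fun s => (B s, A s)) N) : x.1 ∈ wordSpan B N := by
  induction hx using Submodule.span_induction with
  | mem x hx =>
    obtain ⟨w, hw, rfl⟩ := hx
    rw [word_prodMk]
    exact word_mem_wordSpan w hw
  | zero => exact Submodule.zero_mem _
  | add x y _ _ hx hy => exact Submodule.add_mem _ hx hy
  | smul c x _ hx => exact Submodule.smul_mem _ _ hx

theorem Generates.exists_lift (hA : Generates A) (N : ℕ) (a : Matrix ι ι ℂ) :
    ∃ b : Matrix κ κ ℂ, (b, a) ∈ wordSpan (fun s => (B s, A s)) N := by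
  have ha : a ∈ wordSpan A N := by rw [hA.wordSpan_eq_top]; trivial
  induction ha using Submodule.span_induction with
  | mem x hx =>
    obtain ⟨w, hw, rfl⟩ := hx
    refine ⟨word B w, ?_⟩
    rw [← word_prodMk]
    exact word_mem_wordSpan w hw
  | zero => exact ⟨0, Submodule.zero_mem _⟩
  | add x y _ _ hx hy =>
    obtain ⟨b, hb⟩ := hx
    obtain ⟨c, hc⟩ := hy
    exact ⟨b + c, Submodule.add_mem _ hb hc⟩
  | smul c x _ hx =>
    obtain ⟨b, hb⟩ := hx
    exact ⟨c • b, Submodule.smul_mem _ c hb⟩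

theorem SameTrace.isNilpotent (h : SameTrace B A) {x : Matrix κ κ ℂ}
    (hx : (x, (0 : Matrix ι ι ℂ)) ∈ wordSpan (fun s => (B s, A s)) 1) : IsNilpotent x := by
  refine isNilpotent_of_trace_pow_eq_zero fun k hk => ?_
  have := h.trace_eq (wordSpan_mono hk (pow_mem_wordSpan hx k))
  simpa [zero_pow hk.ne'] using this

/-- The elements of the algebra of `B` that vanish in the algebra of `A`. -/
def kernelAlgebra (B : σ → Matrix κ κ ℂ) (A : σ → Matrix ι ι ℂ) :
    NonUnitalSubalgebra ℂ (Matrix κ κ ℂ) where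
  carrier := {x | (x, (0 : Matrix ι ι ℂ)) ∈ wordSpan (fun s => (B s, A s)) 1}
  add_mem' := fun {x y} hx hy => by
    rw [Set.mem_ofPred_eq] at *
    have := Submodule.add_mem _ hx hy
    simpa using this
  zero_mem' := (wordSpan (fun s => (B s, A s)) 1).zero_mem
  mul_mem' := fun {x y} hx hy => by
    rw [Set.mem_ofPred_eq] at *
    have := wordSpan_mono (show 1 ≤ 1 + 1 by omega) (mul_mem_wordSpan hx hy)
    simpa using this
  smul_mem' := fun c x hx => by
    rw [Set.mem_ofPred_eq] at *
    have := Submodule.smul_mem _ c hx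
    simpa using this

theorem exists_vecMulVec_of_idempotent {e : Matrix κ κ ℂ} (he : IsIdempotentElem e)
    (ht : e.trace = 1) : ∃ p q : κ → ℂ, e = Matrix.vecMulVec p q := by
  have h1 : IsIdempotentElem (Matrix.toLin' e) := by
    unfold IsIdempotentElem
    rw [Module.End.mul_eq_comp, ← Matrix.toLin'_mul, he.eq]
  have h2 := (LinearMap.IsIdempotentElem.isProj_range _ h1).trace
  rw [Matrix.trace_toLin'_eq, ht] at h2
  have h3 : Module.finrank ℂ (LinearMap.range (Matrix.toLin' e)) = 1 := by exact_mod_cast h2.symm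
  obtain ⟨p, -, hp⟩ := finrank_eq_one_iff'.1 h3
  choose q hq using fun j : κ => hp ⟨Matrix.toLin' e (Pi.single j 1), LinearMap.mem_range_self _ _⟩
  refine ⟨p, q, ?_⟩
  ext i j
  have := congrFun (congrArg Subtype.val (hq j)) i
  simp at this
  rw [Matrix.vecMulVec_apply, mul_comm, this]

/-- The hypothesis says that the rows of X f never reach the range of P, so the projection f = 1 -
PQ may be inserted after every letter. This turns a word of B into a product in the nilpotent kernel
algebra. -/
theorem mul_word_eq_mul_prod {τ : Type*} {Q : Matrix ι κ ℂ} {P : Matrix κ ι ℂ}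
    {f : Matrix κ κ ℂ} (hf : f * f = f) (hfPQ : f = 1 - P * Q) (w : List σ) :
    ∀ X : Matrix τ κ ℂ, (∀ v, X * f * word B v * P = 0) →
      X * f * word B w = X * f * (w.map fun s => f * B s * f).prod := by
  induction w with
  | nil => intro X _; simp
  | cons s w ih =>
    intro X hX
    have h1 : X * f * B s * P = 0 := by simpa using hX [s]
    have h2 : X * f * B s = X * f * B s * f := by
      have : X * f * B s * f = X * f * B s - X * f * B s * P * Q := by
        rw [hfPQ]; simp only [Matrix.mul_sub, Matrix.mul_one, Matrix.mul_assoc]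
      rw [this, h1, Matrix.zero_mul, sub_zero]
    have h3 : ∀ v, X * f * B s * f * word B v * P = 0 := by
      intro v
      rw [← h2]
      have := hX (s :: v)
      rwa [word_cons, ← Matrix.mul_assoc] at this
    have h4 := ih (X * f * B s) h3
    rw [word_cons, List.map_cons, List.prod_cons]
    calc X * f * (B s * word B w) = X * f * B s * f * word B w := by
          rw [← h2, Matrix.mul_assoc (X * f)]
      _ = X * (f * f) * B s * f * (w.map fun s => f * B s * f).prod := by rw [h4, hf]
      _ = _ := by simp only [Matrix.mul_assoc]

theorem word_mul_eq_prod_mul {τ : Type*} {Q : Matrix ι κ ℂ} {P : Matrix κ ι ℂ}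
    {f : Matrix κ κ ℂ} (hf : f * f = f) (hfPQ : f = 1 - P * Q) (w : List σ) :
    ∀ Y : Matrix κ τ ℂ, (∀ v, Q * word B v * (f * Y) = 0) →
      word B w * (f * Y) = (w.map fun s => f * B s * f).prod * (f * Y) := by
  induction w using List.reverseRecOn with
  | nil => intro Y _; simp
  | append_singleton w s ih =>
    intro Y hY
    have h1 : Q * (B s * (f * Y)) = 0 := by simpa [Matrix.mul_assoc] using hY [s]
    have h2 : B s * (f * Y) = f * (B s * (f * Y)) := by
      have : f * (B s * (f * Y)) = B s * (f * Y) - P * (Q * (B s * (f * Y))) := by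
        conv_lhs => arg 1; rw [hfPQ]
        simp only [Matrix.sub_mul, Matrix.one_mul, Matrix.mul_assoc]
      rw [this, h1, Matrix.mul_zero, sub_zero]
    have h3 : ∀ v, Q * word B v * (f * (B s * (f * Y))) = 0 := by
      intro v
      rw [← h2]
      have := hY (v ++ [s])
      simpa only [word_append, word_singleton, Matrix.mul_assoc] using this
    have h4 := ih (B s * (f * Y)) h3
    rw [word_append, word_singleton, List.map_append, List.prod_append, List.map_singleton,
      List.prod_singleton]
    calc word B w * B s * (f * Y) = word B w * (f * (B s * (f * Y))) := by
          rw [← h2, Matrix.mul_assoc]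
      _ = (w.map fun s => f * B s * f).prod * (f * (B s * (f * f * Y))) := by rw [h4, hf]
      _ = _ := by simp only [Matrix.mul_assoc]

theorem wordSpan_mulVec_eq_zero {N : ℕ} {z : κ → ℂ}
    (hz : ∀ u : List σ, N ≤ u.length → (word B u).mulVec z = 0) {x : Matrix κ κ ℂ}
    (hx : x ∈ wordSpan B N) : x.mulVec z = 0 := by
  induction hx using Submodule.span_induction with
  | mem x hx => obtain ⟨w, hw, rfl⟩ := hx; exact hz w hw
  | zero => simp
  | add x y _ _ hx hy => rw [Matrix.add_mulVec, hx, hy, add_zero]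
  | smul c x _ hx => rw [Matrix.smul_mulVec, hx, smul_zero]

theorem wordSpan_vecMul_eq_zero {N : ℕ} {z : κ → ℂ}
    (hz : ∀ u : List σ, N ≤ u.length → (word B u).vecMul z = 0) {x : Matrix κ κ ℂ}
    (hx : x ∈ wordSpan B N) : x.vecMul z = 0 := by
  induction hx using Submodule.span_induction with
  | mem x hx => obtain ⟨w, hw, rfl⟩ := hx; exact hz w hw
  | zero => simp
  | add x y _ _ hx hy => rw [Matrix.vecMul_add, hx, hy, add_zero]
  | smul c x _ hx => rw [Matrix.vecMul_smul, hx, smul_zero]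

/-- Besides the reduction itself, the construction yields the two extensionality properties: q = q
e₀^N, so each row of Q is q times a combination of words of length at least N, and dually for P. -/
theorem exists_isCanonical [Nonempty ι] (hA : Generates A) (h : SameTrace B A) :
    ∃ (Q : Matrix ι κ ℂ) (P : Matrix κ ι ℂ), IsCanonical B A Q P := by
  obtain ⟨i₀⟩ := ‹Nonempty ι›
  obtain ⟨x, hx⟩ := hA.exists_lift (B := B) 1 (Matrix.single i₀ i₀ 1)
  have hE : IsIdempotentElem (Matrix.single i₀ i₀ (1 : ℂ)) := by
    simp [IsIdempotentElem]
  -- an idempotent lift of a rank one idempotent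
  obtain ⟨e₀, he₀, hidem⟩ : ∃ e₀ : Matrix κ κ ℂ,
      (e₀, Matrix.single i₀ i₀ (1 : ℂ)) ∈ wordSpan (fun s => (B s, A s)) 1 ∧
        IsIdempotentElem e₀ := by
    have hn : IsNilpotent (x - x ^ 2) := by
      refine h.isNilpotent ?_
      have := Submodule.sub_mem _ hx (wordSpan_mono (show 1 ≤ 2 by omega) (pow_mem_wordSpan hx 2))
      simpa [pow_two, hE.eq] using this
    obtain ⟨m, hm⟩ := hn
    have hm1 : (x - x ^ 2) ^ (m + 1) = 0 := by rw [pow_succ, hm, zero_mul]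
    -- The exponent m + 1 is positive even if m = 0; this removes the constant term and makes the
    -- polynomial fix the matrix unit below x.
    refine ⟨1 - (1 - x ^ (m + 1)) ^ (m + 1), ?_, isIdempotentElem_one_sub_one_sub_pow_pow _ _ hm1⟩
    have h1 := one_sub_one_sub_pow_mem_wordSpan
      (wordSpan_mono (show 1 ≤ m + 1 by omega) (pow_mem_wordSpan hx (m + 1))) (m + 1)
    have h2 : (1 : Matrix ι ι ℂ) - (1 - Matrix.single i₀ i₀ 1 ^ (m + 1)) ^ (m + 1) =
        Matrix.single i₀ i₀ 1 := by
      rw [hE.pow_succ_eq, hE.one_sub.pow_succ_eq, sub_sub_cancel]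
    convert h1 using 1
    refine Prod.ext rfl ?_
    simp [h2]
  have htr : e₀.trace = 1 := by
    have := h.trace_eq he₀
    simpa using this
  obtain ⟨p, q, hpq⟩ := exists_vecMulVec_of_idempotent hidem htr
  have hqp1 : q ⬝ᵥ p = 1 := by rw [← htr, hpq, Matrix.trace_vecMulVec, dotProduct_comm]
  have hqe : q ᵥ* e₀ = q := by rw [hpq, Matrix.vecMul_vecMulVec, hqp1, one_smul]
  have hep : e₀ *ᵥ p = p := by
    rw [hpq, Matrix.vecMulVec_mulVec, hqp1]
    simp
  choose y hy using fun i : ι => hA.exists_lift (B := B) 1 (Matrix.single i i₀ 1)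
  choose z hz using fun j : ι => hA.exists_lift (B := B) 1 (Matrix.single i₀ j 1)
  let Q : Matrix ι κ ℂ := Matrix.of fun j => (z j).vecMul q
  let P : Matrix κ ι ℂ := Matrix.of fun k i => (y i).mulVec p k
  -- Since e₀ = p qᵀ, entries of Q r P are traces of products starting with e₀. They can be computed
  -- on the side of `A`, where only matrix units occur.
  have hqp : ∀ t : Matrix κ κ ℂ, q ⬝ᵥ t.mulVec p = (e₀ * t).trace := by
    intro t
    rw [hpq, Matrix.vecMulVec_mul, Matrix.trace_vecMulVec, Matrix.dotProduct_mulVec,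
      dotProduct_comm]
  have hQrP : ∀ (r : Matrix κ κ ℂ) (a : Matrix ι ι ℂ),
      (r, a) ∈ wordSpan (fun s => (B s, A s)) 0 → Q * r * P = a := by
    intro r a hr
    ext j i
    have h1 : (Q * r * P) j i = q ⬝ᵥ (z j * r * y i).mulVec p := by
      change ((q ᵥ* z j) ᵥ* r) ⬝ᵥ (y i *ᵥ p) = _
      rw [Matrix.vecMul_vecMul, Matrix.dotProduct_mulVec, Matrix.vecMul_vecMul,
        Matrix.dotProduct_mulVec, Matrix.mul_assoc]
    rw [h1, hqp]
    have h2 := mul_mem_wordSpan he₀ (mul_mem_wordSpan (mul_mem_wordSpan (hz j) hr) (hy i))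
    have h3 := h.trace_eq (wordSpan_mono (by omega) h2)
    simp only [Prod.mk_mul_mk] at h3
    rw [h3]
    simp
  have hQwP : ∀ w, Q * word B w * P = word A w := fun w =>
    hQrP _ _ (by rw [← word_prodMk]; exact word_mem_wordSpan w (Nat.zero_le _))
  have hQP : Q * P = 1 := by simpa using hQwP []
  -- PQ is the sum of y_i e₀ z_i, a lift of the identity. Hence f B_s f lies over 0 and belongs to
  -- the kernel algebra.
  have hPQ : (P * Q, (1 : Matrix ι ι ℂ)) ∈ wordSpan (fun s => (B s, A s)) 1 := by
    have h1 : ∀ i ∈ Finset.univ, (y i * e₀ * z i,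
        Matrix.single i i₀ (1 : ℂ) * Matrix.single i₀ i₀ 1 * Matrix.single i₀ i 1) ∈
          wordSpan (fun s => (B s, A s)) 1 := fun i _ =>
      wordSpan_mono (by omega) (mul_mem_wordSpan (mul_mem_wordSpan (hy i) he₀) (hz i))
    have h2 := Submodule.sum_mem _ h1
    convert h2 using 1
    rw [Prod.ext_iff, Prod.fst_sum, Prod.snd_sum]
    constructor
    · simp only [hpq]
      ext k l
      simp [Matrix.sum_apply, Matrix.mul_apply, P, Q, Matrix.mul_vecMulVec, Matrix.vecMulVec_mul,
        Matrix.vecMulVec_apply]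
    · simp [Matrix.sum_single_one]
  set f := 1 - P * Q with hf
  have hff : f * f = f := by
    have : P * Q * (P * Q) = P * Q := by
      rw [Matrix.mul_assoc, ← Matrix.mul_assoc Q, hQP, Matrix.one_mul]
    rw [hf]
    simp only [Matrix.sub_mul, Matrix.mul_sub, Matrix.one_mul, Matrix.mul_one, this, sub_self,
      sub_zero]
  have hQfP : ∀ u v, Q * word B u * f * word B v * P = 0 := by
    intro u v
    have : Q * word B u * f * word B v * P =
        Q * word B (u ++ v) * P - Q * word B u * P * (Q * word B v * P) := by
      rw [hf, word_append]
      simp only [Matrix.mul_sub, Matrix.sub_mul, Matrix.mul_one, Matrix.mul_assoc]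
    rw [this, hQwP, hQwP, hQwP, word_append, sub_self]
  obtain ⟨m, hm⟩ := exists_prod_eq_zero_of_nil (kernelAlgebra B A) fun x hx => h.isNilpotent hx
  have hnil : ∀ w : List σ, m ≤ w.length → (w.map fun s => f * B s * f).prod = 0 := by
    intro w hw
    refine hm _ (fun x hx => ?_) (by simpa using hw)
    obtain ⟨s, -, rfl⟩ := List.mem_map.1 hx
    have hs : (B s, A s) ∈ wordSpan (fun s => (B s, A s)) 1 := by
      have := word_mem_wordSpan (a := fun s => (B s, A s)) [s] (N := 1) (by simp)
      rwa [word_singleton] at this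
    have h1 := mul_mem_wordSpan hPQ hs
    have h2 := mul_mem_wordSpan hs hPQ
    have h3 := mul_mem_wordSpan h1 hPQ
    have h4 := Submodule.add_mem _ (Submodule.sub_mem _ (Submodule.sub_mem _ hs
      (wordSpan_mono (by omega) h1)) (wordSpan_mono (by omega) h2)) (wordSpan_mono (by omega) h3)
    change (f * B s * f, (0 : Matrix ι ι ℂ)) ∈ wordSpan (fun s => (B s, A s)) 1
    convert h4 using 1
    refine Prod.ext ?_ (by simp)
    simp only [hf, Prod.mk_mul_mk, Prod.fst_add, Prod.fst_sub]
    noncomm_ring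
  refine ⟨Q, P, hQwP, ⟨m, fun u v hu hv => ?_⟩, ?_, ?_⟩
  · have h1 : ∀ w, word B u * f * word B w * P = 0 := by
      intro w
      have h2 := word_mul_eq_prod_mul hff hf u (word B w * P) (Q := Q) fun v => by
        simpa only [Matrix.mul_assoc] using hQfP v w
      rw [hnil u hu, Matrix.zero_mul] at h2
      simpa only [Matrix.mul_assoc] using h2
    rw [mul_word_eq_mul_prod hff hf v _ h1, hnil v hv, Matrix.mul_zero]
  · intro N v hv
    have h1 : q ᵥ* e₀ ^ N = q := by
      clear hv
      induction N with
      | zero => simp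
      | succ N ih => rw [pow_succ', ← Matrix.vecMul_vecMul, hqe, ih]
    ext j
    change (q ᵥ* z j) ⬝ᵥ v = 0
    rw [← h1, Matrix.vecMul_vecMul, ← Matrix.dotProduct_mulVec, wordSpan_mulVec_eq_zero hv,
      dotProduct_zero]
    exact wordSpan_mono (Nat.le_add_right _ _)
      (fst_mem_wordSpan (mul_mem_wordSpan (pow_mem_wordSpan he₀ N) (hz j)))
  · intro N v hv
    have h1 : e₀ ^ N *ᵥ p = p := by
      clear hv
      induction N with
      | zero => simp
      | succ N ih => rw [pow_succ, ← Matrix.mulVec_mulVec, hep, ih]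
    ext i
    change v ⬝ᵥ (y i *ᵥ p) = 0
    rw [← h1, Matrix.mulVec_mulVec, Matrix.dotProduct_mulVec, wordSpan_vecMul_eq_zero hv,
      zero_dotProduct]
    exact wordSpan_mono (Nat.le_add_left _ _)
      (fst_mem_wordSpan (mul_mem_wordSpan (hy i) (pow_mem_wordSpan he₀ N)))

end existence

/-! ### Comparison of reductions -/

/-- Matrix units X turn the hypothesis into an equality of elementary tensors F ⊗ H = F' ⊗ H'. The
factors of a nonzero elementary tensor are unique up to inverse scalars. -/
theorem exists_scalar_of_mul_mul_eq {α β m ι κ n : Type*} [Fintype ι] [Fintype κ] [DecidableEq ι]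
    [DecidableEq κ] {F F' : α → Matrix m ι ℂ} {H H' : β → Matrix κ n ℂ}
    (h : ∀ a b (X : Matrix ι κ ℂ), F a * X * H b = F' a * X * H' b)
    (hF : ∃ a, F' a ≠ 0) (hH : ∃ b, H' b ≠ 0) :
    ∃ c : ℂ, c ≠ 0 ∧ (∀ b, H b = c • H' b) ∧ ∀ a, F a = c⁻¹ • F' a := by
  have key : ∀ a b r i j l, F a r i * H b j l = F' a r i * H' b j l := by
    intro a b r i j l
    have := congrFun (congrFun (h a b (Matrix.single i j 1)) r) l
    simpa [Matrix.mul_apply, Matrix.single_apply, Finset.sum_ite_eq, ite_and] using this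
  obtain ⟨a₀, ha₀⟩ := hF
  obtain ⟨b₀, hb₀⟩ := hH
  obtain ⟨r₀, i₀, hF₀⟩ : ∃ r i, F' a₀ r i ≠ 0 := by
    by_contra! h0
    exact ha₀ (Matrix.ext h0)
  obtain ⟨j₀, l₀, hH₀⟩ : ∃ j l, H' b₀ j l ≠ 0 := by
    by_contra! h0
    exact hb₀ (Matrix.ext h0)
  have hF1 : F a₀ r₀ i₀ ≠ 0 := by
    intro h0
    have := key a₀ b₀ r₀ i₀ j₀ l₀
    rw [h0, zero_mul] at this
    exact mul_ne_zero hF₀ hH₀ this.symm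
  have hH1 : ∀ b, H b = (F' a₀ r₀ i₀ / F a₀ r₀ i₀) • H' b := by
    intro b
    ext j l
    rw [Matrix.smul_apply, smul_eq_mul, div_mul_eq_mul_div, eq_div_iff hF1, ← key, mul_comm]
  refine ⟨F' a₀ r₀ i₀ / F a₀ r₀ i₀, div_ne_zero hF₀ hF1, hH1, fun a => ?_⟩
  ext r i
  have h1 := key a b₀ r i j₀ l₀
  rw [hH1, Matrix.smul_apply, smul_eq_mul, ← mul_assoc] at h1
  have h2 := mul_right_cancel₀ hH₀ h1
  rw [Matrix.smul_apply, smul_eq_mul, ← h2, inv_div]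
  field_simp

/-- Equality after multiplication from the left by sufficiently long words. -/
def EvEq {σ κ τ : Type*} [Fintype κ] [DecidableEq κ] (B : σ → Matrix κ κ ℂ)
    (M M' : Matrix κ τ ℂ) : Prop :=
  ∃ N, ∀ w : List σ, N ≤ w.length → word B w * M = word B w * M'

namespace EvEq

variable {σ κ τ τ' : Type*} [Fintype κ] [DecidableEq κ] {B : σ → Matrix κ κ ℂ}
  {M M' M'' : Matrix κ τ ℂ}

theorem refl (M : Matrix κ τ ℂ) : EvEq B M M := ⟨0, fun _ _ => rfl⟩

theorem of_eq (h : M = M') : EvEq B M M' := h ▸ refl M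

theorem symm (h : EvEq B M M') : EvEq B M' M := by
  obtain ⟨N, hN⟩ := h
  exact ⟨N, fun w hw => (hN w hw).symm⟩

theorem trans (h : EvEq B M M') (h' : EvEq B M' M'') : EvEq B M M'' := by
  obtain ⟨N, hN⟩ := h
  obtain ⟨N', hN'⟩ := h'
  exact ⟨max N N', fun w hw => (hN w (le_of_max_le_left hw)).trans (hN' w (le_of_max_le_right hw))⟩

theorem smul (h : EvEq B M M') (c : ℂ) : EvEq B (c • M) (c • M') := by
  obtain ⟨N, hN⟩ := h
  exact ⟨N, fun w hw => by rw [Matrix.mul_smul, Matrix.mul_smul, hN w hw]⟩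

theorem add {K K' : Matrix κ τ ℂ} (h : EvEq B M M') (h' : EvEq B K K') :
    EvEq B (M + K) (M' + K') := by
  obtain ⟨N, hN⟩ := h
  obtain ⟨N', hN'⟩ := h'
  exact ⟨max N N', fun w hw => by
    rw [Matrix.mul_add, Matrix.mul_add, hN w (le_of_max_le_left hw),
      hN' w (le_of_max_le_right hw)]⟩

theorem sum {α : Type*} (s : Finset α) {K K' : α → Matrix κ τ ℂ}
    (h : ∀ a, EvEq B (K a) (K' a)) : EvEq B (∑ a ∈ s, K a) (∑ a ∈ s, K' a) := by
  classical
  induction s using Finset.induction_on with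
  | empty => simpa using refl _
  | insert a s ha ih => rw [Finset.sum_insert ha, Finset.sum_insert ha]; exact (h a).add ih

theorem mul_right [Fintype τ] (h : EvEq B M M') (K : Matrix τ τ' ℂ) :
    EvEq B (M * K) (M' * K) := by
  obtain ⟨N, hN⟩ := h
  exact ⟨N, fun w hw => by rw [← Matrix.mul_assoc, ← Matrix.mul_assoc, hN w hw]⟩

end EvEq

/-- `W` intertwines `A` and `B` up to a nonzero scalar, behind sufficiently long words. -/
def Intertwines {σ ι κ : Type*} [Fintype ι] [Fintype κ] [DecidableEq κ]
    (B : σ → Matrix κ κ ℂ) (A : σ → Matrix ι ι ℂ) (W : Matrix κ ι ℂ) : Prop :=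
  ∃ l : ℂ, l ≠ 0 ∧ ∃ N, ∀ (u : List σ) (s : σ), N ≤ u.length →
    word B u * B s * W = l • (word B u * W * A s)

section comparison

variable {σ ι κ : Type*} [Fintype ι] [DecidableEq ι] [Fintype κ] [DecidableEq κ]
  {B : σ → Matrix κ κ ℂ} {A : σ → Matrix ι ι ℂ} {Q V : Matrix ι κ ℂ} {P W : Matrix κ ι ℂ}

theorem isReduction_iff :
    IsReduction B A V W ↔ ∀ w, V * word B w * W = word A w := by
  constructor
  · rintro ⟨-, h⟩ w
    rw [word_eq_chain, h, ← word_eq_chain]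
  · intro h
    refine ⟨by simpa using h [], fun n w => ?_⟩
    rw [chain_eq_word, h, chain_eq_word]

theorem Intertwines.mul_word (h : Intertwines B A W) :
    ∃ l : ℂ, l ≠ 0 ∧ ∃ N, ∀ u v : List σ, N ≤ u.length →
      word B u * word B v * W = l ^ v.length • (word B u * W * word A v) := by
  obtain ⟨l, hl, N, hN⟩ := h
  refine ⟨l, hl, N, fun u v => ?_⟩
  induction v generalizing u with
  | nil => intro _; simp
  | cons s v ih =>
    intro hu
    have h1 := ih (u ++ [s]) (by rw [List.length_append]; omega)
    rw [word_append, word_singleton] at h1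
    rw [word_cons, word_cons, ← Matrix.mul_assoc (word B u), h1, hN u s hu,
      Matrix.smul_mul, smul_smul, List.length_cons, pow_succ]
    simp only [Matrix.mul_assoc]

/-- The first letters of a long word allow W to be moved to the left through the remaining ones,
which become a long word of `A` in front of M. -/
theorem Intertwines.evEq (h : Intertwines B A W) {τ : Type*} {M M' : Matrix ι τ ℂ}
    (hM : EvEq A M M') : EvEq B (W * M) (W * M') := by
  obtain ⟨l, -, N, hN⟩ := h.mul_word
  obtain ⟨N', hN'⟩ := hM
  refine ⟨N + N', fun w hw => ?_⟩
  rw [← List.take_append_drop N w, word_append, ← Matrix.mul_assoc, ← Matrix.mul_assoc,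
    hN _ _ (by rw [List.length_take]; omega), Matrix.smul_mul, Matrix.smul_mul,
    Matrix.mul_assoc (_ * W), hN' _ (by rw [List.length_drop]; omega), ← Matrix.mul_assoc]

theorem Intertwines.of_smul {c : ℂ} (hc : c ≠ 0) (h : Intertwines B (fun s => c • A s) W) :
    Intertwines B A W := by
  obtain ⟨l, hl, N, hN⟩ := h
  refine ⟨l * c, mul_ne_zero hl hc, N, fun u s hu => ?_⟩
  rw [hN u s hu, Matrix.mul_smul, smul_smul]

namespace IsCanonical

variable (hC : IsCanonical B A Q P)
include hC

theorem isReduction : IsReduction B A Q P := isReduction_iff.2 hC.word_eq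

theorem left_ext_matrix {τ : Type*} (N : ℕ) (Z : Matrix κ τ ℂ)
    (hZ : ∀ u : List σ, N ≤ u.length → word B u * Z = 0) : Q * Z = 0 := by
  have : ∀ j, Q *ᵥ Z.col j = 0 := fun j => hC.left_ext N _ fun u hu => by
    ext i
    exact congrFun (congrFun (hZ u hu) i) j
  ext i j
  exact congrFun (this j) i

theorem right_ext_matrix {τ : Type*} (N : ℕ) (Z : Matrix τ κ ℂ)
    (hZ : ∀ u : List σ, N ≤ u.length → Z * word B u = 0) : Z * P = 0 := by
  have : ∀ i, Z.row i ᵥ* P = 0 := fun i => hC.right_ext N _ fun u hu => by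
    ext j
    exact congrFun (congrFun (hZ u hu) i) j
  ext i j
  exact congrFun (this i) j

theorem bulk_eq : ∃ N, ∀ u v : List σ, N ≤ u.length → N ≤ v.length →
    word B u * P * (Q * word B v) = word B u * word B v := by
  obtain ⟨N, hN⟩ := hC.bulk
  refine ⟨N, fun u v hu hv => ?_⟩
  have := hN u v hu hv
  rw [Matrix.mul_sub, Matrix.sub_mul, Matrix.mul_one, sub_eq_zero] at this
  rw [this]
  simp only [Matrix.mul_assoc]

/-- The bulk identity needs long words on both sides. Left extensionality of Q supplies the missing
left one, so only the right word must be long. -/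
theorem word_mul : ∃ N, ∀ u v : List σ, N ≤ v.length →
    Q * (word B u * word B v) = word A u * (Q * word B v) := by
  obtain ⟨N, hN⟩ := hC.bulk_eq
  refine ⟨N, fun u v hv => ?_⟩
  have h0 : Q * (word B u * (word B v - P * (Q * word B v))) = 0 := by
    refine hC.left_ext_matrix N _ fun x hx => ?_
    have := hN (x ++ u) v (by rw [List.length_append]; omega) hv
    rw [word_append] at this
    rw [← Matrix.mul_assoc, Matrix.mul_sub, ← this, ← Matrix.mul_assoc _ P, sub_self]
  rw [Matrix.mul_sub, Matrix.mul_sub, sub_eq_zero] at h0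
  rw [h0, ← hC.word_eq u]
  simp only [Matrix.mul_assoc]

theorem mul_word : ∃ N, ∀ u v : List σ, N ≤ u.length →
    word B u * word B v * P = word B u * P * word A v := by
  obtain ⟨N, hN⟩ := hC.bulk_eq
  refine ⟨N, fun u v hu => ?_⟩
  have h0 : (word B u - word B u * P * Q) * word B v * P = 0 := by
    refine hC.right_ext_matrix N _ fun x hx => ?_
    have := hN u (v ++ x) hu (by rw [List.length_append]; omega)
    rw [word_append] at this
    rw [Matrix.mul_assoc, Matrix.sub_mul, ← this, Matrix.mul_assoc (_ * P), sub_self]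
  rw [Matrix.sub_mul, Matrix.sub_mul, sub_eq_zero] at h0
  rw [h0, ← hC.word_eq v]
  simp only [Matrix.mul_assoc]

theorem intertwines : Intertwines B A P := by
  obtain ⟨N, hN⟩ := hC.mul_word
  refine ⟨1, one_ne_zero, N, fun u s hu => ?_⟩
  have := hN u [s] hu
  rwa [word_singleton, word_singleton, ← one_smul ℂ (_ * P * A s)] at this

end IsCanonical

theorem Generates.exists_word_ne_zero [Nonempty ι] (hA : Generates A) (N : ℕ) :
    ∃ w : List σ, N ≤ w.length ∧ word A w ≠ 0 := by
  by_contra! h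
  have h1 : wordSpan A N = ⊥ := by
    rw [wordSpan, Submodule.span_eq_bot]
    rintro _ ⟨w, hw, rfl⟩
    exact h w hw
  rw [hA.wordSpan_eq_top] at h1
  exact top_ne_bot h1

theorem Generates.ext_linear {τ τ' : Type*} (hA : Generates A) {F F' : Matrix τ ι ℂ}
    {H H' : Matrix ι τ' ℂ} (N : ℕ)
    (h : ∀ w : List σ, N ≤ w.length → F * word A w * H = F' * word A w * H') (X : Matrix ι ι ℂ) :
    F * X * H = F' * X * H' := by
  have hX : X ∈ wordSpan A N := by rw [hA.wordSpan_eq_top]; trivial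
  induction hX using Submodule.span_induction with
  | mem x hx => obtain ⟨w, hw, rfl⟩ := hx; exact h w hw
  | zero => simp
  | add x y _ _ hx hy => simp only [Matrix.mul_add, Matrix.add_mul, hx, hy]
  | smul c x _ hx => simp only [Matrix.mul_smul, Matrix.smul_mul, hx]

/-- An arbitrary reduction need not satisfy the bulk identity itself; it is read through the one for
(Q, P). -/
theorem IsCanonical.compare [Nonempty ι] (hA : Generates A) (hC : IsCanonical B A Q P)
    (hVW : IsReduction B A V W) :
    ∃ c : ℂ, c ≠ 0 ∧ ∃ N, ∀ w : List σ, N ≤ w.length →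
      word B w * W = c • (word B w * P) ∧ V * word B w = c⁻¹ • (Q * word B w) := by
  rw [isReduction_iff] at hVW
  obtain ⟨N₀, h₀⟩ := hC.bulk_eq
  obtain ⟨N₁, h₁⟩ := hC.mul_word
  obtain ⟨N₂, h₂⟩ := hC.word_mul
  set N := max N₀ (max N₁ N₂)
  have hN0 : N₀ ≤ N := le_max_left _ _
  have hN1 : N₁ ≤ N := (le_max_left _ _).trans (le_max_right _ _)
  have hN2 : N₂ ≤ N := (le_max_right _ _).trans (le_max_right _ _)
  obtain ⟨w₀, hw₀, hne⟩ := hA.exists_word_ne_zero N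
  -- For X = A_v the product V B_u P X Q B_w W collapses to V B_u B_v B_w W = A_u A_v A_w. The words
  -- A_v span, so X is arbitrary.
  obtain ⟨c, hc, hH, hF⟩ := exists_scalar_of_mul_mul_eq (α := {u : List σ // N ≤ u.length})
    (β := {u : List σ // N ≤ u.length})
    (F := fun u => V * (word B u.1 * P)) (F' := fun u => word A u.1)
    (H := fun w => Q * word B w.1 * W) (H' := fun w => word A w.1) (by
      rintro ⟨u, hu⟩ ⟨w, hw⟩ X
      refine hA.ext_linear 0 (fun v _ => ?_) X
      have e1 : V * (word B u * P) * word A v * (Q * word B w * W) =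
          V * (word B u * P * word A v * (Q * word B w)) * W := by
        simp only [Matrix.mul_assoc]
      have e2 := h₀ (u ++ v) w (by rw [List.length_append]; omega) (by omega)
      rw [word_append] at e2
      rw [e1, ← h₁ u v (by omega), e2, ← word_append, ← word_append, hVW, word_append,
        word_append]) ⟨⟨w₀, hw₀⟩, hne⟩ ⟨⟨w₀, hw₀⟩, hne⟩
  -- PQ is inserted between two halves of length at least N; the scalar relation is applied to one
  -- of them.
  refine ⟨c, hc, 2 * N, fun w hw => ?_⟩
  have hl1 : N ≤ (w.take N).length := by rw [List.length_take]; omega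
  have hl2 : N ≤ (w.drop N).length := by rw [List.length_drop]; omega
  have e0 := h₀ (w.take N) (w.drop N) (by omega) (by omega)
  rw [← List.take_append_drop N w, word_append]
  constructor
  · rw [h₁ _ _ (by omega), ← e0, Matrix.mul_assoc, hH ⟨_, hl2⟩, Matrix.mul_smul]
  · have := hF ⟨_, hl1⟩
    simp only at this
    rw [h₂ _ _ (by omega), ← e0, ← Matrix.mul_assoc, this, Matrix.smul_mul]

theorem IsReduction.intertwines [Nonempty ι] (hA : Generates A) (h : SameTrace B A)
    (hVW : IsReduction B A V W) : Intertwines B A W := by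
  obtain ⟨Q, P, hC⟩ := exists_isCanonical hA h
  obtain ⟨c, hc, N, hN⟩ := hC.compare hA hVW
  obtain ⟨l, hl, N', hN'⟩ := hC.intertwines
  refine ⟨l, hl, max N N', fun u s hu => ?_⟩
  have h1 := (hN (u ++ [s]) (by rw [List.length_append]; omega)).1
  rw [word_append, word_singleton] at h1
  rw [h1, hN' u s (by omega), (hN u (by omega)).1, Matrix.smul_mul, smul_comm]

theorem IsReduction.evEq [Nonempty ι] (hA : Generates A) (h : SameTrace B A)
    (hVW : IsReduction B A V W) (hQP : IsReduction B A Q P) :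
    ∃ c : ℂ, c ≠ 0 ∧ EvEq B W (c • P) := by
  obtain ⟨_, _, hC⟩ := exists_isCanonical hA h
  obtain ⟨c, hc, N, hN⟩ := hC.compare hA hVW
  obtain ⟨c', hc', N', hN'⟩ := hC.compare hA hQP
  refine ⟨c * c'⁻¹, mul_ne_zero hc (inv_ne_zero hc'), max N N', fun w hw => ?_⟩
  rw [Matrix.mul_smul, (hN w (by omega)).1, (hN' w (by omega)).1, smul_smul, mul_assoc,
    inv_mul_cancel₀ hc', mul_one]

/-- Applying V gives (c - c') A_w A_s = 0 for all long w. If c ≠ c', spanning forces every A_s to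
vanish. The factor A_s is kept because the half-site comparison only controls W multiplied by
tensors. -/
theorem IsReduction.scalar_unique [Nonempty ι] (hA : Generates A) (hVW : IsReduction B A V W)
    {c c' : ℂ} (h : ∀ s, EvEq B (c • (W * A s)) (c' • (W * A s))) : c = c' := by
  rw [isReduction_iff] at hVW
  by_contra hne
  obtain ⟨s₀⟩ : Nonempty σ := by
    obtain ⟨w, hw, -⟩ := hA.exists_word_ne_zero 1
    cases w with
    | nil => simp at hw
    | cons s _ => exact ⟨s⟩
  have h1 : ∀ s, ∃ N, ∀ w : List σ, N ≤ w.length → word A w * A s = 0 := by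
    intro s
    obtain ⟨N, hN⟩ := h s
    refine ⟨N, fun w hw => ?_⟩
    have e := congrArg (V * ·) (hN w hw)
    simp only [Matrix.mul_smul, ← Matrix.mul_assoc, hVW] at e
    rw [← sub_eq_zero, ← sub_smul, smul_eq_zero] at e
    exact e.resolve_left (sub_ne_zero.2 hne)
  have h2 : ∀ s, A s = 0 := by
    intro s
    obtain ⟨N, hN⟩ := h1 s
    have := hA.ext_linear (F := 1) (F' := 0) (H := A s) (H' := A s) N (fun w hw => by
      rw [Matrix.one_mul, hN w hw, Matrix.zero_mul, Matrix.zero_mul]) 1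
    simpa using this
  obtain ⟨w, hw, hw0⟩ := hA.exists_word_ne_zero 1
  cases w with
  | nil => simp at hw
  | cons s w => exact hw0 (by rw [word_cons, h2, Matrix.zero_mul])

end comparison

/-! ### Products of matrix product operators -/

/-- The product tensor `∑ⱼ X^{ij} ⊗ Y^{jk}` for possibly rectangular virtual matrices. -/
def mpoProd {p ι ι' κ κ' : Type*} [Fintype p] (X : p × p → Matrix ι ι' ℂ)
    (Y : p × p → Matrix κ κ' ℂ) : p × p → Matrix (ι × κ) (ι' × κ') ℂ :=
  fun s => ∑ j, X (s.1, j) ⊗ₖ Y (j, s.2)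

theorem mpoMul_eq_mpoProd {p ι κ : Type*} [Fintype p] (X : p × p → Matrix ι ι ℂ)
    (Y : p × p → Matrix κ κ ℂ) : mpoMul X Y = mpoProd X Y := rfl

theorem chain_zero {σ ι : Type*} [Fintype ι] [DecidableEq ι] (A : σ → Matrix ι ι ℂ)
    (w : Fin 0 → σ) : chain A w = 1 := by simp [chain]

theorem chain_succ {σ ι : Type*} [Fintype ι] [DecidableEq ι] (A : σ → Matrix ι ι ℂ) {n : ℕ}
    (w : Fin (n + 1) → σ) : chain A w = A (w 0) * chain A (fun k => w k.succ) := by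
  simp [chain, List.ofFn_succ]

section mpo

variable {p ι κ ν : Type*} [Fintype p] [Fintype ι] [DecidableEq ι] [Fintype κ] [DecidableEq κ]
  [Fintype ν] [DecidableEq ν]

theorem chain_mpoMul (X : p × p → Matrix ι ι ℂ) (Y : p × p → Matrix κ κ ℂ) {n : ℕ}
    (w : Fin n → p × p) :
    chain (mpoMul X Y) w = ∑ j : Fin n → p, chain X (fun k => ((w k).1, j k)) ⊗ₖ
      chain Y (fun k => (j k, (w k).2)) := by
  induction n with
  | zero => simp [chain_zero]
  | succ n ih =>
    rw [chain_succ, ih, ← (Fin.consEquiv fun _ => p).sum_comp, Fintype.sum_prod_type]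
    simp only [mpoMul, Fin.consEquiv_apply, chain_succ X, chain_succ Y, Fin.cons_zero,
      Fin.cons_succ, Matrix.mul_kronecker_mul, Finset.sum_mul, Finset.mul_sum]
    rw [Finset.sum_comm]

/-- Keeping track of the lengths lets statements about long words of one factor pass to the product
tensor by linearity. -/
theorem word_mpoMul_mem_span (X : p × p → Matrix ι ι ℂ) (Y : p × p → Matrix κ κ ℂ)
    (w : List (p × p)) :
    word (mpoMul X Y) w ∈ Submodule.span ℂ {Z | ∃ a b : List (p × p), a.length = w.length ∧
      b.length = w.length ∧ Z = word X a ⊗ₖ word Y b} := by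
  rw [word_eq_chain, chain_mpoMul]
  refine Submodule.sum_mem _ fun j _ => Submodule.subset_span
    ⟨List.ofFn fun k => ((w.get k).1, j k), List.ofFn fun k => (j k, (w.get k).2), ?_, ?_, ?_⟩
  · simp
  · simp
  · rw [chain_eq_word, chain_eq_word]

theorem mpoOp_mpoMul [DecidableEq p] (X : p × p → Matrix ι ι ℂ) (Y : p × p → Matrix κ κ ℂ)
    (n : ℕ) : mpoOp (mpoMul X Y) n = mpoOp X n * mpoOp Y n := by
  ext i j
  simp [mpoOp, chain_mpoMul, Matrix.trace_sum, Matrix.trace_kronecker, Matrix.mul_apply]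

theorem sameTrace_iff_mpoOp {X : p × p → Matrix ι ι ℂ} {Y : p × p → Matrix κ κ ℂ} :
    SameTrace X Y ↔ ∀ n : ℕ, 0 < n → mpoOp X n = mpoOp Y n := by
  rw [sameTrace_iff_mpsState]
  refine forall₂_congr fun n _ => ⟨fun h => ?_, fun h => ?_⟩
  · ext i j
    exact congrFun h fun k => (i k, j k)
  · funext w
    exact congrFun (congrFun h fun k => (w k).1) fun k => (w k).2

theorem mpoOp_smul (c : ℂ) (X : p × p → Matrix ι ι ℂ) (n : ℕ) :
    mpoOp (fun s => c • X s) n = c ^ n • mpoOp X n := by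
  ext i j
  simp [mpoOp, chain_eq_word, word_smul, Matrix.trace_smul]

theorem mpoMul_smul_right (c : ℂ) (X : p × p → Matrix ι ι ℂ) (Y : p × p → Matrix κ κ ℂ) :
    mpoMul X (fun s => c • Y s) = fun s => c • mpoMul X Y s := by
  funext s
  simp [mpoMul, Matrix.kronecker_smul, Finset.smul_sum]

theorem mpoMul_smul_left (c : ℂ) (X : p × p → Matrix ι ι ℂ) (Y : p × p → Matrix κ κ ℂ) :
    mpoMul (fun s => c • X s) Y = fun s => c • mpoMul X Y s := by
  funext s
  simp [mpoMul, Matrix.smul_kronecker, Finset.smul_sum]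

theorem mpoProd_assoc {ι' κ' ν' : Type*} (X : p × p → Matrix ι ι' ℂ) (Y : p × p → Matrix κ κ' ℂ)
    (Z : p × p → Matrix ν ν' ℂ) (s : p × p) :
    mpoProd (mpoProd X Y) Z s = (mpoProd X (mpoProd Y Z) s).submatrix (Equiv.prodAssoc _ _ _)
      (Equiv.prodAssoc _ _ _) := by
  ext ⟨⟨i, k⟩, n⟩ ⟨⟨i', k'⟩, n'⟩
  simp [mpoProd, Matrix.sum_apply, Finset.sum_mul, Finset.mul_sum, mul_assoc]
  rw [Finset.sum_comm]

theorem IsReduction.mpoMul_left {B : p × p → Matrix κ κ ℂ} {A : p × p → Matrix ι ι ℂ}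
    {V : Matrix ι κ ℂ} {W : Matrix κ ι ℂ} (h : IsReduction B A V W) (C : p × p → Matrix ν ν ℂ) :
    IsReduction (mpoMul C B) (mpoMul C A) ((1 : Matrix ν ν ℂ) ⊗ₖ V) ((1 : Matrix ν ν ℂ) ⊗ₖ W) := by
  refine ⟨by rw [← Matrix.mul_kronecker_mul, h.1, Matrix.one_mul, Matrix.one_kronecker_one],
    fun n w => ?_⟩
  rw [chain_mpoMul, chain_mpoMul, Matrix.mul_sum, Matrix.sum_mul]
  refine Finset.sum_congr rfl fun j _ => ?_
  rw [← Matrix.mul_kronecker_mul, ← Matrix.mul_kronecker_mul, h.2, Matrix.one_mul, Matrix.mul_one]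

theorem IsReduction.mpoMul_right {B : p × p → Matrix κ κ ℂ} {A : p × p → Matrix ι ι ℂ}
    {V : Matrix ι κ ℂ} {W : Matrix κ ι ℂ} (h : IsReduction B A V W) (C : p × p → Matrix ν ν ℂ) :
    IsReduction (mpoMul B C) (mpoMul A C) (V ⊗ₖ (1 : Matrix ν ν ℂ)) (W ⊗ₖ (1 : Matrix ν ν ℂ)) := by
  refine ⟨by rw [← Matrix.mul_kronecker_mul, h.1, Matrix.one_mul, Matrix.one_kronecker_one],
    fun n w => ?_⟩
  rw [chain_mpoMul, chain_mpoMul, Matrix.mul_sum, Matrix.sum_mul]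
  refine Finset.sum_congr rfl fun j _ => ?_
  rw [← Matrix.mul_kronecker_mul, ← Matrix.mul_kronecker_mul, h.2, Matrix.one_mul, Matrix.mul_one]

theorem EvEq.kronecker_left {τ τ' : Type*} {B : p × p → Matrix κ κ ℂ} {M M' : Matrix κ τ ℂ}
    (h : EvEq B M M') (C : p × p → Matrix ν ν ℂ) (K : Matrix ν τ' ℂ) :
    EvEq (mpoMul C B) (K ⊗ₖ M) (K ⊗ₖ M') := by
  obtain ⟨N, hN⟩ := h
  refine ⟨N, fun w hw => ?_⟩
  have hmem := word_mpoMul_mem_span C B w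
  generalize word (mpoMul C B) w = x at hmem ⊢
  induction hmem using Submodule.span_induction with
  | mem x hx =>
    obtain ⟨a, b, -, hb, rfl⟩ := hx
    rw [← Matrix.mul_kronecker_mul, ← Matrix.mul_kronecker_mul, hN b (by omega)]
  | zero => simp
  | add x y _ _ hx hy => rw [Matrix.add_mul, Matrix.add_mul, hx, hy]
  | smul c x _ hx => rw [Matrix.smul_mul, Matrix.smul_mul, hx]

theorem EvEq.kronecker_right {τ τ' : Type*} {B : p × p → Matrix κ κ ℂ} {M M' : Matrix κ τ ℂ}
    (h : EvEq B M M') (C : p × p → Matrix ν ν ℂ) (K : Matrix ν τ' ℂ) :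
    EvEq (mpoMul B C) (M ⊗ₖ K) (M' ⊗ₖ K) := by
  obtain ⟨N, hN⟩ := h
  refine ⟨N, fun w hw => ?_⟩
  have hmem := word_mpoMul_mem_span B C w
  generalize word (mpoMul B C) w = x at hmem ⊢
  induction hmem using Submodule.span_induction with
  | mem x hx =>
    obtain ⟨a, b, ha, -, rfl⟩ := hx
    rw [← Matrix.mul_kronecker_mul, ← Matrix.mul_kronecker_mul, hN a (by omega)]
  | zero => simp
  | add x y _ _ hx hy => rw [Matrix.add_mul, Matrix.add_mul, hx, hy]
  | smul c x _ hx => rw [Matrix.smul_mul, Matrix.smul_mul, hx]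

theorem Intertwines.mpoMul_left {B : p × p → Matrix κ κ ℂ} {A : p × p → Matrix ι ι ℂ}
    {W : Matrix κ ι ℂ} (h : Intertwines B A W) (C : p × p → Matrix ν ν ℂ) :
    Intertwines (mpoMul C B) (mpoMul C A) ((1 : Matrix ν ν ℂ) ⊗ₖ W) := by
  obtain ⟨l, hl, N, hN⟩ := h
  refine ⟨l, hl, N, fun u s hu => ?_⟩
  have hmem := word_mpoMul_mem_span C B u
  generalize word (mpoMul C B) u = x at hmem ⊢
  induction hmem using Submodule.span_induction with
  | mem x hx =>
    obtain ⟨a, b, -, hb, rfl⟩ := hx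
    simp only [mpoMul, Matrix.mul_sum, Matrix.sum_mul, ← Matrix.mul_kronecker_mul, Finset.smul_sum,
      Matrix.mul_one, hN b _ (show N ≤ b.length by omega), Matrix.kronecker_smul]
  | zero => simp
  | add x y _ _ hx hy => simp only [Matrix.add_mul, hx, hy, smul_add]
  | smul c x _ hx => simp only [Matrix.smul_mul, hx, smul_comm l]

theorem Intertwines.mpoMul_right {B : p × p → Matrix κ κ ℂ} {A : p × p → Matrix ι ι ℂ}
    {W : Matrix κ ι ℂ} (h : Intertwines B A W) (C : p × p → Matrix ν ν ℂ) :
    Intertwines (mpoMul B C) (mpoMul A C) (W ⊗ₖ (1 : Matrix ν ν ℂ)) := by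
  obtain ⟨l, hl, N, hN⟩ := h
  refine ⟨l, hl, N, fun u s hu => ?_⟩
  have hmem := word_mpoMul_mem_span B C u
  generalize word (mpoMul B C) u = x at hmem ⊢
  induction hmem using Submodule.span_induction with
  | mem x hx =>
    obtain ⟨a, b, ha, -, rfl⟩ := hx
    simp only [mpoMul, Matrix.mul_sum, Matrix.sum_mul, ← Matrix.mul_kronecker_mul, Finset.smul_sum,
      Matrix.mul_one, hN a _ (show N ≤ a.length by omega), Matrix.smul_kronecker]
  | zero => simp
  | add x y _ _ hx hy => simp only [Matrix.add_mul, hx, hy, smul_add]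
  | smul c x _ hx => simp only [Matrix.smul_mul, hx, smul_comm l]

end mpo

/-! ### Composition, scaling and reindexing of reductions. -/

section general

variable {σ ι κ ν : Type*} [Fintype ι] [DecidableEq ι] [Fintype κ] [DecidableEq κ]
  [Fintype ν] [DecidableEq ν]

theorem IsReduction.trans {B : σ → Matrix κ κ ℂ} {A : σ → Matrix ι ι ℂ} {A' : σ → Matrix ν ν ℂ}
    {V : Matrix ι κ ℂ} {W : Matrix κ ι ℂ} {V' : Matrix ν ι ℂ} {W' : Matrix ι ν ℂ}
    (h : IsReduction B A V W) (h' : IsReduction A A' V' W') :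
    IsReduction B A' (V' * V) (W * W') := by
  rw [isReduction_iff] at *
  intro w
  rw [← h', ← h]
  simp only [Matrix.mul_assoc]

theorem IsReduction.smul {B : σ → Matrix κ κ ℂ} {A : σ → Matrix ι ι ℂ}
    {V : Matrix ι κ ℂ} {W : Matrix κ ι ℂ} (h : IsReduction B A V W) (c : ℂ) :
    IsReduction (fun s => c • B s) (fun s => c • A s) V W := by
  rw [isReduction_iff] at *
  intro w
  rw [word_smul, word_smul, Matrix.mul_smul, Matrix.smul_mul, h]

theorem word_submatrix (e : ι ≃ κ) (B : σ → Matrix κ κ ℂ) (w : List σ) :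
    word (fun s => (B s).submatrix e e) w = (word B w).submatrix e e := by
  induction w with
  | nil => simp
  | cons s w ih => rw [word_cons, ih, word_cons, Matrix.submatrix_mul_equiv]

theorem EvEq.submatrix {τ τ' : Type*} {B : σ → Matrix κ κ ℂ} {M M' : Matrix κ τ ℂ}
    (h : EvEq B M M') (e : ι ≃ κ) (f : τ' → τ) :
    EvEq (fun s => (B s).submatrix e e) (M.submatrix e f) (M'.submatrix e f) := by
  obtain ⟨N, hN⟩ := h
  refine ⟨N, fun w hw => ?_⟩
  rw [word_submatrix, Matrix.submatrix_mul_equiv, Matrix.submatrix_mul_equiv, hN w hw]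

theorem IsReduction.submatrix {B : σ → Matrix κ κ ℂ} {A : σ → Matrix ν ν ℂ}
    {V : Matrix ν κ ℂ} {W : Matrix κ ν ℂ} (h : IsReduction B A V W) (e : ι ≃ κ) :
    IsReduction (fun s => (B s).submatrix e e) A (V.submatrix id e) (W.submatrix e id) := by
  rw [isReduction_iff] at *
  intro w
  rw [word_submatrix, Matrix.submatrix_mul_equiv, Matrix.submatrix_mul_equiv, h]
  rfl

theorem SameTrace.symm {B : σ → Matrix κ κ ℂ} {A : σ → Matrix ι ι ℂ} (h : SameTrace B A) :
    SameTrace A B := fun w hw => (h w hw).symm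

theorem SameTrace.trans {B : σ → Matrix κ κ ℂ} {A : σ → Matrix ι ι ℂ} {C : σ → Matrix ν ν ℂ}
    (h : SameTrace B A) (h' : SameTrace A C) : SameTrace B C :=
  fun w hw => (h w hw).trans (h' w hw)

theorem Generates.smul {A : σ → Matrix ι ι ℂ} (hA : Generates A) {c : ℂ} (hc : c ≠ 0) :
    Generates (fun s => c • A s) := by
  rw [Generates, eq_top_iff, ← hA, wordSpan, Submodule.span_le]
  rintro _ ⟨w, hw, rfl⟩
  have h1 := word_mem_wordSpan (a := fun s => c • A s) w hw
  rw [word_smul] at h1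
  have h2 := Submodule.smul_mem _ (c ^ w.length)⁻¹ h1
  rwa [smul_smul, inv_mul_cancel₀ (pow_ne_zero _ hc), one_smul] at h2

end general

/-! ### Nested reductions and the pentagon identity -/

section nested

variable {α β γ δ ε ζ η θ κ : Type*} [Fintype α] [DecidableEq α] [Fintype β] [DecidableEq β]
  [Fintype γ] [DecidableEq γ] [Fintype δ] [DecidableEq δ] [Fintype ε] [DecidableEq ε]
  [Fintype ζ] [DecidableEq ζ] [Fintype η] [DecidableEq η] [Fintype θ] [DecidableEq θ]
  [Fintype κ] [DecidableEq κ]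

/-- Closing a triple product from the right: first the last two factors. -/
def nestR (W₂₃ : Matrix (β × γ) ε ℂ) (W : Matrix (α × ε) ζ ℂ) : Matrix (α × β × γ) ζ ℂ :=
  ((1 : Matrix α α ℂ) ⊗ₖ W₂₃) * W

/-- Closing a triple product from the right: first the first two factors. -/
def nestL (W₁₂ : Matrix (α × β) ε ℂ) (W : Matrix (ε × γ) ζ ℂ) : Matrix (α × β × γ) ζ ℂ :=
  ((W₁₂ ⊗ₖ (1 : Matrix γ γ ℂ)) * W).submatrix (Equiv.prodAssoc α β γ).symm id

variable {p : Type*} [Fintype p]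

theorem mpoMul_assoc_symm (A : p × p → Matrix α α ℂ) (B : p × p → Matrix β β ℂ)
    (C : p × p → Matrix γ γ ℂ) :
    mpoMul A (mpoMul B C) = fun s => (mpoMul (mpoMul A B) C s).submatrix
      (Equiv.prodAssoc α β γ).symm (Equiv.prodAssoc α β γ).symm := by
  funext s
  simp only [mpoMul_eq_mpoProd, mpoProd_assoc, Matrix.submatrix_submatrix, Equiv.self_comp_symm,
    Matrix.submatrix_id_id]

theorem Intertwines.submatrix {σ : Type*} {B : σ → Matrix β β ℂ} {A : σ → Matrix α α ℂ}
    {W : Matrix β α ℂ} (h : Intertwines B A W) (e : γ ≃ β) :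
    Intertwines (fun s => (B s).submatrix e e) A (W.submatrix e id) := by
  obtain ⟨l, hl, N, hN⟩ := h
  refine ⟨l, hl, N, fun u s hu => ?_⟩
  have : (word B u * W).submatrix e id * A s = (word B u * W * A s).submatrix e id := rfl
  rw [word_submatrix, Matrix.submatrix_mul_equiv, Matrix.submatrix_mul_equiv, hN u s hu,
    Matrix.submatrix_mul_equiv, this]
  rfl

theorem IsReduction.exists_nestR {A : p × p → Matrix α α ℂ} {B : p × p → Matrix β β ℂ}
    {C : p × p → Matrix γ γ ℂ} {E : p × p → Matrix ε ε ℂ} {F : p × p → Matrix ζ ζ ℂ} {c c' : ℂ}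
    {V₂₃ : Matrix ε (β × γ) ℂ} {W₂₃ : Matrix (β × γ) ε ℂ} {V : Matrix ζ (α × ε) ℂ}
    {W : Matrix (α × ε) ζ ℂ} (h : IsReduction (mpoMul B C) (fun s => c • E s) V₂₃ W₂₃)
    (h' : IsReduction (mpoMul A E) (fun s => c' • F s) V W) :
    ∃ V', IsReduction (mpoMul A (mpoMul B C)) (fun s => (c * c') • F s) V'
      (nestR W₂₃ W) := by
  have h1 := h.mpoMul_left A
  rw [mpoMul_smul_right] at h1
  have h2 := h1.trans (h'.smul c)
  simp only [smul_smul] at h2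
  exact ⟨_, h2⟩

theorem IsReduction.exists_nestL {A : p × p → Matrix α α ℂ} {B : p × p → Matrix β β ℂ}
    {C : p × p → Matrix γ γ ℂ} {E : p × p → Matrix ε ε ℂ} {F : p × p → Matrix ζ ζ ℂ} {c c' : ℂ}
    {V₁₂ : Matrix ε (α × β) ℂ} {W₁₂ : Matrix (α × β) ε ℂ} {V : Matrix ζ (ε × γ) ℂ}
    {W : Matrix (ε × γ) ζ ℂ} (h : IsReduction (mpoMul A B) (fun s => c • E s) V₁₂ W₁₂)
    (h' : IsReduction (mpoMul E C) (fun s => c' • F s) V W) :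
    ∃ V', IsReduction (mpoMul A (mpoMul B C)) (fun s => (c * c') • F s) V'
      (nestL W₁₂ W) := by
  have h1 := h.mpoMul_right C
  rw [mpoMul_smul_left] at h1
  have h2 := (h1.trans (h'.smul c)).submatrix (Equiv.prodAssoc α β γ).symm
  simp only [smul_smul] at h2
  rw [mpoMul_assoc_symm]
  exact ⟨_, h2⟩

theorem kronecker_assoc_symm {α' β' γ' : Type*} (K : Matrix α α' ℂ) (L : Matrix β β' ℂ)
    (M : Matrix γ γ' ℂ) : K ⊗ₖ (L ⊗ₖ M) = ((K ⊗ₖ L) ⊗ₖ M).submatrix (Equiv.prodAssoc _ _ _).symm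
      (Equiv.prodAssoc _ _ _).symm := by
  ext ⟨i, j, k⟩ ⟨i', j', k'⟩
  simp [mul_assoc]

theorem EvEq.nestR_congr {A : p × p → Matrix α α ℂ} {B : p × p → Matrix β β ℂ}
    {C : p × p → Matrix γ γ ℂ} {E : p × p → Matrix ε ε ℂ} {W₂₃ : Matrix (β × γ) ε ℂ}
    (hW : Intertwines (mpoMul B C) E W₂₃) {M M' : Matrix (α × ε) ζ ℂ}
    (h : EvEq (mpoMul A E) M M') :
    EvEq (mpoMul A (mpoMul B C)) (nestR W₂₃ M) (nestR W₂₃ M') :=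
  (hW.mpoMul_left A).evEq h

theorem EvEq.nestL_congr {A : p × p → Matrix α α ℂ} {B : p × p → Matrix β β ℂ}
    {C : p × p → Matrix γ γ ℂ} {E : p × p → Matrix ε ε ℂ} {W₁₂ : Matrix (α × β) ε ℂ}
    (hW : Intertwines (mpoMul A B) E W₁₂) {M M' : Matrix (ε × γ) ζ ℂ}
    (h : EvEq (mpoMul E C) M M') :
    EvEq (mpoMul A (mpoMul B C)) (nestL W₁₂ M) (nestL W₁₂ M') := by
  rw [mpoMul_assoc_symm]
  exact ((hW.mpoMul_right C).evEq h).submatrix _ _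

theorem nestR_smul (W₂₃ : Matrix (β × γ) ε ℂ) (M : Matrix (α × ε) ζ ℂ) (c : ℂ) :
    nestR W₂₃ (c • M) = c • nestR W₂₃ M := by
  rw [nestR, nestR, Matrix.mul_smul]

theorem nestL_smul (W₁₂ : Matrix (α × β) ε ℂ) (M : Matrix (ε × γ) ζ ℂ) (c : ℂ) :
    nestL W₁₂ (c • M) = c • nestL W₁₂ M := by
  rw [nestL, nestL, Matrix.mul_smul]
  rfl

/-- Rebracketing of a fourfold product. -/
def prodAssoc₄ (α β γ δ : Type*) : α × β × γ × δ ≃ (α × β × γ) × δ :=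
  ((Equiv.refl α).prodCongr (Equiv.prodAssoc β γ δ).symm).trans (Equiv.prodAssoc α (β × γ) δ).symm

theorem mpoMul_prodAssoc₄ (A : p × p → Matrix α α ℂ) (B : p × p → Matrix β β ℂ)
    (C : p × p → Matrix γ γ ℂ) (D : p × p → Matrix δ δ ℂ) :
    mpoMul A (mpoMul B (mpoMul C D)) = fun s => (mpoMul (mpoMul A (mpoMul B C)) D s).submatrix
      (prodAssoc₄ α β γ δ) (prodAssoc₄ α β γ δ) := by
  have h1 := mpoMul_assoc_symm A (mpoMul B C) D
  have h2 : mpoMul A (mpoMul B (mpoMul C D)) =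
      fun s => (mpoMul A (mpoMul (mpoMul B C) D) s).submatrix
        ((Equiv.refl α).prodCongr (Equiv.prodAssoc β γ δ).symm)
        ((Equiv.refl α).prodCongr (Equiv.prodAssoc β γ δ).symm) := by
    rw [mpoMul_assoc_symm B C D]
    funext s
    ext ⟨i, j⟩ ⟨i', j'⟩
    simp [mpoMul, Matrix.sum_apply]
  rw [h2, h1]
  rfl

theorem kronecker_submatrix_mul (Wbc : Matrix (β × γ) ζ ℂ) (M : Matrix (α × ζ) ε ℂ)
    (N : Matrix (ε × δ) θ ℂ) :
    ((1 : Matrix α α ℂ) ⊗ₖ (Wbc ⊗ₖ (1 : Matrix δ δ ℂ)).submatrix (Equiv.prodAssoc β γ δ).symm id) *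
      nestL M N = ((nestR Wbc M ⊗ₖ (1 : Matrix δ δ ℂ)) * N).submatrix (prodAssoc₄ α β γ δ) id := by
  have h1 : (1 : Matrix α α ℂ) ⊗ₖ (Wbc ⊗ₖ (1 : Matrix δ δ ℂ)).submatrix
      (Equiv.prodAssoc β γ δ).symm id = (((1 : Matrix α α ℂ) ⊗ₖ Wbc) ⊗ₖ
        (1 : Matrix δ δ ℂ)).submatrix (prodAssoc₄ α β γ δ) (Equiv.prodAssoc α ζ δ).symm := by
    ext ⟨i, j, k, l⟩ ⟨i', j', k'⟩
    simp [prodAssoc₄, mul_assoc]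
  rw [h1, nestL, Matrix.submatrix_mul_equiv, nestR, ← Matrix.mul_assoc,
    ← Matrix.mul_kronecker_mul, Matrix.one_mul]

theorem nestL_nestL (Wab : Matrix (α × β) ε ℂ) (M : Matrix (ε × γ) ζ ℂ)
    (N : Matrix (ζ × δ) θ ℂ) :
    nestL Wab (nestL M N) =
      ((nestL Wab M ⊗ₖ (1 : Matrix δ δ ℂ)) * N).submatrix (prodAssoc₄ α β γ δ) id := by
  have h1 : nestL Wab M ⊗ₖ (1 : Matrix δ δ ℂ) =
      ((((Wab ⊗ₖ (1 : Matrix γ γ ℂ)) * M) ⊗ₖ (1 : Matrix δ δ ℂ))).submatrix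
        ((Equiv.prodAssoc α β γ).symm.prodCongr (Equiv.refl δ)) id := by
    ext ⟨i, j⟩ ⟨i', j'⟩
    rfl
  rw [nestL, nestL, ← Matrix.one_kronecker_one, kronecker_assoc_symm, Matrix.submatrix_mul_equiv,
    ← Matrix.mul_assoc, ← Matrix.mul_kronecker_mul, Matrix.one_mul, h1,
    Matrix.submatrix_submatrix, ← Matrix.submatrix_id_id N]
  rfl

/-- The five bracketings of A B C D are joined by three associators along one side and two along the
other. Each may be applied inside a larger nesting because the remaining reduction matrices
intertwine the tensors behind long words. -/
theorem EvEq.pentagon {A : p × p → Matrix α α ℂ} {B : p × p → Matrix β β ℂ}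
    {C : p × p → Matrix γ γ ℂ} {D : p × p → Matrix δ δ ℂ}
    {AB : p × p → Matrix ε ε ℂ} {BC : p × p → Matrix ζ ζ ℂ} {CD : p × p → Matrix η η ℂ}
    {αβγ βγδ : Type*} [Fintype αβγ] [DecidableEq αβγ] [Fintype βγδ] [DecidableEq βγδ]
    {Wab : Matrix (α × β) ε ℂ} {Wbc : Matrix (β × γ) ζ ℂ} {Wcd : Matrix (γ × δ) η ℂ}
    (hab : Intertwines (mpoMul A B) AB Wab) (hbc : Intertwines (mpoMul B C) BC Wbc)
    (hcd : Intertwines (mpoMul C D) CD Wcd)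
    {Wab_c : Matrix (ε × γ) αβγ ℂ} {Wa_bc : Matrix (α × ζ) αβγ ℂ}
    {Wbc_d : Matrix (ζ × δ) βγδ ℂ} {Wb_cd : Matrix (β × η) βγδ ℂ}
    {Wabc_d : Matrix (αβγ × δ) θ ℂ} {Wa_bcd : Matrix (α × βγδ) θ ℂ} {Wab_cd : Matrix (ε × η) θ ℂ}
    {x₁ x₂ x₃ y₁ y₂ : ℂ}
    (hx₁ : EvEq (mpoMul B (mpoMul C D)) (nestR Wcd Wb_cd) (x₁ • nestL Wbc Wbc_d))
    (hx₂ : EvEq (mpoMul A (mpoMul BC D)) (nestR Wbc_d Wa_bcd) (x₂ • nestL Wa_bc Wabc_d))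
    (hx₃ : EvEq (mpoMul A (mpoMul B C)) (nestR Wbc Wa_bc) (x₃ • nestL Wab Wab_c))
    (hy₁ : EvEq (mpoMul A (mpoMul B CD)) (nestR Wb_cd Wa_bcd) (y₁ • nestL Wab Wab_cd))
    (hy₂ : EvEq (mpoMul AB (mpoMul C D)) (nestR Wcd Wab_cd) (y₂ • nestL Wab_c Wabc_d)) :
    EvEq (mpoMul A (mpoMul B (mpoMul C D)))
      ((x₁ * x₂ * x₃) • nestL Wab (nestL Wab_c Wabc_d))
      ((y₁ * y₂) • nestL Wab (nestL Wab_c Wabc_d)) := by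
  have h1 : EvEq (mpoMul A (mpoMul B (mpoMul C D)))
      (nestR (nestR Wcd Wb_cd) Wa_bcd)
      (x₁ • nestR (nestL Wbc Wbc_d) Wa_bcd) := by
    have := (hx₁.kronecker_left A (1 : Matrix α α ℂ)).mul_right Wa_bcd
    rwa [Matrix.kronecker_smul, Matrix.smul_mul] at this
  have h2 : EvEq (mpoMul A (mpoMul B (mpoMul C D)))
      (nestR (nestL Wbc Wbc_d) Wa_bcd)
      (x₂ • (((nestR Wbc Wa_bc ⊗ₖ (1 : Matrix δ δ ℂ)) * Wabc_d).submatrix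
        (prodAssoc₄ α β γ δ) id)) := by
    have hK := ((hbc.mpoMul_right D).submatrix (Equiv.prodAssoc β γ δ).symm)
    rw [← mpoMul_assoc_symm] at hK
    have := (hK.mpoMul_left A).evEq hx₂
    rw [Matrix.mul_smul] at this
    convert this using 1
    · rw [nestR, nestR, nestL, ← Matrix.mul_assoc,
        ← Matrix.mul_kronecker_mul, Matrix.one_mul]
      rfl
    · rw [kronecker_submatrix_mul]
  have h3 : EvEq (mpoMul A (mpoMul B (mpoMul C D)))
      (((nestR Wbc Wa_bc ⊗ₖ (1 : Matrix δ δ ℂ)) * Wabc_d).submatrix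
        (prodAssoc₄ α β γ δ) id)
      (x₃ • nestL Wab (nestL Wab_c Wabc_d)) := by
    have := ((hx₃.kronecker_right D (1 : Matrix δ δ ℂ)).mul_right Wabc_d).submatrix
      (prodAssoc₄ α β γ δ) id
    rw [Matrix.smul_kronecker, Matrix.smul_mul] at this
    convert this using 1
    · exact mpoMul_prodAssoc₄ A B C D
    · rw [nestL_nestL]
      rfl
  -- This edge also uses that the closings of A B and of C D act on different tensor factors and
  -- commute.
  have h4 : EvEq (mpoMul A (mpoMul B (mpoMul C D)))
      (nestR (nestR Wcd Wb_cd) Wa_bcd)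
      (y₁ • nestL Wab (nestR Wcd Wab_cd)) := by
    have := ((hcd.mpoMul_left B).mpoMul_left A).evEq hy₁
    rw [Matrix.mul_smul] at this
    convert this using 1
    · rw [nestR, nestR, nestR, ← Matrix.mul_assoc,
        ← Matrix.mul_kronecker_mul, Matrix.one_mul]
    · congr 1
      rw [kronecker_assoc_symm, nestL, nestL, nestR,
        Matrix.submatrix_mul_equiv, ← Matrix.mul_assoc, ← Matrix.mul_assoc,
        ← Matrix.mul_kronecker_mul, ← Matrix.mul_kronecker_mul, Matrix.one_kronecker_one,
        Matrix.one_mul, Matrix.one_mul, Matrix.mul_one, Matrix.mul_one]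
  have h5 := hy₂.nestL_congr hab
  rw [nestL_smul] at h5
  have h6 := (h1.trans (h2.smul x₁)).trans ((h3.smul x₂).smul x₁)
  have h7 := h4.trans (h5.smul y₁)
  rw [smul_smul, smul_smul] at h6
  rw [smul_smul] at h7
  exact h6.symm.trans h7

end nested

/-! ### The associator of labeling data -/

namespace LabelingData

variable {G p : Type*} [Group G] [Fintype p] [DecidableEq p] {E : G → ℕ}
  {T : ∀ g, p × p → Matrix (Fin (E g)) (Fin (E g)) ℂ} (d : LabelingData T)

/-- The chosen reduction matrix `W`, with the product of the group elements as a variable. -/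
def red {x y z : G} (h : x * y = z) : Matrix (Fin (d.D x) × Fin (d.D y)) (Fin (d.D z)) ℂ :=
  (d.W x y).submatrix id (Fin.cast (congrArg d.D h.symm))

theorem exists_isReduction_red {x y z : G} (h : x * y = z) :
    ∃ V, IsReduction (mpoMul (d.A x) (d.A y)) (fun s => d.lam x y • d.A z s) V (d.red h) := by
  subst h
  exact ⟨d.V x y, d.isReduction x y⟩

/-- The properties of labeling data of a one-block representation that are used for the label. -/
structure Regular : Prop where
  generates : ∀ g, Generates (d.A g)
  isUnit : ∀ g (n : ℕ), 0 < n → IsUnit (mpoOp (d.A g) n)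

variable {d} [Nonempty p] (hd : d.Regular)
include hd

theorem Regular.mpoOp_ne_zero (g : G) : mpoOp (d.A g) 1 ≠ 0 := (hd.isUnit g 1 one_pos).ne_zero

theorem Regular.nonempty (g : G) : Nonempty (Fin (d.D g)) := by
  by_contra h
  rw [not_nonempty_iff] at h
  refine hd.mpoOp_ne_zero g ?_
  ext i j
  simp [mpoOp, Matrix.trace]

theorem Regular.lam_ne_zero (g h : G) : d.lam g h ≠ 0 := by
  intro h0
  have h1 := d.mpoOp_mul g h 1 one_pos
  rw [h0, pow_one, zero_smul] at h1
  exact ((hd.isUnit g 1 one_pos).mul (hd.isUnit h 1 one_pos)).ne_zero h1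

omit hd in
theorem mpoOp_mul' {x y z : G} (h : x * y = z) {n : ℕ} (hn : 0 < n) :
    mpoOp (d.A x) n * mpoOp (d.A y) n = d.lam x y ^ n • mpoOp (d.A z) n := by
  subst h
  exact d.mpoOp_mul x y n hn

omit hd in
theorem sameTrace_mul {x y z : G} (h : x * y = z) :
    SameTrace (mpoMul (d.A x) (d.A y)) (fun s => d.lam x y • d.A z s) := by
  rw [sameTrace_iff_mpoOp]
  intro n hn
  rw [mpoOp_mpoMul, mpoOp_smul, mpoOp_mul' h hn]

omit hd in
theorem sameTrace_mul_mul {a b c bc abc : G} (h₂ : b * c = bc) (h₃ : a * bc = abc) :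
    SameTrace (mpoMul (d.A a) (mpoMul (d.A b) (d.A c)))
      (fun s => (d.lam b c * d.lam a bc) • d.A abc s) := by
  rw [sameTrace_iff_mpoOp]
  intro n hn
  rw [mpoOp_mpoMul, mpoOp_mpoMul, mpoOp_smul, mpoOp_mul' h₂ hn, Matrix.mul_smul, mpoOp_mul' h₃ hn,
    smul_smul, mul_pow]

/-- Associativity at length one, divided by a nonzero operator. It makes both nestings reductions to
the same multiple of the tensor of abc, as the comparison of reductions requires. -/
theorem Regular.lam_assoc {a b c ab bc abc : G} (h₁ : a * b = ab) (h₂ : b * c = bc)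
    (h₃ : a * bc = abc) (h₄ : ab * c = abc) :
    d.lam a b * d.lam ab c = d.lam b c * d.lam a bc := by
  have h := mul_assoc (mpoOp (d.A a) 1) (mpoOp (d.A b) 1) (mpoOp (d.A c) 1)
  rw [mpoOp_mul' h₁ one_pos, mpoOp_mul' h₂ one_pos, Matrix.smul_mul, Matrix.mul_smul,
    mpoOp_mul' h₃ one_pos, mpoOp_mul' h₄ one_pos, smul_smul, smul_smul] at h
  have := smul_left_injective ℂ (hd.mpoOp_ne_zero abc) h
  simpa using this

theorem Regular.intertwines_red {x y z : G} (h : x * y = z) :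
    Intertwines (mpoMul (d.A x) (d.A y)) (d.A z) (d.red h) := by
  have := hd.nonempty z
  obtain ⟨V, hV⟩ := d.exists_isReduction_red h
  exact (hV.intertwines ((hd.generates z).smul (hd.lam_ne_zero x y)) (sameTrace_mul h)).of_smul
    (hd.lam_ne_zero x y)

theorem Regular.exists_isReduction_nestL {a b c ab bc abc : G} (h₁ : a * b = ab) (h₂ : b * c = bc)
    (h₃ : a * bc = abc) (h₄ : ab * c = abc) :
    ∃ V, IsReduction (mpoMul (d.A a) (mpoMul (d.A b) (d.A c)))
      (fun s => (d.lam b c * d.lam a bc) • d.A abc s) V (nestL (d.red h₁) (d.red h₄)) := by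
  obtain ⟨V₁, hV₁⟩ := d.exists_isReduction_red h₁
  obtain ⟨V₄, hV₄⟩ := d.exists_isReduction_red h₄
  have := hV₁.exists_nestL hV₄
  rwa [hd.lam_assoc h₁ h₂ h₃ h₄] at this

theorem Regular.exists_associator {a b c ab bc abc : G} (h₁ : a * b = ab) (h₂ : b * c = bc)
    (h₃ : a * bc = abc) (h₄ : ab * c = abc) :
    ∃ ω : ℂ, ω ≠ 0 ∧ EvEq (mpoMul (d.A a) (mpoMul (d.A b) (d.A c)))
      (nestR (d.red h₂) (d.red h₃)) (ω • nestL (d.red h₁) (d.red h₄)) := by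
  have := hd.nonempty abc
  obtain ⟨V₂, hV₂⟩ := d.exists_isReduction_red h₂
  obtain ⟨V₃, hV₃⟩ := d.exists_isReduction_red h₃
  obtain ⟨V, hV⟩ := hV₂.exists_nestR hV₃
  obtain ⟨V', hV'⟩ := hd.exists_isReduction_nestL h₁ h₂ h₃ h₄
  exact hV.evEq ((hd.generates abc).smul (mul_ne_zero (hd.lam_ne_zero b c) (hd.lam_ne_zero a bc)))
    (sameTrace_mul_mul h₂ h₃) hV'

-- Treating the products in G as variables constrained by equations confines the casts between
-- differently bracketed products to this equivalence.
omit hd in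
theorem isAssociator_iff {ω : G → G → G → ℂˣ} :
    d.IsAssociator ω ↔ ∀ {a b c ab bc abc : G} (h₁ : a * b = ab) (h₂ : b * c = bc)
      (h₃ : a * bc = abc) (h₄ : ab * c = abc),
      EvEq (mpoMul (d.A a) (mpoMul (d.A b) (d.A c)))
        (nestR (d.red h₂) (d.red h₃)) ((ω a b c : ℂ) • nestL (d.red h₁) (d.red h₄)) := by
  have key : ∀ (g h k : G) {n : ℕ} (w : Fin n → p × p),
      d.rightNested g h k w = chain (mpoMul (d.A g) (mpoMul (d.A h) (d.A k))) w *
        nestR (d.red (rfl : h * k = h * k)) (d.red (rfl : g * (h * k) = g * (h * k))) ∧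
      (d.leftNested g h k w).submatrix (Equiv.prodAssoc _ _ _).symm
        (Fin.cast (congrArg d.D (mul_assoc g h k).symm)) =
        chain (mpoMul (d.A g) (mpoMul (d.A h) (d.A k))) w *
          nestL (d.red (rfl : g * h = g * h)) (d.red (mul_assoc g h k)) := by
    intro g h k n w
    constructor
    · rw [rightNested, nestR, Matrix.mul_assoc]
      rfl
    · rw [leftNested, nestL, mpoMul_assoc_symm, chain_eq_word, chain_eq_word, word_submatrix,
        Matrix.submatrix_mul_equiv, Matrix.mul_assoc]
      rfl
  constructor
  · intro hω a b c ab bc abc h₁ h₂ h₃ h₄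
    subst h₁ h₂ h₃
    obtain ⟨N, hN⟩ := hω a b c
    refine ⟨N, fun w hw => ?_⟩
    have := hN w.length hw w.get
    rw [(key _ _ _ _).1, (key _ _ _ _).2, ← word_eq_chain] at this
    rw [this, Matrix.mul_smul]
  · intro hω g h k
    obtain ⟨N, hN⟩ := hω (rfl : g * h = g * h) (rfl : h * k = h * k) rfl (mul_assoc g h k)
    refine ⟨N, fun n hn w => ?_⟩
    have := hN (List.ofFn w) (by simpa using hn)
    rw [(key _ _ _ _).1, (key _ _ _ _).2, chain_eq_word, this, Matrix.mul_smul]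

theorem Regular.exists_isAssociator :
    ∃ ω : G → G → G → ℂˣ, ∀ ω', d.IsAssociator ω' ↔ ω' = ω := by
  choose ω hω0 hω using fun a b c : G =>
    hd.exists_associator (a := a) (b := b) (c := c) rfl rfl rfl (mul_assoc a b c)
  refine ⟨fun a b c => Units.mk0 (ω a b c) (hω0 a b c), fun ω' => ⟨fun h => ?_, ?_⟩⟩
  · funext a b c
    ext
    have h1 := isAssociator_iff.1 h (rfl : a * b = a * b) (rfl : b * c = b * c) rfl
      (mul_assoc a b c)
    have h2 := h1.symm.trans (hω a b c)
    have := hd.nonempty (a * (b * c))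
    obtain ⟨V, hV⟩ := hd.exists_isReduction_nestL (a := a) (b := b) (c := c) rfl rfl rfl
      (mul_assoc a b c)
    refine hV.scalar_unique ((hd.generates _).smul
      (mul_ne_zero (hd.lam_ne_zero b c) (hd.lam_ne_zero a (b * c)))) fun s => ?_
    rw [← Matrix.smul_mul, ← Matrix.smul_mul]
    exact h2.mul_right _
  · rintro rfl
    rw [isAssociator_iff]
    intro a b c ab bc abc h₁ h₂ h₃ h₄
    subst h₁ h₂ h₃
    exact hω a b c

/-- The pentagon compares two multiples of the same fourfold nesting. That nesting is again part of
a reduction, so its scalar is unique. -/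
theorem Regular.associator_cocycle {ω : G → G → G → ℂˣ} (hω : d.IsAssociator ω) (a b c e : G) :
    ω b c e * ω a (b * c) e * ω a b c = ω a b (c * e) * ω (a * b) c e := by
  have hω' := @isAssociator_iff.1 hω
  ext
  have hassoc : a * b * c * e = a * (b * (c * e)) := by simp only [mul_assoc]
  have hbce : b * c * e = b * (c * e) := mul_assoc _ _ _
  have h := EvEq.pentagon
    (hd.intertwines_red (rfl : a * b = a * b)) (hd.intertwines_red (rfl : b * c = b * c))
    (hd.intertwines_red (rfl : c * e = c * e))
    (hω' rfl rfl (rfl : b * (c * e) = b * (c * e)) hbce)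
    (hω' (rfl : a * (b * c) = a * (b * c)) hbce (rfl : a * (b * (c * e)) = a * (b * (c * e)))
      (by simp only [mul_assoc]))
    (hω' (rfl : a * b = a * b) (rfl : b * c = b * c) rfl (mul_assoc a b c))
    (hω' (rfl : a * b = a * b) rfl rfl (by simp only [mul_assoc] : a * b * (c * e) = _))
    (hω' (by simp only [mul_assoc] : a * b * c = a * (b * c)) rfl _ (by simp only [mul_assoc]))
  have := hd.nonempty (a * (b * (c * e)))
  have hV₁ := d.exists_isReduction_red (rfl : a * b = a * b)
  obtain ⟨V₁, hV₁⟩ := hV₁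
  obtain ⟨V₂, hV₂⟩ := hd.exists_isReduction_nestL (a := a * b) (b := c) (c := e)
    (ab := a * (b * c)) (bc := c * e) (abc := a * (b * (c * e))) (mul_assoc a b c) rfl
    (mul_assoc a b _) (by simp only [mul_assoc])
  obtain ⟨V, hV⟩ := hV₁.exists_nestL hV₂
  have hne : d.lam a b * (d.lam c e * d.lam (a * b) (c * e)) ≠ 0 :=
    mul_ne_zero (hd.lam_ne_zero _ _) (mul_ne_zero (hd.lam_ne_zero _ _) (hd.lam_ne_zero _ _))
  rw [Units.val_mul, Units.val_mul, Units.val_mul]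
  refine hV.scalar_unique ((hd.generates _).smul hne) fun s => ?_
  rw [← Matrix.smul_mul, ← Matrix.smul_mul]
  exact h.mul_right _

end LabelingData

/-! ### Alternating chains -/

/-- The word with letters `(s, t₁), (s₁, t₂), …, (sₙ, t)` obtained by shifting
`(t₁, s₁), …, (tₙ, sₙ)` by half a site. -/
def shiftWord {σ τ : Type*} : σ → List (τ × σ) → τ → List (σ × τ)
  | s, [], t => [(s, t)]
  | s, (t', s') :: w, t => (s, t') :: shiftWord s' w t

@[simp] theorem length_shiftWord {σ τ : Type*} (s : σ) (w : List (τ × σ)) (t : τ) :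
    (shiftWord s w t).length = w.length + 1 := by
  induction w generalizing s with
  | nil => rfl
  | cons x w ih => simp [shiftWord, ih]

section concat

variable {σ τ ι κ : Type*} [Fintype ι] [DecidableEq ι] [Fintype κ] [DecidableEq κ]

theorem word_shiftWord (X : σ → Matrix ι κ ℂ) (Y : τ → Matrix κ ι ℂ) (s : σ) (w : List (τ × σ))
    (t : τ) : word (concat X Y) (shiftWord s w t) = X s * word (concat Y X) w * Y t := by
  induction w generalizing s with
  | nil => simp [shiftWord, concat]
  | cons x w ih =>
    rw [shiftWord, word_cons, word_cons, ih]
    simp only [concat, Matrix.mul_assoc]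

/-- An alternating chain can be blocked from either end; this carries statements about long words of
one blocking to the other. -/
theorem exists_mul_word_concat (X : σ → Matrix ι κ ℂ) (Y : τ → Matrix κ ι ℂ) (s : σ)
    (w : List (τ × σ)) : ∃ (u : List (σ × τ)) (s' : σ), u.length = w.length ∧
      X s * word (concat Y X) w = word (concat X Y) u * X s' := by
  induction w generalizing s with
  | nil => exact ⟨[], s, rfl, by simp⟩
  | cons x w ih =>
    obtain ⟨u, s', hu, h⟩ := ih x.2
    refine ⟨(s, x.1) :: u, s', by simp [hu], ?_⟩
    rw [word_cons, word_cons, Matrix.mul_assoc, ← h]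
    simp only [concat, Matrix.mul_assoc]

theorem exists_word_concat_mul (X : σ → Matrix ι κ ℂ) (Y : τ → Matrix κ ι ℂ)
    (w : List (σ × τ)) (s : σ) : ∃ (s' : σ) (u : List (τ × σ)), u.length = w.length ∧
      word (concat X Y) w * X s = X s' * word (concat Y X) u := by
  induction w generalizing s with
  | nil => exact ⟨s, [], rfl, by simp⟩
  | cons x w ih =>
    obtain ⟨s', u, hu, h⟩ := ih s
    refine ⟨x.1, (x.2, s') :: u, by simp [hu], ?_⟩
    rw [word_cons, word_cons, Matrix.mul_assoc, h]
    simp only [concat, Matrix.mul_assoc]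

theorem EvEq.concat_mul {ν : Type*} {X : σ → Matrix ι κ ℂ} {Y : τ → Matrix κ ι ℂ}
    {M M' : Matrix κ ν ℂ} (h : EvEq (concat Y X) M M') (s : σ) :
    EvEq (concat X Y) (X s * M) (X s * M') := by
  obtain ⟨N, hN⟩ := h
  refine ⟨N, fun w hw => ?_⟩
  obtain ⟨s', u, hu, h⟩ := exists_word_concat_mul X Y w s
  rw [← Matrix.mul_assoc, ← Matrix.mul_assoc, h, Matrix.mul_assoc, Matrix.mul_assoc,
    hN u (by omega)]

theorem SameTrace.concat_swap {ι' κ' : Type*} [Fintype ι'] [DecidableEq ι'] [Fintype κ']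
    [DecidableEq κ'] {X : σ → Matrix ι κ ℂ} {Y : τ → Matrix κ ι ℂ} {X' : σ → Matrix ι' κ' ℂ}
    {Y' : τ → Matrix κ' ι' ℂ} (h : SameTrace (concat X Y) (concat X' Y')) :
    SameTrace (concat Y X) (concat Y' X') := by
  intro w hw
  cases w with
  | nil => exact absurd rfl hw
  | cons x w =>
    have := h (shiftWord x.2 w x.1) fun h0 => by
      have := congrArg List.length h0
      simp at this
    rw [word_shiftWord, word_shiftWord, Matrix.trace_mul_comm,
      Matrix.trace_mul_comm _ (Y' x.1)] at this
    rw [word_cons, word_cons]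
    simpa only [concat, Matrix.mul_assoc] using this

variable {α β : Type*} [Fintype α] [DecidableEq α] [Fintype β] [DecidableEq β]

/-- Between long words, 1 - P'Q' in the middle of X_s Y_t is a bulk defect of the other blocking and
vanishes. Extensionality of Q and P removes the long words. -/
theorem IsCanonical.mul_concat {X : σ → Matrix ι κ ℂ} {Y : τ → Matrix κ ι ℂ}
    {A : σ × τ → Matrix α α ℂ} {A' : τ × σ → Matrix β β ℂ} {Q : Matrix α ι ℂ} {P : Matrix ι α ℂ}
    {Q' : Matrix β κ ℂ} {P' : Matrix κ β ℂ} (hC : IsCanonical (concat X Y) A Q P)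
    (hC' : IsCanonical (concat Y X) A' Q' P') (s : σ) (t : τ) :
    (Q * X s * P') * (Q' * Y t * P) = A (s, t) := by
  obtain ⟨N, hN⟩ := hC'.bulk
  have h0 : Q * (X s * (1 - P' * Q') * Y t * P) = 0 := by
    refine hC.left_ext_matrix N _ fun u hu => ?_
    have h1 : word (concat X Y) u * X s * (1 - P' * Q') * Y t * P = 0 := by
      refine hC.right_ext_matrix N _ fun v hv => ?_
      obtain ⟨s', u', hu', e⟩ := exists_word_concat_mul X Y u s
      obtain ⟨v', t', hv', e'⟩ := exists_mul_word_concat Y X t v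
      have : X s' * (word (concat Y X) u' * (1 - P' * Q') * word (concat Y X) v') * Y t' = 0 := by
        rw [hN u' v' (by omega) (by omega), Matrix.mul_zero, Matrix.zero_mul]
      rw [e, Matrix.mul_assoc _ (Y t), e', ← this]
      simp only [Matrix.mul_assoc]
    rw [← h1]
    simp only [Matrix.mul_assoc]
  have h2 := hC.word_eq [(s, t)]
  rw [word_singleton, word_singleton] at h2
  rw [← h2, ← sub_eq_zero, ← neg_eq_zero, neg_sub, ← h0]
  simp only [concat, Matrix.mul_sub, Matrix.sub_mul, Matrix.mul_one, Matrix.mul_assoc]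

/-- The normal tensors of the two ways of blocking an alternating chain factorize compatibly. -/
theorem exists_factorization [Nonempty α] [Nonempty β] {X : σ → Matrix ι κ ℂ}
    {Y : τ → Matrix κ ι ℂ} {A : σ × τ → Matrix α α ℂ} {A' : τ × σ → Matrix β β ℂ}
    (hA : Generates A) (hA' : Generates A') (h : SameTrace (concat X Y) A)
    (h' : SameTrace (concat Y X) A') :
    ∃ (X' : σ → Matrix α β ℂ) (Y' : τ → Matrix β α ℂ), concat X' Y' = A ∧ concat Y' X' = A' := by
  obtain ⟨Q, P, hC⟩ := exists_isCanonical hA h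
  obtain ⟨Q', P', hC'⟩ := exists_isCanonical hA' h'
  refine ⟨fun s => Q * X s * P', fun t => Q' * Y t * P, ?_, ?_⟩
  · funext ⟨s, t⟩
    exact hC.mul_concat hC' s t
  · funext ⟨t, s⟩
    exact hC'.mul_concat hC t s

theorem Generates.exists_concat_ne_zero [Nonempty α] {A : σ → Matrix α β ℂ}
    {B : τ → Matrix β α ℂ} (h : Generates (concat A B)) : (∃ s, A s ≠ 0) ∧ ∃ t, B t ≠ 0 := by
  obtain ⟨w, hw, hne⟩ := h.exists_word_ne_zero 1
  cases w with
  | nil => simp at hw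
  | cons x w =>
    rw [word_cons] at hne
    refine ⟨⟨x.1, fun h0 => hne ?_⟩, ⟨x.2, fun h0 => hne ?_⟩⟩ <;> simp [concat, h0]

/-- A_s (BA)_w B_t is a word of AB, hence unchanged by the primes. Spanning by (BA)_w gives A'_s Z
B'_t = A_s Z B_t for every Z, and the factors separate. -/
theorem exists_smul_of_concat_eq [Nonempty α] [Nonempty β] {A A' : σ → Matrix α β ℂ}
    {B B' : τ → Matrix β α ℂ} (hAB : Generates (concat A B)) (hBA : Generates (concat B A))
    (h : concat A' B' = concat A B) (h' : concat B' A' = concat B A) :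
    ∃ c : ℂ, c ≠ 0 ∧ ∀ s, A' s = c • A s := by
  obtain ⟨hA, hB⟩ := hAB.exists_concat_ne_zero
  obtain ⟨c, hc, -, hF⟩ := exists_scalar_of_mul_mul_eq (F := A') (F' := A) (H := B') (H' := B)
    (fun s t Z => hBA.ext_linear 0 (fun w _ => by
      rw [← word_shiftWord, ← h, word_shiftWord, h']) Z) hA hB
  exact ⟨c⁻¹, inv_ne_zero hc, hF⟩

/-- Reductions of the two blockings of an alternating chain are compatible up to a scalar. -/
theorem exists_evEq_of_isReduction_concat [Nonempty α] [Nonempty β] {A : σ → Matrix α β ℂ}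
    {B : τ → Matrix β α ℂ} {C : σ → Matrix ι κ ℂ} {D : τ → Matrix κ ι ℂ}
    (hAB : Generates (concat A B)) (hBA : Generates (concat B A))
    (h : SameTrace (concat C D) (concat A B)) {V : Matrix α ι ℂ} {W : Matrix ι α ℂ}
    {V' : Matrix β κ ℂ} {W' : Matrix κ β ℂ} (hVW : IsReduction (concat C D) (concat A B) V W)
    (hVW' : IsReduction (concat D C) (concat B A) V' W') :
    ∃ c : ℂ, c ≠ 0 ∧ ∀ s, EvEq (concat C D) (W * A s) (c • (C s * W')) := by
  obtain ⟨Q, P, hC⟩ := exists_isCanonical hAB h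
  obtain ⟨Q', P', hC'⟩ := exists_isCanonical hBA h.concat_swap
  obtain ⟨a, ha, hWP⟩ := hVW.evEq hAB h hC.isReduction
  obtain ⟨b, hb, hPW⟩ := hC'.isReduction.evEq hBA h.concat_swap hVW'
  obtain ⟨c, hc, hCA⟩ := exists_smul_of_concat_eq (A' := fun s => Q * C s * P')
    (B' := fun t => Q' * D t * P) hAB hBA (funext fun x => hC.mul_concat hC' x.1 x.2)
    (funext fun x => hC'.mul_concat hC x.1 x.2)
  -- Only a left word is available for the bulk identity; right extensionality of P' provides the
  -- right one, after a half-site shift past C_s.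
  have hbulk : ∀ s, EvEq (concat C D) (P * (Q * C s * P')) (C s * P') := by
    intro s
    obtain ⟨N, hN⟩ := hC.bulk
    refine ⟨N, fun w hw => ?_⟩
    have h1 : word (concat C D) w * (1 - P * Q) * C s * P' = 0 := by
      refine hC'.right_ext_matrix N _ fun v hv => ?_
      obtain ⟨u, s', hu, e⟩ := exists_mul_word_concat C D s v
      rw [Matrix.mul_assoc, e, ← Matrix.mul_assoc, hN w u hw (by omega), Matrix.zero_mul]
    rw [← sub_eq_zero, ← neg_eq_zero, neg_sub, ← h1]
    simp only [Matrix.mul_sub, Matrix.sub_mul, Matrix.mul_one, Matrix.mul_assoc]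
  refine ⟨a * (c⁻¹ * b), mul_ne_zero ha (mul_ne_zero (inv_ne_zero hc) hb), fun s => ?_⟩
  have h1 := hWP.mul_right (A s)
  have h2 : P * A s = c⁻¹ • (P * (Q * C s * P')) := by
    rw [hCA, Matrix.mul_smul, smul_smul, inv_mul_cancel₀ hc, one_smul]
  rw [Matrix.smul_mul, h2] at h1
  have h3 := (hbulk s).trans (hPW.concat_mul s)
  rw [Matrix.mul_smul] at h3
  have h4 := h1.trans ((h3.smul c⁻¹).smul a)
  rwa [smul_smul, smul_smul, mul_assoc] at h4

theorem exists_scalar_chain_concat [Finite σ] [Nonempty α] [Nonempty β] {A : σ → Matrix α β ℂ}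
    {B : τ → Matrix β α ℂ} {C : σ → Matrix ι κ ℂ} {D : τ → Matrix κ ι ℂ}
    (hAB : Generates (concat A B)) (hBA : Generates (concat B A))
    (h : SameTrace (concat C D) (concat A B)) {V : Matrix α ι ℂ} {W : Matrix ι α ℂ}
    {V' : Matrix β κ ℂ} {W' : Matrix κ β ℂ} (hVW : IsReduction (concat C D) (concat A B) V W)
    (hVW' : IsReduction (concat D C) (concat B A) V' W') :
    ∃ (c : ℂ) (N : ℕ), ∀ k ≥ N, ∀ (w : Fin k → σ × τ) (s : σ),
      chain (concat A B) w * A s = c • (V * (chain (concat C D) w * C s) * W') := by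
  cases nonempty_fintype σ
  obtain ⟨c, -, hc⟩ := exists_evEq_of_isReduction_concat hAB hBA h hVW hVW'
  choose N hN using hc
  -- The threshold depends on s; finiteness of the physical index makes it uniform.
  refine ⟨c, Finset.univ.sup N, fun k hk w s => ?_⟩
  have h1 := hN s (List.ofFn w) (by
    rw [List.length_ofFn]
    exact (Finset.le_sup (Finset.mem_univ s)).trans hk)
  rw [isReduction_iff] at hVW
  rw [chain_eq_word, chain_eq_word, ← hVW, Matrix.mul_assoc, Matrix.mul_assoc, h1,
    Matrix.mul_smul, Matrix.mul_smul]
  simp only [Matrix.mul_assoc]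

end concat

/-! ### Comparing the labels of the two blockings -/

section relabel

variable {σ τ ι κ : Type*} [Fintype ι] [DecidableEq ι] [Fintype κ] [DecidableEq κ]

theorem word_comp {R : Type*} [Monoid R] (a : τ → R) (φ : σ → τ) (w : List σ) :
    word (fun s => a (φ s)) w = word a (w.map φ) := by
  simp [word, Function.comp_def]

theorem SameTrace.comp {B : τ → Matrix κ κ ℂ} {A : τ → Matrix ι ι ℂ} (h : SameTrace B A)
    (φ : σ → τ) : SameTrace (fun s => B (φ s)) (fun s => A (φ s)) := fun w hw => by
  rw [word_comp B, word_comp A, h _ (by simpa using hw)]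

theorem IsReduction.comp {B : τ → Matrix κ κ ℂ} {A : τ → Matrix ι ι ℂ} {V : Matrix ι κ ℂ}
    {W : Matrix κ ι ℂ} (h : IsReduction B A V W) (φ : σ → τ) :
    IsReduction (fun s => B (φ s)) (fun s => A (φ s)) V W := by
  rw [isReduction_iff] at *
  intro w
  rw [word_comp B, word_comp A, h]

theorem EvEq.comp {ν : Type*} {B : τ → Matrix κ κ ℂ} {M M' : Matrix κ ν ℂ} (h : EvEq B M M')
    (φ : σ → τ) : EvEq (fun s => B (φ s)) M M' := by
  obtain ⟨N, hN⟩ := h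
  exact ⟨N, fun w hw => by rw [word_comp, hN _ (by simpa using hw)]⟩

theorem Generates.comp_equiv {A : τ → Matrix ι ι ℂ} (h : Generates A) (φ : σ ≃ τ) :
    Generates (fun s => A (φ s)) := by
  rw [Generates, eq_top_iff, ← h, wordSpan, Submodule.span_le]
  rintro _ ⟨w, hw, rfl⟩
  have := word_mem_wordSpan (a := fun s => A (φ s)) (N := 1) (w.map φ.symm) (by simpa using hw)
  rwa [word_comp, List.map_map, Equiv.self_comp_symm, List.map_id] at this

end relabel

theorem mpoConcat_eq {p q ι κ : Type*} [Fintype κ] (X : p × p → Matrix ι κ ℂ)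
    (Y : q × q → Matrix κ ι ℂ) :
    mpoConcat X Y = fun s => concat X Y (Equiv.prodProdProdComm p q p q s) := rfl

section mpo

variable {p q ι κ : Type*} [Fintype ι] [DecidableEq ι] [Fintype κ] [DecidableEq κ]

theorem EvEq.mpoConcat_mul {ν : Type*} {X : p × p → Matrix ι κ ℂ} {Y : q × q → Matrix κ ι ℂ}
    {M M' : Matrix κ ν ℂ} (h : EvEq (mpoConcat Y X) M M') (s : p × p) :
    EvEq (mpoConcat X Y) (X s * M) (X s * M') :=
  ((h.comp (Equiv.prodProdProdComm q q p p)).concat_mul s).comp (Equiv.prodProdProdComm p q p q)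

theorem mpoMul_mpoConcat [Fintype p] [Fintype q] {ι' κ' : Type*} [Fintype ι'] [DecidableEq ι']
    [Fintype κ'] [DecidableEq κ'] (X : p × p → Matrix ι κ ℂ) (Y : q × q → Matrix κ ι ℂ)
    (X' : p × p → Matrix ι' κ' ℂ) (Y' : q × q → Matrix κ' ι' ℂ) :
    mpoMul (mpoConcat X Y) (mpoConcat X' Y') = mpoConcat (mpoProd X X') (mpoProd Y Y') := by
  funext s
  simp only [mpoMul, mpoConcat, mpoProd, Fintype.sum_prod_type, Matrix.mul_kronecker_mul,
    Matrix.sum_mul, Matrix.mul_sum]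
  rw [Finset.sum_comm]

theorem exists_mpoConcat_factorization {α β : Type*} [Fintype α] [DecidableEq α] [Fintype β]
    [DecidableEq β] [Nonempty α] [Nonempty β] {X : p × p → Matrix ι κ ℂ}
    {Y : q × q → Matrix κ ι ℂ} {A : (p × q) × (p × q) → Matrix α α ℂ}
    {A' : (q × p) × (q × p) → Matrix β β ℂ} (hA : Generates A) (hA' : Generates A')
    (h : SameTrace (mpoConcat X Y) A) (h' : SameTrace (mpoConcat Y X) A') :
    ∃ (X' : p × p → Matrix α β ℂ) (Y' : q × q → Matrix β α ℂ),
      mpoConcat X' Y' = A ∧ mpoConcat Y' X' = A' := by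
  obtain ⟨X', Y', h1, h2⟩ := exists_factorization (X := X) (Y := Y)
    (hA.comp_equiv (Equiv.prodProdProdComm p p q q))
    (hA'.comp_equiv (Equiv.prodProdProdComm q q p p)) (h.comp (Equiv.prodProdProdComm p p q q))
    (h'.comp (Equiv.prodProdProdComm q q p p))
  refine ⟨X', Y', ?_, ?_⟩
  · rw [mpoConcat_eq, h1]
    rfl
  · rw [mpoConcat_eq, h2]
    rfl

end mpo

/-! ### Moving half-site tensors through nested reductions. -/

section nested

variable {α β γ ε ζ α' β' γ' ε' ζ' p : Type*} [Fintype p]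
  [Fintype α] [DecidableEq α] [Fintype β] [DecidableEq β] [Fintype γ] [DecidableEq γ]
  [Fintype ε] [DecidableEq ε] [Fintype ζ] [DecidableEq ζ] [Fintype α'] [DecidableEq α']
  [Fintype β'] [DecidableEq β'] [Fintype γ'] [DecidableEq γ'] [Fintype ε'] [DecidableEq ε']
  [Fintype ζ'] [DecidableEq ζ']
  {Xa : p × p → Matrix α α' ℂ} {Xb : p × p → Matrix β β' ℂ} {Xc : p × p → Matrix γ γ' ℂ}
  {Xe : p × p → Matrix ε ε' ℂ} {Xf : p × p → Matrix ζ ζ' ℂ} {c₁ c₂ : ℂ}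

/-- The tensor Xf passes the outer reduction, becoming a product of Xa and Xe, and then Xe passes
the inner one. Each passage contributes its own scalar. -/
theorem EvEq.nestR_mul {r : Type*} [Fintype r]
    {A : r × r → Matrix α α ℂ} {B : r × r → Matrix β β ℂ}
    {C : r × r → Matrix γ γ ℂ} {E : r × r → Matrix ε ε ℂ}
    {W₂₃ : Matrix (β × γ) ε ℂ} {W : Matrix (α × ε) ζ ℂ} {W₂₃' : Matrix (β' × γ') ε' ℂ}
    {W' : Matrix (α' × ε') ζ' ℂ} (hW : Intertwines (mpoMul B C) E W₂₃)
    (h₁ : ∀ s, EvEq (mpoMul B C) (W₂₃ * Xe s) (c₁ • (mpoProd Xb Xc s * W₂₃')))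
    (h₂ : ∀ s, EvEq (mpoMul A E) (W * Xf s) (c₂ • (mpoProd Xa Xe s * W'))) (s : p × p) :
    EvEq (mpoMul A (mpoMul B C)) (nestR W₂₃ W * Xf s)
      ((c₁ * c₂) • (mpoProd Xa (mpoProd Xb Xc) s * nestR W₂₃' W')) := by
  have h3 := (h₂ s).nestR_congr hW
  have h4 : EvEq (mpoMul A (mpoMul B C)) (nestR W₂₃ (mpoProd Xa Xe s * W'))
      (c₁ • (mpoProd Xa (mpoProd Xb Xc) s * nestR W₂₃' W')) := by
    have h5 := (EvEq.sum Finset.univ fun j =>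
      (h₁ (j, s.2)).kronecker_left A (Xa (s.1, j))).mul_right W'
    convert h5 using 1
    · rw [nestR, ← Matrix.mul_assoc, mpoProd, Matrix.mul_sum]
      simp only [← Matrix.mul_kronecker_mul, Matrix.one_mul]
    · rw [nestR, ← Matrix.mul_assoc]
      simp only [Matrix.kronecker_smul]
      rw [← Finset.smul_sum, Matrix.smul_mul]
      congr 2
      rw [mpoProd, Matrix.sum_mul]
      simp only [← Matrix.mul_kronecker_mul, Matrix.mul_one]
  rw [nestR_smul] at h3
  have h6 := h3.trans (h4.smul c₂)
  rw [smul_smul, mul_comm c₂] at h6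
  rwa [nestR, Matrix.mul_assoc]

theorem EvEq.nestL_mul {r : Type*} [Fintype r]
    {A : r × r → Matrix α α ℂ} {B : r × r → Matrix β β ℂ}
    {C : r × r → Matrix γ γ ℂ} {E : r × r → Matrix ε ε ℂ}
    {W₁₂ : Matrix (α × β) ε ℂ} {W : Matrix (ε × γ) ζ ℂ} {W₁₂' : Matrix (α' × β') ε' ℂ}
    {W' : Matrix (ε' × γ') ζ' ℂ} (hW : Intertwines (mpoMul A B) E W₁₂)
    (h₁ : ∀ s, EvEq (mpoMul A B) (W₁₂ * Xe s) (c₁ • (mpoProd Xa Xb s * W₁₂')))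
    (h₂ : ∀ s, EvEq (mpoMul E C) (W * Xf s) (c₂ • (mpoProd Xe Xc s * W'))) (s : p × p) :
    EvEq (mpoMul A (mpoMul B C)) (nestL W₁₂ W * Xf s)
      ((c₁ * c₂) • (mpoProd Xa (mpoProd Xb Xc) s * nestL W₁₂' W')) := by
  have h3 := (h₂ s).nestL_congr hW
  have h4 : EvEq (mpoMul A (mpoMul B C)) (nestL W₁₂ (mpoProd Xe Xc s * W'))
      (c₁ • (mpoProd Xa (mpoProd Xb Xc) s * nestL W₁₂' W')) := by
    have h5 := ((EvEq.sum Finset.univ fun j =>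
      (h₁ (s.1, j)).kronecker_right C (Xc (j, s.2))).mul_right W').submatrix
        (Equiv.prodAssoc α β γ).symm id
    rw [mpoMul_assoc_symm]
    convert h5 using 1
    · rw [nestL, ← Matrix.mul_assoc, mpoProd, Matrix.mul_sum]
      simp only [← Matrix.mul_kronecker_mul, Matrix.one_mul]
    · have h6 : mpoProd Xa (mpoProd Xb Xc) s = (mpoProd (mpoProd Xa Xb) Xc s).submatrix
          (Equiv.prodAssoc _ _ _).symm (Equiv.prodAssoc _ _ _).symm := by
        rw [mpoProd_assoc]
        simp
      rw [nestL, h6, Matrix.submatrix_mul_equiv, ← Matrix.mul_assoc]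
      simp only [Matrix.smul_kronecker]
      rw [← Finset.smul_sum, Matrix.smul_mul]
      change _ = (c₁ • (_ : Matrix ((α × β) × γ) ζ' ℂ)).submatrix _ _
      congr 3
      rw [mpoProd, Matrix.sum_mul]
      simp only [← Matrix.mul_kronecker_mul, Matrix.mul_one]
      rfl
  rw [nestL_smul] at h3
  have h6 := h3.trans (h4.smul c₂)
  rw [smul_smul, mul_comm c₂] at h6
  convert h6 using 1
  rw [nestL, nestL, ← Matrix.mul_assoc]
  rfl

end nested

/-! ### The half-site shift of operators -/

theorem shiftWord_ofFn {σ τ : Type*} (s : σ) (t : τ) {m : ℕ} (v : Fin m → τ × σ) :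
    shiftWord s (List.ofFn v) t = List.ofFn fun k : Fin (m + 1) =>
      ((Fin.cons s fun j => (v j).2 : Fin (m + 1) → σ) k,
        (Fin.snoc (fun j => (v j).1) t : Fin (m + 1) → τ) k) := by
  induction m generalizing s with
  | zero => simp [shiftWord, Fin.snoc]
  | succ m ih =>
    rw [List.ofFn_succ, shiftWord, ih]
    conv_rhs => rw [List.ofFn_succ]
    refine congrArg₂ List.cons ?_ (congrArg List.ofFn (funext fun k => Prod.ext ?_ ?_))
    · refine Prod.ext rfl ?_
      exact (Fin.snoc_castSucc (α := fun _ => τ) t (fun j => (v j).1) 0).symm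
    · refine Fin.cases ?_ (fun j => ?_) k <;> simp
    · refine Fin.lastCases ?_ (fun j => ?_) k
      · simp only [Fin.snoc_last, Fin.succ_last]
      · simp only [Fin.snoc_castSucc, ← Fin.castSucc_succ]

/-- Cyclicity moves the first Y to the end, pairing each X with the Y of the next site; hence the
rotation of only one of the two indices. -/
theorem trace_chain_concat_swap {σ τ ι κ : Type*} [Fintype ι] [DecidableEq ι] [Fintype κ]
    [DecidableEq κ] (X : σ → Matrix ι κ ℂ) (Y : τ → Matrix κ ι ℂ) {n : ℕ} (hn : 0 < n)
    (w : Fin n → τ × σ) :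
    (chain (concat Y X) w).trace =
      (chain (concat X Y) fun k => ((w k).2, (w (finRotate n k)).1)).trace := by
  obtain ⟨m, rfl⟩ := Nat.exists_eq_succ_of_ne_zero hn.ne'
  have h : (List.ofFn fun k => ((w k).2, (w (finRotate (m + 1) k)).1)) =
      shiftWord (w 0).2 (List.ofFn fun k : Fin m => w k.succ) (w 0).1 := by
    rw [shiftWord_ofFn]
    congr 1
    funext k
    refine Prod.ext ?_ ?_
    · refine Fin.cases ?_ (fun j => ?_) k <;> simp
    · simp only [Fin.snoc_eq_cons_rotate]
      generalize finRotate (m + 1) k = l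
      refine Fin.cases ?_ (fun j => ?_) l <;> simp
  rw [chain_eq_word, chain_eq_word, h, word_shiftWord, List.ofFn_succ, word_cons,
    Matrix.trace_mul_comm _ (Y _)]
  simp only [concat, Matrix.mul_assoc]

/-- The half-site shift of configurations. -/
def shiftEquiv (p q : Type*) (n : ℕ) : (Fin n → q × p) ≃ (Fin n → p × q) where
  toFun i k := ((i k).2, (i (finRotate n k)).1)
  invFun j k := ((j ((finRotate n).symm k)).2, (j k).1)
  left_inv i := funext fun k => by simp only [Equiv.apply_symm_apply]
  right_inv j := funext fun k => by simp only [Equiv.symm_apply_apply]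

theorem mpoOp_mpoConcat_swap {p q ι κ : Type*} [Fintype ι] [DecidableEq ι] [Fintype κ]
    [DecidableEq κ] (X : p × p → Matrix ι κ ℂ) (Y : q × q → Matrix κ ι ℂ) {n : ℕ} (hn : 0 < n) :
    mpoOp (mpoConcat Y X) n =
      (mpoOp (mpoConcat X Y) n).submatrix (shiftEquiv p q n) (shiftEquiv p q n) := by
  ext i j
  exact trace_chain_concat_swap X Y hn fun k => (((i k).1, (j k).1), ((i k).2, (j k).2))

/-- The half-site shift permutes configurations, so all operators are simultaneously conjugated and
the same λ serves. -/
theorem IsOneBlockProjRep.swap {G p q : Type*} [Group G] [Fintype p] [DecidableEq p] [Fintype q]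
    [DecidableEq q] {D₁ D₂ : G → ℕ} {X : ∀ g, p × p → Matrix (Fin (D₁ g)) (Fin (D₂ g)) ℂ}
    {Y : ∀ g, q × q → Matrix (Fin (D₂ g)) (Fin (D₁ g)) ℂ}
    (h : IsOneBlockProjRep fun g => mpoConcat (X g) (Y g)) :
    IsOneBlockProjRep fun g => mpoConcat (Y g) (X g) := by
  obtain ⟨h1, lam, h2⟩ := h
  refine ⟨fun g n hn => ?_, lam, fun g k n hn => ?_⟩
  · beta_reduce
    rw [mpoOp_mpoConcat_swap (X g) (Y g) hn, Matrix.isUnit_submatrix_equiv]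
    exact h1 g n hn
  · beta_reduce
    rw [mpoOp_mpoConcat_swap (X g) (Y g) hn, mpoOp_mpoConcat_swap (X k) (Y k) hn,
      mpoOp_mpoConcat_swap (X (g * k)) (Y (g * k)) hn, Matrix.submatrix_mul_equiv]
    exact congrArg (fun M : Matrix (Fin n → p × q) (Fin n → p × q) ℂ =>
      M.submatrix (shiftEquiv p q n) (shiftEquiv p q n)) (h2 g k n hn)

namespace LabelingData

variable {G p q : Type*} [Group G] [Fintype p] [DecidableEq p] [Fintype q] [DecidableEq q]
  [Nonempty p] [Nonempty q] {E E' : G → ℕ}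
  {T : ∀ g, (p × q) × (p × q) → Matrix (Fin (E g)) (Fin (E g)) ℂ}
  {T' : ∀ g, (q × p) × (q × p) → Matrix (Fin (E' g)) (Fin (E' g)) ℂ}
  {d : LabelingData T} {d' : LabelingData T'}

theorem lam_eq_of_factorization (hd' : d'.Regular)
    {X : ∀ g, p × p → Matrix (Fin (d.D g)) (Fin (d'.D g)) ℂ}
    {Y : ∀ g, q × q → Matrix (Fin (d'.D g)) (Fin (d.D g)) ℂ}
    (hXY : ∀ g, mpoConcat (X g) (Y g) = d.A g) (hYX : ∀ g, mpoConcat (Y g) (X g) = d'.A g)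
    (a b : G) : d.lam a b = d'.lam a b := by
  have h1 := d.mpoOp_mul a b 1 one_pos
  have h2 := d'.mpoOp_mul a b 1 one_pos
  have h3 := hd'.mpoOp_ne_zero (a * b)
  simp only [← hYX, mpoOp_mpoConcat_swap _ _ one_pos, hXY] at h2 h3
  rw [Matrix.submatrix_mul_equiv, h1, pow_one, pow_one] at h2
  have h4 := smul_left_injective ℂ h3 (a₁ := d.lam a b) (a₂ := d'.lam a b) h2
  exact h4

/-- The cochain c(x,y) is the scalar by which X fails to commute with the chosen reductions for x,
y. Passing X through the two nestings gives the products c(y,z) c(x,yz) and c(x,y) c(xy,z). -/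
theorem exists_coboundary (hd : d.Regular) (hd' : d'.Regular)
    {X : ∀ g, p × p → Matrix (Fin (d.D g)) (Fin (d'.D g)) ℂ}
    {Y : ∀ g, q × q → Matrix (Fin (d'.D g)) (Fin (d.D g)) ℂ}
    (hXY : ∀ g, mpoConcat (X g) (Y g) = d.A g) (hYX : ∀ g, mpoConcat (Y g) (X g) = d'.A g)
    {ω ω' : G → G → G → ℂˣ} (hω : d.IsAssociator ω) (hω' : d'.IsAssociator ω') :
    ∃ c : G → G → ℂˣ, ∀ x y z : G,
      ω x y z * (c x y * c (x * y) z) = ω' x y z * (c y z * c x (y * z)) := by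
  have hcross : ∀ x y : G, ∃ c : ℂ, c ≠ 0 ∧ ∀ {xy : G} (h : x * y = xy) (s : p × p),
      EvEq (mpoMul (d.A x) (d.A y)) (d.red h * X xy s)
        (c • (mpoProd (X x) (X y) s * d'.red h)) := by
    intro x y
    have := hd.nonempty (x * y)
    have := hd'.nonempty (x * y)
    have hne := hd.lam_ne_zero x y
    have e1 : mpoMul (d.A x) (d.A y) = mpoConcat (mpoProd (X x) (X y)) (mpoProd (Y x) (Y y)) := by
      rw [← hXY, ← hXY, mpoMul_mpoConcat]
    have e2 : mpoMul (d'.A x) (d'.A y) =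
        mpoConcat (mpoProd (Y x) (Y y)) (mpoProd (X x) (X y)) := by
      rw [← hYX, ← hYX, mpoMul_mpoConcat]
    -- The scalar λ(x,y) is absorbed into X in both blockings, which requires the two λ to coincide.
    -- The factor λ⁻¹ in the final scalar undoes this.
    have f1 : (fun s => d.lam x y • d.A (x * y) s) =
        mpoConcat (fun s => d.lam x y • X (x * y) s) (Y (x * y)) := by
      funext s
      rw [← hXY]
      simp only [mpoConcat, Matrix.smul_mul]
    have f2 : (fun s => d'.lam x y • d'.A (x * y) s) =
        mpoConcat (Y (x * y)) (fun s => d.lam x y • X (x * y) s) := by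
      funext s
      rw [← hYX, lam_eq_of_factorization hd' hXY hYX]
      simp only [mpoConcat, Matrix.mul_smul]
    obtain ⟨V, hV⟩ := d.exists_isReduction_red (rfl : x * y = x * y)
    obtain ⟨V', hV'⟩ := d'.exists_isReduction_red (rfl : x * y = x * y)
    have ht := d.sameTrace_mul (rfl : x * y = x * y)
    have hg := (hd.generates (x * y)).smul hne
    have hg' := (hd'.generates (x * y)).smul (hd'.lam_ne_zero x y)
    rw [e1, f1] at hV ht
    rw [e2, f2] at hV'
    rw [f1] at hg
    rw [f2] at hg'
    obtain ⟨c, hc, hcc⟩ := exists_evEq_of_isReduction_concat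
      (A := fun s => d.lam x y • X (x * y) s) (B := Y (x * y)) (C := mpoProd (X x) (X y))
      (D := mpoProd (Y x) (Y y))
      (hg.comp_equiv (Equiv.prodProdProdComm p p q q))
      (hg'.comp_equiv (Equiv.prodProdProdComm q q p p))
      (ht.comp (Equiv.prodProdProdComm p p q q)) (hV.comp (Equiv.prodProdProdComm p p q q))
      (hV'.comp (Equiv.prodProdProdComm q q p p))
    refine ⟨(d.lam x y)⁻¹ * c, mul_ne_zero (inv_ne_zero hne) hc, fun {xy} h s => ?_⟩
    subst h
    have h1 := ((hcc s).comp (Equiv.prodProdProdComm p q p q)).smul (d.lam x y)⁻¹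
    rw [Matrix.mul_smul, smul_smul, inv_mul_cancel₀ hne, one_smul, smul_smul] at h1
    rw [e1]
    exact h1
  choose c hc0 hc using hcross
  refine ⟨fun x y => Units.mk0 (c x y) (hc0 x y), fun x y z => ?_⟩
  ext
  rw [Units.val_mul, Units.val_mul, Units.val_mul, Units.val_mul]
  simp only [Units.val_mk0]
  have hassoc : x * y * z = x * (y * z) := mul_assoc x y z
  have := hd.nonempty (x * (y * z))
  obtain ⟨V, hV⟩ := hd.exists_isReduction_nestL (rfl : x * y = x * y) (rfl : y * z = y * z) rfl
    hassoc
  set K := nestL (d.red (rfl : x * y = x * y)) (d.red hassoc) with hK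
  have hR := fun s => EvEq.nestR_mul (hd.intertwines_red (rfl : y * z = y * z))
    (hc y z (rfl : y * z = y * z)) (hc x (y * z) (rfl : x * (y * z) = x * (y * z))) s
  have hL := fun s => EvEq.nestL_mul (hd.intertwines_red (rfl : x * y = x * y))
    (hc x y (rfl : x * y = x * y)) (hc (x * y) z hassoc) s
  have e := (isAssociator_iff.1 hω) (rfl : x * y = x * y) (rfl : y * z = y * z) rfl hassoc
  have e' := (isAssociator_iff.1 hω') (rfl : x * y = x * y) (rfl : y * z = y * z) rfl hassoc
  have t1 : mpoMul (d.A x) (mpoMul (d.A y) (d.A z)) =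
      mpoConcat (mpoProd (X x) (mpoProd (X y) (X z))) (mpoProd (Y x) (mpoProd (Y y) (Y z))) := by
    rw [← hXY, ← hXY, ← hXY, mpoMul_mpoConcat, mpoMul_mpoConcat]
  have t2 : mpoMul (d'.A x) (mpoMul (d'.A y) (d'.A z)) =
      mpoConcat (mpoProd (Y x) (mpoProd (Y y) (Y z))) (mpoProd (X x) (mpoProd (X y) (X z))) := by
    rw [← hYX, ← hYX, ← hYX, mpoMul_mpoConcat, mpoMul_mpoConcat]
  have key : ∀ s, EvEq (mpoMul (d.A x) (mpoMul (d.A y) (d.A z)))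
      ((ω x y z * (c x y * c (x * y) z)) • (K * X (x * (y * z)) s))
      ((ω' x y z * (c y z * c x (y * z))) • (K * X (x * (y * z)) s)) := by
    intro s
    have h1 := e.mul_right (X (x * (y * z)) s)
    rw [Matrix.smul_mul] at h1
    have h2 := (t2 ▸ e').mpoConcat_mul s
    rw [← t1] at h2
    rw [Matrix.mul_smul] at h2
    have h3 := (h1.symm.trans (hR s)).trans (h2.smul _)
    -- Cross-multiplication brings both expressions to the same multiple of the shifted left nesting
    -- without division.
    have h4 := h3.smul (c x y * c (x * y) z)
    have h5 := (hL s).smul (c y z * c x (y * z) * ω' x y z)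
    rw [smul_smul] at h4
    rw [smul_smul, smul_smul] at h4
    rw [smul_smul] at h5
    have h6 := h4.trans ((EvEq.of_eq (by congr 1; ring)).trans h5.symm)
    convert h6 using 1 <;> congr 1 <;> ring
  refine hV.scalar_unique ((hd.generates _).smul (mul_ne_zero (hd.lam_ne_zero y z)
    (hd.lam_ne_zero x (y * z)))) fun s => ?_
  have h7 := ((key (s.1.1, s.2.1)).mul_right (Y (x * (y * z)) (s.1.2, s.2.2))).smul
    (d.lam y z * d.lam x (y * z))
  have h8 : d.A (x * (y * z)) s =
      X (x * (y * z)) (s.1.1, s.2.1) * Y (x * (y * z)) (s.1.2, s.2.2) := by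
    rw [← hXY]
    rfl
  rw [h8]
  convert h7 using 1 <;>
    simp only [Matrix.smul_mul, Matrix.mul_smul, Matrix.mul_assoc, smul_smul] <;> congr 1 <;> ring

end LabelingData

/-! ### Irreducible and normal tensors -/

section normal

variable {σ ι : Type*} [Fintype ι] [DecidableEq ι] {A : σ → Matrix ι ι ℂ}

theorem wordSpan_zero_eq_top_of_irreducible [Nonempty ι]
    (hA : ∀ U : Submodule ℂ (ι → ℂ), (∀ s, ∀ v ∈ U, (A s).mulVec v ∈ U) → U = ⊥ ∨ U = ⊤) :
    wordSpan A 0 = ⊤ := by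
  let S : Subalgebra ℂ (Matrix ι ι ℂ) :=
    (wordSpan A 0).toSubalgebra one_mem_wordSpan fun x y hx hy => by
      simpa using mul_mem_wordSpan (M := 0) (N := 0) hx hy
  have hS : S = ⊤ := subalgebra_eq_top_of_irreducible S fun U hU =>
    hA U fun s v hv => hU (A s) (by
      have := word_mem_wordSpan (a := A) [s] (Nat.zero_le _)
      rwa [word_singleton] at this) v hv
  rw [eq_top_iff]
  intro x _
  have : x ∈ S := hS ▸ Algebra.mem_top
  exact this

/-- Burnside gives all matrices once the empty word is allowed. Nonempty words then span a two-sided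
ideal, which contains a nonzero A_s and hence every matrix unit. -/
theorem generates_of_irreducible [Nonempty ι]
    (hA : ∀ U : Submodule ℂ (ι → ℂ), (∀ s, ∀ v ∈ U, (A s).mulVec v ∈ U) → U = ⊥ ∨ U = ⊤)
    (h0 : ∃ s, A s ≠ 0) : Generates A := by
  have htop := wordSpan_zero_eq_top_of_irreducible hA
  obtain ⟨s, hs⟩ := h0
  obtain ⟨i, j, hij⟩ : ∃ i j, A s i j ≠ 0 := by
    by_contra! h
    exact hs (Matrix.ext h)
  have hmem : A s ∈ wordSpan A 1 := by
    have := word_mem_wordSpan (a := A) [s] le_rfl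
    rwa [word_singleton] at this
  have hideal : ∀ x y : Matrix ι ι ℂ, x * A s * y ∈ wordSpan A 1 := fun x y =>
    mul_mem_wordSpan (M := 1) (N := 0)
      (mul_mem_wordSpan (M := 0) (N := 1) (htop ▸ Submodule.mem_top) hmem)
      (htop ▸ Submodule.mem_top)
  rw [Generates, eq_top_iff]
  intro x _
  rw [Matrix.matrix_eq_sum_single x]
  refine Submodule.sum_mem _ fun k _ => Submodule.sum_mem _ fun l _ => ?_
  have := Submodule.smul_mem _ (x k l * (A s i j)⁻¹) (hideal (Matrix.single k i 1)
    (Matrix.single j l 1))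
  convert this using 1
  rw [Matrix.single_mul_mul_single, Matrix.smul_single]
  congr 1
  simp [hij]

/-- For v in an invariant subspace U, iterates of v v† keep their range in U. One of them is
positive definite, hence invertible, so U is everything. -/
theorem IsNormal.generates [Fintype σ] [Nonempty ι] (h : IsNormal A) : Generates A := by
  obtain ⟨n, hn, hpos⟩ := h
  refine generates_of_irreducible (fun U hU => ?_) ?_
  · rw [or_iff_not_imp_left]
    intro hbot
    obtain ⟨v, hv, hv0⟩ := Submodule.exists_mem_ne_zero_of_ne_bot hbot
    have hstep : ∀ (k : ℕ) (ρ : Matrix ι ι ℂ), (∀ x, ρ.mulVec x ∈ U) →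
        ∀ x, ((transfer A)^[k] ρ).mulVec x ∈ U := by
      intro k
      induction k with
      | zero => exact fun ρ h => h
      | succ k ih =>
        intro ρ hρ
        refine ih _ fun x => ?_
        rw [transfer, Matrix.sum_mulVec]
        refine Submodule.sum_mem _ fun s _ => ?_
        rw [Matrix.mul_assoc, ← Matrix.mulVec_mulVec, ← Matrix.mulVec_mulVec]
        exact hU s _ (hρ _)
    have hρ := hpos (Matrix.vecMulVec v (star v)) (Matrix.posSemidef_vecMulVec_self_star v) (by
      intro h
      obtain ⟨i, hi⟩ := Function.ne_iff.1 hv0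
      have := congrFun (congrFun h i) i
      simp [Matrix.vecMulVec_apply] at this
      exact hi this)
    rw [eq_top_iff]
    intro x _
    have h1 := hstep n (Matrix.vecMulVec v (star v)) (fun x => by
      rw [Matrix.vecMulVec_mulVec, op_smul_eq_smul]
      exact Submodule.smul_mem _ _ hv)
        (((transfer A)^[n] (Matrix.vecMulVec v (star v)))⁻¹.mulVec x)
    rwa [Matrix.mulVec_mulVec, Matrix.mul_nonsing_inv _ ((Matrix.isUnit_iff_isUnit_det _).1
      hρ.isUnit), Matrix.one_mulVec] at h1
  · by_contra! h0
    have h1 := hpos 1 Matrix.PosSemidef.one one_ne_zero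
    obtain ⟨m, rfl⟩ := Nat.exists_eq_succ_of_ne_zero hn.ne'
    rw [Function.iterate_succ_apply'] at h1
    have h2 : transfer A ((transfer A)^[m] 1) = 0 := by simp [transfer, h0]
    rw [h2] at h1
    exact not_isUnit_zero h1.isUnit

theorem posSemidef_transfer [Fintype σ] {ρ : Matrix ι ι ℂ} (hρ : ρ.PosSemidef) :
    (transfer A ρ).PosSemidef :=
  Matrix.posSemidef_sum _ fun s _ => hρ.mul_mul_conjTranspose_same (A s)

theorem dotProduct_word_eq_zero_of_transfer_iterate [Fintype σ] (n : ℕ) :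
    ∀ (ρ : Matrix ι ι ℂ), ρ.PosSemidef → ∀ x : ι → ℂ,
      star x ⬝ᵥ ((transfer A)^[n] ρ).mulVec x = 0 → ∀ w : List σ, w.length = n →
        ρ.mulVec ((word A w)ᴴ.mulVec x) = 0 := by
  induction n with
  | zero =>
    intro ρ hρ x hx w hw
    rw [List.length_eq_zero_iff.1 hw, word_nil, Matrix.conjTranspose_one, Matrix.one_mulVec]
    exact (hρ.dotProduct_mulVec_zero_iff x).1 hx
  | succ n ih =>
    intro ρ hρ x hx w hw
    obtain rfl | ⟨u, s, rfl⟩ := List.eq_nil_or_concat' w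
    · simp at hw
    have h1 := ih (transfer A ρ) (posSemidef_transfer hρ) x hx u (by simpa using hw)
    set y := (word A u)ᴴ.mulVec x with hy
    have h2 : star y ⬝ᵥ (transfer A ρ).mulVec y = 0 := by rw [h1, dotProduct_zero]
    rw [transfer, Matrix.sum_mulVec, dotProduct_sum, Finset.sum_eq_zero_iff_of_nonneg
      fun t _ => (hρ.mul_mul_conjTranspose_same (A t)).dotProduct_mulVec_nonneg y] at h2
    have h3 := h2 s (Finset.mem_univ s)
    rw [word_append, word_singleton, Matrix.conjTranspose_mul, ← Matrix.mulVec_mulVec, ← hy]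
    refine (hρ.dotProduct_mulVec_zero_iff _).1 ?_
    rw [← h3, Matrix.star_mulVec, Matrix.conjTranspose_conjTranspose, ← Matrix.dotProduct_mulVec,
      Matrix.mulVec_mulVec, Matrix.mulVec_mulVec, Matrix.mul_assoc]

/-- If x is a null vector of the n-th iterate of ρ, positivity of each summand gives ρ A_w† x = 0
for all words of length n. For x ≠ 0 the vectors M† x fill the space, so ρ = 0. -/
theorem isNormal_of_span_eq_top [Fintype σ] {n : ℕ} (hn : 0 < n)
    (h : Submodule.span ℂ {x | ∃ w : List σ, w.length = n ∧ word A w = x} = ⊤) :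
    IsNormal A := by
  refine ⟨n, hn, fun ρ hρ hρ0 => ?_⟩
  have hpsd : ∀ k, ((transfer A)^[k] ρ).PosSemidef := by
    intro k
    induction k with
    | zero => exact hρ
    | succ k ih => rw [Function.iterate_succ_apply']; exact posSemidef_transfer ih
  refine Matrix.PosDef.of_dotProduct_mulVec_pos (hpsd n).1 fun x hx0 => ?_
  refine lt_of_le_of_ne ((hpsd n).dotProduct_mulVec_nonneg x) fun h0 => hρ0 ?_
  have h1 := dotProduct_word_eq_zero_of_transfer_iterate n ρ hρ x h0.symm
  have h2 : ∀ M : Matrix ι ι ℂ, ρ.mulVec (Mᴴ.mulVec x) = 0 := by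
    intro M
    have hM : M ∈ Submodule.span ℂ {x | ∃ w : List σ, w.length = n ∧ word A w = x} :=
      h ▸ Submodule.mem_top
    induction hM using Submodule.span_induction with
    | mem M hM => obtain ⟨w, hw, rfl⟩ := hM; exact h1 w hw
    | zero => simp
    | add M N _ _ hM hN =>
      rw [Matrix.conjTranspose_add, Matrix.add_mulVec, Matrix.mulVec_add, hM, hN, add_zero]
    | smul c M _ hM =>
      rw [Matrix.conjTranspose_smul, Matrix.smul_mulVec, Matrix.mulVec_smul, hM, smul_zero]
  obtain ⟨i, hi⟩ := Function.ne_iff.1 hx0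
  ext k j
  have h3 := congrFun (h2 (Matrix.single i j (star (x i))⁻¹)) k
  rw [Matrix.conjTranspose_single] at h3
  have h4 : (Matrix.single j i (star (star (x i))⁻¹)).mulVec x = Pi.single j 1 := by
    rw [Matrix.single_mulVec]
    have hi' : x i ≠ 0 := hi
    simp [hi', Pi.single]
  rw [h4] at h3
  simpa using h3

end normal

/-! ### Compression of a tensor -/

/-- Factor e = PQ with QP = 1 through its range. The tensor Q T P has the traces of e T e by
cyclicity, and its bond dimension is the rank of e. -/
theorem exists_compression {σ ι : Type*} [Fintype ι] [DecidableEq ι] {e : Matrix ι ι ℂ}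
    (he : IsIdempotentElem e) (h1 : e ≠ 1) (T : σ → Matrix ι ι ℂ) :
    ∃ r < Fintype.card ι, ∃ T' : σ → Matrix (Fin r) (Fin r) ℂ,
      SameTrace T' fun s => e * T s * e := by
  obtain ⟨r, hr, P, Q, hQP, hPQ⟩ : ∃ r < Fintype.card ι, ∃ (P : Matrix ι (Fin r) ℂ)
      (Q : Matrix (Fin r) ι ℂ), Q * P = 1 ∧ P * Q = e := by
    have he' : IsIdempotentElem (Matrix.toLin' e) := by
      unfold IsIdempotentElem
      rw [Module.End.mul_eq_comp, ← Matrix.toLin'_mul, he.eq]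
    let U := LinearMap.range (Matrix.toLin' e)
    let b := Module.finBasis ℂ U
    have hU : U ≠ ⊤ := by
      intro hU
      refine h1 ?_
      have hsurj := LinearMap.range_eq_top.1 hU
      have : Matrix.toLin' e = Matrix.toLin' 1 := by
        rw [Matrix.toLin'_one]
        refine LinearMap.ext fun x => ?_
        obtain ⟨y, rfl⟩ := hsurj x
        exact LinearMap.congr_fun he'.eq y
      exact Matrix.toLin'.injective this
    refine ⟨Module.finrank ℂ U, ?_, LinearMap.toMatrix b (Pi.basisFun ℂ ι) U.subtype,
      LinearMap.toMatrix (Pi.basisFun ℂ ι) b (Matrix.toLin' e).rangeRestrict, ?_, ?_⟩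
    · have := Submodule.finrank_lt hU
      rwa [Module.finrank_fintype_fun_eq_card] at this
    · rw [← LinearMap.toMatrix_comp, ← LinearMap.toMatrix_id b]
      congr 1
      ext ⟨_, y, rfl⟩ : 2
      exact LinearMap.congr_fun he'.eq y
    · rw [← LinearMap.toMatrix_comp]
      exact LinearMap.toMatrix'_toLin' e
  refine ⟨r, hr, fun s => Q * T s * P, fun w hw => ?_⟩
  have hword : ∀ w : List σ, P * word (fun s => Q * T s * P) w * Q =
      e * word (fun s => e * T s * e) w := by
    intro w
    induction w with
    | nil => simp [hPQ]
    | cons s w ih =>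
      rw [word_cons, word_cons]
      calc P * (Q * T s * P * word (fun s => Q * T s * P) w) * Q
          = P * Q * T s * (P * word (fun s => Q * T s * P) w * Q) := by
            simp only [Matrix.mul_assoc]
        _ = e * (e * T s * e * word (fun s => e * T s * e) w) := by
            rw [ih, hPQ]
            nth_rewrite 1 [← he.eq]
            simp only [Matrix.mul_assoc]
  have habs : e * word (fun s => e * T s * e) w = word (fun s => e * T s * e) w := by
    cases w with
    | nil => exact absurd rfl hw
    | cons s w =>
      rw [word_cons, ← Matrix.mul_assoc, ← Matrix.mul_assoc, ← Matrix.mul_assoc, he.eq]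
  rw [← habs, ← hword, Matrix.trace_mul_comm, ← Matrix.mul_assoc, hQP, Matrix.one_mul]

/-! ### Invertible matrix product operators have a normal tensor -/

theorem chain_smul_one {σ ι : Type*} [Fintype ι] [DecidableEq ι] (f : σ → ℂ) {n : ℕ}
    (w : Fin n → σ) :
    chain (fun s => f s • (1 : Matrix ι ι ℂ)) w = (∏ k, f (w k)) • (1 : Matrix ι ι ℂ) := by
  induction n with
  | zero => simp [chain_zero]
  | succ n ih => rw [chain_succ, ih, Fin.prod_univ_succ, Matrix.smul_mul, Matrix.one_mul, smul_smul]

/-- The tensor of bond dimension one that generates the operators `μⁿ`. -/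
def unitTensor (p : Type*) [DecidableEq p] (μ : ℂ) : p × p → Matrix Unit Unit ℂ :=
  fun s => (if s.1 = s.2 then μ else 0) • 1

theorem unitTensor_eq (p : Type*) [DecidableEq p] (μ : ℂ) :
    unitTensor p μ = fun s => (if s.1 = s.2 then μ else 0) • 1 := rfl

section invertible

variable {p ι κ : Type*} [Fintype p] [DecidableEq p] [Fintype ι] [DecidableEq ι] [Fintype κ]
  [DecidableEq κ]

theorem mpoOp_unitTensor (μ : ℂ) (n : ℕ) : mpoOp (unitTensor p μ) n = μ ^ n • 1 := by
  ext i j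
  rw [mpoOp, Matrix.of_apply, unitTensor_eq, chain_smul_one]
  simp only [Finset.prod_ite_zero, Finset.mem_univ, true_implies, Matrix.smul_apply,
    Matrix.one_apply, funext_iff]
  split_ifs <;> simp

theorem generates_unitTensor [Nonempty p] {μ : ℂ} (hμ : μ ≠ 0) : Generates (unitTensor p μ) := by
  obtain ⟨a⟩ := ‹Nonempty p›
  rw [Generates, eq_top_iff]
  intro x _
  have h : word (unitTensor p μ) [(a, a)] ∈ wordSpan (unitTensor p μ) 1 :=
    word_mem_wordSpan _ le_rfl
  rw [word_singleton] at h
  convert Submodule.smul_mem _ (x () () * μ⁻¹) h using 1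
  ext
  rw [unitTensor_eq]
  simp [hμ]

/-- The tensor is block triangular for e. The empty word is excluded because its compressed versions
are full identities, not the projections e and 1 - e. -/
theorem trace_word_eq_add {σ : Type*} {T : σ → Matrix ι ι ℂ} {e : Matrix ι ι ℂ}
    (he : IsIdempotentElem e) (hT : ∀ s, (1 - e) * T s * e = 0) {w : List σ} (hw : w ≠ []) :
    (word T w).trace = (word (fun s => e * T s * e) w).trace +
      (word (fun s => (1 - e) * T s * (1 - e)) w).trace := by
  set f := 1 - e with hf
  have hff : f * f = f := he.one_sub.eq
  have h1 : ∀ s, T s * e = e * T s * e := fun s => by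
    have := hT s
    rw [hf, Matrix.sub_mul, Matrix.sub_mul, Matrix.one_mul, sub_eq_zero] at this
    exact this
  have h2 : ∀ s, f * T s = f * T s * f := fun s => by
    nth_rewrite 3 [hf]
    rw [Matrix.mul_sub, hT s, Matrix.mul_one, sub_zero]
  have h3 : ∀ w : List σ, word T w * e = e * word (fun s => e * T s * e) w := by
    intro w
    induction w with
    | nil => simp
    | cons s w ih =>
      rw [word_cons, word_cons, Matrix.mul_assoc, ih, ← Matrix.mul_assoc, h1,
        ← Matrix.mul_assoc, ← Matrix.mul_assoc, ← Matrix.mul_assoc, he.eq]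
  have h4 : ∀ w : List σ, f * word T w = f * word (fun s => f * T s * f) w * f := by
    intro w
    induction w with
    | nil => simp [hff]
    | cons s w ih =>
      rw [word_cons, word_cons, ← Matrix.mul_assoc, h2, Matrix.mul_assoc, ih]
      simp only [← Matrix.mul_assoc]
      rw [hff, Matrix.mul_assoc (f * T s) f f, hff]
  have h5 : e * word (fun s => e * T s * e) w = word (fun s => e * T s * e) w := by
    cases w with
    | nil => exact absurd rfl hw
    | cons s w => rw [word_cons, ← Matrix.mul_assoc, ← Matrix.mul_assoc, ← Matrix.mul_assoc, he.eq]
  have h6 : f * word (fun s => f * T s * f) w = word (fun s => f * T s * f) w := by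
    cases w with
    | nil => exact absurd rfl hw
    | cons s w => rw [word_cons, ← Matrix.mul_assoc, ← Matrix.mul_assoc, ← Matrix.mul_assoc, hff]
  have h7 : word T w = word T w * e + word T w * f := by
    rw [hf, Matrix.mul_sub, Matrix.mul_one, add_sub_cancel]
  rw [h7, Matrix.trace_add, h3, h5, Matrix.trace_mul_comm _ f, h4, Matrix.trace_mul_comm,
    ← Matrix.mul_assoc, hff, h6]

/-- Since e commutes with words, 0 = e B_u B_v (1 - e) = (e B_u P)(Q B_v (1 - e)). With bond
dimension one this is a column times a row, so either all long columns or all long rows vanish. -/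
theorem IsCanonical.trace_dichotomy {σ : Type*} {B : σ → Matrix κ κ ℂ} {A : σ → Matrix Unit Unit ℂ}
    {Q : Matrix Unit κ ℂ} {P : Matrix κ Unit ℂ} (hC : IsCanonical B A Q P) {e : Matrix κ κ ℂ}
    (he : IsIdempotentElem e) (hB : ∀ s, Commute e (B s)) :
    ∃ N, (∀ w : List σ, N ≤ w.length → (word B w * e).trace = 0) ∨
      ∀ w : List σ, N ≤ w.length → (word B w * (1 - e)).trace = 0 := by
  have hcomm : ∀ w, e * word B w = word B w * e := by
    intro w
    induction w with
    | nil => simp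
    | cons s w ih => rw [word_cons, ← Matrix.mul_assoc, (hB s).eq, Matrix.mul_assoc, ih,
        Matrix.mul_assoc]
  obtain ⟨N, hN⟩ := hC.bulk_eq
  have hsplit : ∀ w : List σ, N + N ≤ w.length → ∃ u v : List σ, N ≤ u.length ∧ N ≤ v.length ∧
      w = u ++ v := fun w hw => ⟨w.take N, w.drop N, by rw [List.length_take]; omega,
    by rw [List.length_drop]; omega, (List.take_append_drop N w).symm⟩
  refine ⟨N + N, ?_⟩
  by_cases h : ∀ u : List σ, N ≤ u.length → e * word B u * P = 0
  · left
    intro w hw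
    obtain ⟨u, v, hu, hv, rfl⟩ := hsplit w hw
    rw [← hcomm, word_append, ← hN u v hu hv, ← Matrix.mul_assoc, ← Matrix.mul_assoc e, h u hu,
      Matrix.zero_mul, Matrix.trace_zero]
  · right
    push Not at h
    obtain ⟨u₀, hu₀, h₀⟩ := h
    obtain ⟨i, hi⟩ : ∃ i, (e * word B u₀ * P) i () ≠ 0 := by
      by_contra! h
      exact h₀ (Matrix.ext fun i _ => h i)
    have hzero : ∀ v : List σ, N ≤ v.length → Q * word B v * (1 - e) = 0 := by
      intro v hv
      have h1 : e * word B u₀ * P * (Q * word B v * (1 - e)) = 0 := by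
        have : e * word B u₀ * P * (Q * word B v * (1 - e)) =
            e * (word B u₀ * P * (Q * word B v)) * (1 - e) := by simp only [Matrix.mul_assoc]
        rw [this, hN u₀ v hu₀ hv, ← word_append, hcomm, Matrix.mul_assoc, he.mul_one_sub_self,
          Matrix.mul_zero]
      ext a j
      have h2 := congrFun (congrFun h1 i) j
      rw [Matrix.mul_apply, Fintype.sum_unique] at h2
      exact (mul_eq_zero.1 h2).resolve_left hi
    intro w hw
    obtain ⟨u, v, hu, hv, rfl⟩ := hsplit w hw
    rw [word_append, ← hN u v hu hv, Matrix.mul_assoc, hzero v hv, Matrix.mul_zero,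
      Matrix.trace_zero]

/-- High powers of a nonempty word are long words, so all powers of one of them are traceless and
the word is nilpotent. -/
theorem trace_word_eq_zero_of_eventually {σ : Type*} {T : σ → Matrix ι ι ℂ} {N : ℕ}
    (h : ∀ w : List σ, N ≤ w.length → (word T w).trace = 0) {w : List σ} (hw : w ≠ []) :
    (word T w).trace = 0 := by
  have h1 : IsNilpotent (word T w ^ (N + 1)) := by
    refine isNilpotent_of_trace_pow_eq_zero fun k hk => ?_
    rw [← pow_mul, ← word_flatten_replicate]
    refine h _ ?_
    rw [List.length_flatten, List.map_replicate, List.sum_replicate, smul_eq_mul]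
    have := List.length_pos_iff.2 hw
    calc N ≤ (N + 1) * 1 * 1 := by omega
      _ ≤ (N + 1) * k * w.length := by gcongr <;> omega
  exact (Matrix.isNilpotent_trace_of_isNilpotent (IsNilpotent.of_pow h1)).eq_zero

theorem trace_word_eq_zero_of_mpoMul {T : p × p → Matrix ι ι ℂ} {T' : p × p → Matrix κ κ ℂ}
    (hT' : ∀ n, 0 < n → IsUnit (mpoOp T' n)) {N : ℕ}
    (h : ∀ w : List (p × p), N ≤ w.length → (word (mpoMul T T') w).trace = 0)
    {w : List (p × p)} (hw : w ≠ []) : (word T w).trace = 0 := by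
  refine trace_word_eq_zero_of_eventually (N := N + 1) (fun w hw => ?_) hw
  have h0 : mpoOp (mpoMul T T') w.length = 0 := by
    ext i j
    simp only [mpoOp, Matrix.of_apply, Matrix.zero_apply, chain_eq_word]
    exact h _ (by rw [List.length_ofFn]; omega)
  rw [mpoOp_mpoMul] at h0
  have h1 := (hT' w.length (by omega)).mul_left_eq_zero.1 h0
  have := congrFun (congrFun h1 fun k => (w.get k).1) fun k => (w.get k).2
  rw [word_eq_chain]
  exact this

/-- The product with T' generates scalar operators, so the dichotomy makes one diagonal block
traceless against T'. As V_n(T') is invertible, that block generates zero and can be dropped. -/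
theorem sameTrace_block_of_invertible [Nonempty p] {T : p × p → Matrix ι ι ℂ}
    {T' : p × p → Matrix κ κ ℂ} {μ : ℂ} (hμ : μ ≠ 0)
    (h : ∀ n, 0 < n → mpoOp T n * mpoOp T' n = μ ^ n • 1) {e : Matrix ι ι ℂ}
    (he : IsIdempotentElem e) (hT : ∀ s, (1 - e) * T s * e = 0) :
    SameTrace T (fun s => (1 - e) * T s * (1 - e)) ∨ SameTrace T fun s => e * T s * e := by
  have hT' : ∀ n, 0 < n → IsUnit (mpoOp T' n) := fun n hn =>
    IsUnit.of_mul_eq_one ((μ ^ n)⁻¹ • mpoOp T n) (by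
      rw [← mul_eq_one_comm, Matrix.smul_mul, h n hn, smul_smul,
        inv_mul_cancel₀ (pow_ne_zero n hμ), one_smul])
  have hee : (1 - e) * e = 0 := he.one_sub_mul_self
  have hee' : e * (1 - e) = 0 := he.mul_one_sub_self
  set T₁ : p × p → Matrix ι ι ℂ := fun s => e * T s * e with hT₁
  set T₂ : p × p → Matrix ι ι ℂ := fun s => (1 - e) * T s * (1 - e) with hT₂
  -- Deleting the off-diagonal block keeps all traces and makes e ⊗ 1 commute with the product
  -- tensor.
  set S : p × p → Matrix ι ι ℂ := fun s => T₁ s + T₂ s with hS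
  have heS : ∀ s, e * S s = T₁ s := fun s => by
    simp only [hS, hT₁, hT₂, Matrix.mul_add, ← Matrix.mul_assoc, he.eq, hee', Matrix.zero_mul,
      add_zero]
  have hSe : ∀ s, S s * e = T₁ s := fun s => by
    simp only [hS, hT₁, hT₂, Matrix.add_mul, Matrix.mul_assoc, he.eq, hee, Matrix.mul_zero,
      add_zero]
  have hfS : ∀ s, (1 - e) * S s = T₂ s := fun s => by
    rw [Matrix.sub_mul, Matrix.one_mul, heS]
    simp [hS]
  have hSf : ∀ s, S s * (1 - e) = T₂ s := fun s => by
    rw [Matrix.mul_sub, Matrix.mul_one, hSe]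
    simp [hS]
  have heT₁ : ∀ s, e * T₁ s = T₁ s := fun s => by simp only [hT₁, ← Matrix.mul_assoc, he.eq]
  have hfT₂ : ∀ s, (1 - e) * T₂ s = T₂ s := fun s => by
    simp only [hT₂, ← Matrix.mul_assoc, he.one_sub.eq]
  have hT₁e : ∀ s, T₁ s * e = T₁ s := fun s => by simp only [hT₁, Matrix.mul_assoc, he.eq]
  have hT₂e : ∀ s, T₂ s * e = 0 := fun s => by
    simp only [hT₂, Matrix.mul_assoc, hee, Matrix.mul_zero]
  have hT₂f : ∀ s, T₂ s * (1 - e) = T₂ s := fun s => by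
    rw [Matrix.mul_sub, hT₂e, Matrix.mul_one, sub_zero]
  have hsum : ∀ w : List (p × p), w ≠ [] →
      (word T w).trace = (word T₁ w).trace + (word T₂ w).trace :=
    fun w hw => trace_word_eq_add he hT hw
  have hST : SameTrace S T := by
    intro w hw
    rw [hsum w hw, trace_word_eq_add he (fun s => by rw [hfS, hT₂e]) hw]
    simp only [heS, hfS, hT₁e, hT₂f]
  have hB : SameTrace (mpoMul S T') (unitTensor p μ) := by
    rw [sameTrace_iff_mpoOp] at hST ⊢
    intro n hn
    rw [mpoOp_mpoMul, hST n hn, h n hn, mpoOp_unitTensor]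
  obtain ⟨Q, P, hC⟩ := exists_isCanonical (generates_unitTensor hμ) hB
  set E : Matrix (ι × κ) (ι × κ) ℂ := e ⊗ₖ (1 : Matrix κ κ ℂ) with hE
  have hEidem : IsIdempotentElem E := by
    rw [IsIdempotentElem, hE, ← Matrix.mul_kronecker_mul, he.eq, Matrix.one_mul]
  have hF : 1 - E = (1 - e) ⊗ₖ (1 : Matrix κ κ ℂ) := by
    ext ⟨i, k⟩ ⟨i', k'⟩
    simp only [hE, Matrix.sub_apply, Matrix.kroneckerMap_apply, Matrix.one_apply, Prod.mk.injEq,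
      sub_mul, ite_and, ite_mul, one_mul, zero_mul]
  have hmulE : ∀ (g : Matrix ι ι ℂ) s, mpoMul S T' s * (g ⊗ₖ (1 : Matrix κ κ ℂ)) =
      mpoMul (fun s => S s * g) T' s := fun g s => by
    simp only [mpoMul, Finset.sum_mul, ← Matrix.mul_kronecker_mul, Matrix.mul_one]
  have hEmul : ∀ (g : Matrix ι ι ℂ) s, (g ⊗ₖ (1 : Matrix κ κ ℂ)) * mpoMul S T' s =
      mpoMul (fun s => g * S s) T' s := fun g s => by
    simp only [mpoMul, Finset.mul_sum, ← Matrix.mul_kronecker_mul, Matrix.one_mul]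
  have hcommE : ∀ s, Commute E (mpoMul S T' s) := fun s => by
    rw [Commute, SemiconjBy, hmulE, hEmul]
    simp only [heS, hSe]
  have hword : ∀ (g : Matrix ι ι ℂ) (R : p × p → Matrix ι ι ℂ), (∀ s, g * S s = R s) →
      (∀ s, S s * g = R s) → (∀ s, g * R s = R s) → ∀ w : List (p × p), w ≠ [] →
      word (mpoMul S T') w * (g ⊗ₖ (1 : Matrix κ κ ℂ)) = word (mpoMul R T') w := by
    intro g R h1 h2 h3 w
    have h4 : ∀ s, (g ⊗ₖ (1 : Matrix κ κ ℂ)) * mpoMul R T' s = mpoMul R T' s := fun s => by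
      simp only [mpoMul, Finset.mul_sum, ← Matrix.mul_kronecker_mul, Matrix.one_mul, h3]
    induction w with
    | nil => exact fun h => absurd rfl h
    | cons s w ih =>
      intro _
      rcases eq_or_ne w [] with rfl | hw
      · rw [word_singleton, word_singleton, hmulE]
        simp only [h2]
      · obtain ⟨t, v, rfl⟩ := List.exists_cons_of_ne_nil hw
        have h5 : (g ⊗ₖ (1 : Matrix κ κ ℂ)) * word (mpoMul R T') (t :: v) =
            word (mpoMul R T') (t :: v) := by
          rw [word_cons, ← Matrix.mul_assoc, h4]
        rw [word_cons, Matrix.mul_assoc, ih hw, ← h5, ← Matrix.mul_assoc, hmulE]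
        simp only [h2]
        rw [← word_cons]
  obtain ⟨N, hN | hN⟩ := hC.trace_dichotomy hEidem hcommE
  · left
    intro w hw
    rw [hsum w hw, trace_word_eq_zero_of_mpoMul hT' (N := N + 1) (fun w hw => ?_) hw, zero_add]
    rw [← hword e T₁ heS hSe heT₁ w (by rintro rfl; simp at hw)]
    exact hN w (by omega)
  · right
    intro w hw
    rw [hsum w hw, trace_word_eq_zero_of_mpoMul (T := T₂) hT' (N := N + 1) (fun w hw => ?_) hw,
      add_zero]
    rw [← hword (1 - e) T₂ hfS hSf hfT₂ w (by rintro rfl; simp at hw), ← hF]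
    exact hN w (by omega)

theorem exists_generates_of_invertible [Nonempty p] {D : ℕ}
    (T : p × p → Matrix (Fin D) (Fin D) ℂ) {T' : p × p → Matrix κ κ ℂ} {μ : ℂ} (hμ : μ ≠ 0)
    (h : ∀ n, 0 < n → mpoOp T n * mpoOp T' n = μ ^ n • 1) :
    ∃ (D' : ℕ) (A : p × p → Matrix (Fin D') (Fin D') ℂ), Generates A ∧ SameTrace A T := by
  induction D using Nat.strong_induction_on with
  | _ D ih =>
  have hne : mpoOp T 1 ≠ 0 := by
    intro h0
    have := h 1 one_pos
    rw [h0, Matrix.zero_mul, pow_one] at this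
    exact smul_ne_zero hμ one_ne_zero this.symm
  have hs : ∃ s, T s ≠ 0 := by
    by_contra! h0
    refine hne ?_
    ext i j
    simp [mpoOp, chain, h0]
  have : Nonempty (Fin D) := by
    by_contra hD
    rw [not_nonempty_iff] at hD
    obtain ⟨s, hs⟩ := hs
    exact hs (Matrix.ext fun i => isEmptyElim i)
  by_cases hirr : ∀ U : Submodule ℂ (Fin D → ℂ), (∀ s, ∀ v ∈ U, (T s).mulVec v ∈ U) →
      U = ⊥ ∨ U = ⊤
  · exact ⟨D, T, generates_of_irreducible hirr hs, fun _ _ => rfl⟩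
  · push Not at hirr
    obtain ⟨U, hU, hbot, htop⟩ := hirr
    obtain ⟨U', hU'⟩ := U.exists_isCompl
    set e : Matrix (Fin D) (Fin D) ℂ := LinearMap.toMatrix' (U.projection U' hU') with he_def
    have hmul : ∀ v, e.mulVec v = U.projection U' hU' v := fun v => by
      rw [he_def, LinearMap.toMatrix'_mulVec]
    have hmem : ∀ v, e.mulVec v ∈ U := fun v => by
      rw [hmul]
      exact Submodule.projection_apply_mem hU' v
    have hfix : ∀ v ∈ U, e.mulVec v = v := fun v hv => by
      rw [hmul]
      exact Submodule.projection_apply_left hU' ⟨v, hv⟩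
    have he : IsIdempotentElem e := by
      refine Matrix.ext_of_mulVec_single fun i => ?_
      rw [← Matrix.mulVec_mulVec, hfix _ (hmem _)]
    have hT : ∀ s, (1 - e) * T s * e = 0 := by
      intro s
      refine Matrix.ext_of_mulVec_single fun i => ?_
      rw [← Matrix.mulVec_mulVec, ← Matrix.mulVec_mulVec, Matrix.sub_mulVec, Matrix.one_mulVec,
        hfix _ (hU s _ (hmem _)), sub_self, Matrix.zero_mulVec]
    have he1 : e ≠ 1 := by
      intro h1
      refine htop (eq_top_iff.2 fun v _ => ?_)
      have := hmem v
      rwa [h1, Matrix.one_mulVec] at this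
    have he0 : 1 - e ≠ 1 := by
      intro h1
      refine hbot (eq_bot_iff.2 fun v hv => ?_)
      have h2 := hfix v hv
      rw [sub_eq_self.1 h1, Matrix.zero_mulVec] at h2
      exact h2.symm
    have step : ∀ g : Matrix (Fin D) (Fin D) ℂ, IsIdempotentElem g → g ≠ 1 →
        SameTrace T (fun s => g * T s * g) →
        ∃ (D' : ℕ) (A : p × p → Matrix (Fin D') (Fin D') ℂ), Generates A ∧ SameTrace A T := by
      intro g hg hg1 hgT
      obtain ⟨r, hr, R, hR⟩ := exists_compression hg hg1 T
      rw [Fintype.card_fin] at hr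
      have hRT := hR.trans hgT.symm
      obtain ⟨D', A, hA, hAR⟩ := ih r hr R fun n hn => by
        rw [sameTrace_iff_mpoOp.1 hRT n hn, h n hn]
      exact ⟨D', A, hA, hAR.trans hRT⟩
    rcases sameTrace_block_of_invertible hμ h he hT with h1 | h1
    · exact step _ he.one_sub he0 h1
    · exact step _ he he1 h1

end invertible

/-! ### Aperiodicity of invertible matrix product operators. -/

section invertible

variable {p ι κ : Type*} [Fintype p] [DecidableEq p] [Fintype ι] [DecidableEq ι] [Fintype κ]
  [DecidableEq κ]

theorem unitTensor_apply (μ : ℂ) (s : p × p) (i j : Unit) :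
    unitTensor p μ s i j = if s.1 = s.2 then μ else 0 := by
  simp only [unitTensor_eq]
  rw [Matrix.smul_apply, Subsingleton.elim i j, Matrix.one_apply_eq, smul_eq_mul,
    mul_one]

theorem unitTensor_mpoMul (μ : ℂ) (A : p × p → Matrix ι ι ℂ) :
    mpoMul (unitTensor p μ) A =
      fun s => (μ • A s).submatrix (Equiv.punitProd ι) (Equiv.punitProd ι) := by
  funext s
  ext ⟨_, i⟩ ⟨_, j⟩
  simp [mpoMul, unitTensor_apply, Matrix.sum_apply]

theorem mpoMul_unitTensor (μ : ℂ) (A : p × p → Matrix ι ι ℂ) :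
    mpoMul A (unitTensor p μ) =
      fun s => (μ • A s).submatrix (Equiv.prodPUnit ι) (Equiv.prodPUnit ι) := by
  funext s
  ext ⟨i, _⟩ ⟨j, _⟩
  simp [mpoMul, unitTensor_apply, Matrix.sum_apply, mul_comm]

theorem isReduction_refl {σ : Type*} (A : σ → Matrix ι ι ℂ) : IsReduction A A 1 1 :=
  isReduction_iff.2 fun w => by rw [Matrix.one_mul, Matrix.mul_one]

theorem exists_trace_mul_eq_zero {S : Submodule ℂ (Matrix ι ι ℂ)} (hS : S ≠ ⊤) :
    ∃ X : Matrix ι ι ℂ, X ≠ 0 ∧ ∀ M ∈ S, (X * M).trace = 0 := by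
  obtain ⟨f, hf, hle⟩ := Submodule.exists_le_ker_of_lt_top S (lt_top_iff_ne_top.2 hS)
  have key : ∀ M : Matrix ι ι ℂ,
      (Matrix.of (fun j i => f (Matrix.single i j 1)) * M).trace = f M := by
    intro M
    conv_rhs => rw [Matrix.matrix_eq_sum_single M]
    rw [map_sum, Matrix.trace_mul_comm, Matrix.trace]
    refine Finset.sum_congr rfl fun i _ => ?_
    rw [map_sum, Matrix.diag_apply, Matrix.mul_apply]
    refine Finset.sum_congr rfl fun j _ => ?_
    rw [Matrix.of_apply, ← smul_eq_mul, ← map_smul, Matrix.smul_single, smul_eq_mul, mul_one]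
  refine ⟨Matrix.of fun j i => f (Matrix.single i j 1), fun h0 => hf ?_, fun M hM => ?_⟩
  · ext M
    rw [← key, h0]
    simp
  · rw [key]
    exact hle hM

theorem kronecker_submatrix_prodAssoc (X : Matrix ι ι ℂ) (K : Matrix (κ × ι) (κ × ι) ℂ) :
    (X ⊗ₖ K).submatrix (Equiv.prodAssoc ι κ ι) (Equiv.prodAssoc ι κ ι) =
      ∑ l, ∑ l', (X ⊗ₖ Matrix.of fun k k' => K (k, l) (k', l')) ⊗ₖ Matrix.single l l' (1 : ℂ) := by
  ext ⟨⟨i, k⟩, m⟩ ⟨⟨i', k'⟩, m'⟩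
  simp [Matrix.sum_apply, Matrix.single_apply, ite_and]

/-- Q (AB)_v (X ⊗ K) (AB)_u P is a scalar. By cyclicity and the bulk identity it is the trace of (X
⊗ K) against (AB)_{uv}, a sum of terms containing tr(X A_w) = 0. The third factor A is a spectator,
handled by expanding in matrix units. -/
theorem mul_eq_zero_of_trace_eq_zero {A : p × p → Matrix ι ι ℂ} {B : p × p → Matrix κ κ ℂ}
    {Q : Matrix Unit (ι × κ) ℂ} {P : Matrix (ι × κ) Unit ℂ} {X : Matrix ι ι ℂ} {N : ℕ}
    (hbulk : ∀ u v : List (p × p), N ≤ u.length → N ≤ v.length →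
      word (mpoMul A B) u * P * (Q * word (mpoMul A B) v) =
        word (mpoMul A B) u * word (mpoMul A B) v)
    (hX : ∀ w : List (p × p), w.length = N + N → (X * word A w).trace = 0)
    (K : Matrix (κ × ι) (κ × ι) ℂ) (v u : List (p × p)) (hv : v.length = N) (hu : u.length = N) :
    (Q ⊗ₖ (1 : Matrix ι ι ℂ)) * word (mpoMul (mpoMul A B) A) v *
      (X ⊗ₖ K).submatrix (Equiv.prodAssoc ι κ ι) (Equiv.prodAssoc ι κ ι) *
        word (mpoMul (mpoMul A B) A) u * (P ⊗ₖ (1 : Matrix ι ι ℂ)) = 0 := by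
  have hscalar : ∀ (K : Matrix κ κ ℂ) (v u : List (p × p)), v.length = N → u.length = N →
      Q * word (mpoMul A B) v * (X ⊗ₖ K) * word (mpoMul A B) u * P = 0 := by
    intro K v u hv hu
    have htr : (Q * word (mpoMul A B) v * (X ⊗ₖ K) * word (mpoMul A B) u * P).trace = 0 := by
      have h1 : Q * word (mpoMul A B) v * (X ⊗ₖ K) * word (mpoMul A B) u * P =
          (Q * word (mpoMul A B) v) * ((X ⊗ₖ K) * (word (mpoMul A B) u * P)) := by
        simp only [Matrix.mul_assoc]
      rw [h1, Matrix.trace_mul_comm, Matrix.mul_assoc, hbulk u v hu.ge hv.ge, ← word_append]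
      have hmem := word_mpoMul_mem_span A B (u ++ v)
      generalize word (mpoMul A B) (u ++ v) = x at hmem ⊢
      induction hmem using Submodule.span_induction with
      | mem x hx =>
        obtain ⟨a, b, ha, -, rfl⟩ := hx
        rw [← Matrix.mul_kronecker_mul, Matrix.trace_kronecker, hX a (by
          rw [ha, List.length_append, hu, hv]), zero_mul]
      | zero => simp
      | add x y _ _ hx hy => rw [Matrix.mul_add, Matrix.trace_add, hx, hy, add_zero]
      | smul c x _ hx => rw [Matrix.mul_smul, Matrix.trace_smul, hx, smul_zero]
    ext a b
    simpa [Matrix.trace] using htr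
  rw [kronecker_submatrix_prodAssoc]
  have hmv := word_mpoMul_mem_span (mpoMul A B) A v
  have hmu := word_mpoMul_mem_span (mpoMul A B) A u
  generalize word (mpoMul (mpoMul A B) A) v = Y at hmv ⊢
  generalize word (mpoMul (mpoMul A B) A) u = Z at hmu ⊢
  induction hmv using Submodule.span_induction with
  | mem Y hY =>
    obtain ⟨a, b, ha, -, rfl⟩ := hY
    induction hmu using Submodule.span_induction with
    | mem Z hZ =>
      obtain ⟨a', b', ha', -, rfl⟩ := hZ
      simp only [Matrix.mul_sum, Matrix.sum_mul, ← Matrix.mul_kronecker_mul]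
      refine Finset.sum_eq_zero fun l _ => Finset.sum_eq_zero fun l' _ => ?_
      rw [hscalar _ _ _ (ha.trans hv) (ha'.trans hu), Matrix.zero_kronecker]
    | zero => simp
    | add x y _ _ hx hy => rw [Matrix.mul_add, Matrix.add_mul, hx, hy, add_zero]
    | smul c x _ hx => rw [Matrix.mul_smul, Matrix.smul_mul, hx, smul_zero]
  | zero => simp
  | add x y _ _ hx hy =>
    rw [Matrix.mul_add, Matrix.add_mul, Matrix.add_mul, Matrix.add_mul, hx, hy, add_zero]
  | smul c x _ hx =>
    rw [Matrix.mul_smul, Matrix.smul_mul, Matrix.smul_mul, Matrix.smul_mul, hx, smul_zero]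

/-- Generation alone permits periodicity. If words of length 2N failed to span, some X ≠ 0 would be
trace-orthogonal to them. The chain A B A reduces to A by contracting AB or BA; exchanging these
reductions around X expresses A_v X A_u through the vanishing quantity above. Cancelling A_v and A_u
by spanning gives X = 0. -/
theorem isNormal_of_invertible [Nonempty p] [Nonempty ι] {A : p × p → Matrix ι ι ℂ}
    {B : p × p → Matrix κ κ ℂ}
    (hA : Generates A) {μ : ℂ} (hμ : μ ≠ 0)
    (h : ∀ n, 0 < n → mpoOp A n * mpoOp B n = μ ^ n • 1) : IsNormal A := by
  have h' : ∀ n, 0 < n → mpoOp B n * mpoOp A n = μ ^ n • 1 := fun n hn => by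
    have h1 : ((μ ^ n)⁻¹ • mpoOp A n) * mpoOp B n = 1 := by
      rw [Matrix.smul_mul, h n hn, smul_smul, inv_mul_cancel₀ (pow_ne_zero n hμ), one_smul]
    rw [mul_eq_one_comm, Matrix.mul_smul] at h1
    rw [← h1, smul_smul, mul_inv_cancel₀ (pow_ne_zero n hμ), one_smul]
  have hAB : SameTrace (mpoMul A B) (unitTensor p μ) := sameTrace_iff_mpoOp.2 fun n hn => by
    rw [mpoOp_mpoMul, h n hn, mpoOp_unitTensor]
  have hBA : SameTrace (mpoMul B A) (unitTensor p μ) := sameTrace_iff_mpoOp.2 fun n hn => by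
    rw [mpoOp_mpoMul, h' n hn, mpoOp_unitTensor]
  have hABA : SameTrace (mpoMul (mpoMul A B) A) (fun s => μ • A s) :=
    sameTrace_iff_mpoOp.2 fun n hn => by
      rw [mpoOp_mpoMul, mpoOp_mpoMul, h n hn, mpoOp_smul, Matrix.smul_mul, Matrix.one_mul]
  obtain ⟨Q, P, hQP⟩ := exists_isCanonical (generates_unitTensor hμ) hAB
  obtain ⟨Q', P', hQP'⟩ := exists_isCanonical (generates_unitTensor hμ) hBA
  have r1 := hQP.isReduction.mpoMul_right A
  rw [unitTensor_mpoMul] at r1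
  replace r1 := r1.trans ((isReduction_refl fun s => μ • A s).submatrix (Equiv.punitProd ι))
  have r2 := (hQP'.isReduction.mpoMul_left A).submatrix (Equiv.prodAssoc ι κ ι)
  rw [mpoMul_unitTensor] at r2
  replace r2 := r2.trans ((isReduction_refl fun s => μ • A s).submatrix (Equiv.prodPUnit ι))
  have hC : (fun s => (mpoMul A (mpoMul B A) s).submatrix (Equiv.prodAssoc ι κ ι)
      (Equiv.prodAssoc ι κ ι)) = mpoMul (mpoMul A B) A :=
    funext fun s => (mpoProd_assoc A B A s).symm
  rw [hC] at r2
  obtain ⟨c, hc, N₁, hN₁⟩ := r2.evEq (hA.smul hμ) hABA r1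
  obtain ⟨N₂, hN₂⟩ := hQP.bulk_eq
  set N := max N₁ (max N₂ 1) with hN
  refine isNormal_of_span_eq_top (n := N + N) (by omega) ?_
  by_contra hspan
  obtain ⟨X, hX0, hX⟩ := exists_trace_mul_eq_zero hspan
  have hX' : ∀ w : List (p × p), w.length = N + N → (X * word A w).trace = 0 := fun w hw =>
    hX _ (Submodule.subset_span ⟨w, hw, rfl⟩)
  have hmid : ∀ v u : List (p × p), v.length = N → u.length = N →
      word A v * X * word A u = 0 := by
    intro v u hv hu
    have hz := mul_eq_zero_of_trace_eq_zero (N := N)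
      (fun u v hu hv => hN₂ u v (by omega) (by omega)) hX' (P' * Q') v u hv hu
    have e1 := hN₁ v (by omega)
    have e2 := hN₁ u (by omega)
    rw [isReduction_iff] at r1 r2
    have f1 := r1 v
    have f2 := r2 u
    set J₁ := (1 : Matrix ι ι ℂ).submatrix id (Equiv.punitProd ι) with hJ₁
    set J₁' := (1 : Matrix ι ι ℂ).submatrix (Equiv.punitProd ι) id with hJ₁'
    set J₂ := (1 : Matrix ι ι ℂ).submatrix id (Equiv.prodPUnit ι) with hJ₂
    set J₂' := (1 : Matrix ι ι ℂ).submatrix (Equiv.prodPUnit ι) id with hJ₂'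
    set V₁ := Q ⊗ₖ (1 : Matrix ι ι ℂ)
    set W₁ := P ⊗ₖ (1 : Matrix ι ι ℂ)
    set V₂ := ((1 : Matrix ι ι ℂ) ⊗ₖ Q').submatrix id (Equiv.prodAssoc ι κ ι) with hV₂
    set W₂ := ((1 : Matrix ι ι ℂ) ⊗ₖ P').submatrix (Equiv.prodAssoc ι κ ι) id with hW₂
    have hJ : J₂' * X * J₂ = X ⊗ₖ (1 : Matrix Unit Unit ℂ) := by
      ext ⟨i, _⟩ ⟨j, _⟩
      simp [hJ₂, hJ₂', Matrix.mul_apply, Matrix.one_apply]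
    -- Closing the last two factors, inserting X and reopening them leaves X on the first factor and
    -- P'Q' on the others.
    have hK : W₂ * J₂' * X * (J₂ * V₂) =
        (X ⊗ₖ (P' * Q')).submatrix (Equiv.prodAssoc ι κ ι) (Equiv.prodAssoc ι κ ι) := by
      have : W₂ * J₂' * X * (J₂ * V₂) = W₂ * (J₂' * X * J₂) * V₂ := by
        simp only [Matrix.mul_assoc]
      rw [this, hJ, hW₂, hV₂]
      have h3 : X ⊗ₖ (P' * Q') = ((1 : Matrix ι ι ℂ) ⊗ₖ P') * (X ⊗ₖ (1 : Matrix Unit Unit ℂ)) *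
          ((1 : Matrix ι ι ℂ) ⊗ₖ Q') := by
        rw [← Matrix.mul_kronecker_mul, ← Matrix.mul_kronecker_mul, Matrix.one_mul, Matrix.mul_one,
          Matrix.mul_one]
      rw [h3]
      rfl
    rw [← hK] at hz
    have hz' : c * c⁻¹ * (μ ^ v.length * μ ^ u.length) = μ ^ v.length * μ ^ u.length := by
      rw [mul_inv_cancel₀ hc, one_mul]
    have key : (μ ^ v.length * μ ^ u.length) • (word A v * X * word A u) = 0 := by
      rw [word_smul] at f1 f2
      have g1 : word (mpoMul (mpoMul A B) A) u * (W₁ * J₁') =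
          c⁻¹ • (word (mpoMul (mpoMul A B) A) u * (W₂ * J₂')) := by
        rw [e2, Matrix.mul_smul, smul_smul, inv_mul_cancel₀ hc, one_smul]
      calc (μ ^ v.length * μ ^ u.length) • (word A v * X * word A u)
          = (μ ^ v.length • word A v) * X * (μ ^ u.length • word A u) := by
            rw [Matrix.smul_mul, Matrix.smul_mul, Matrix.mul_smul, smul_smul]
        _ = (J₁ * V₁ * word (mpoMul (mpoMul A B) A) v * (W₁ * J₁')) * X *
              (J₂ * V₂ * word (mpoMul (mpoMul A B) A) u * (W₂ * J₂')) := by rw [f1, f2]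
        -- The closing matrices W₁ and W₂ are about to be interchanged on the two sides of X; the
        -- scalars c and c⁻¹ this costs cancel.
        _ = J₁ * V₁ * (c • (word (mpoMul (mpoMul A B) A) v * (W₁ * J₁'))) * X *
              (J₂ * V₂ * (c⁻¹ • (word (mpoMul (mpoMul A B) A) u * (W₂ * J₂')))) := by
            simp only [Matrix.mul_smul, Matrix.smul_mul, smul_smul, inv_mul_cancel₀ hc, one_smul,
              Matrix.mul_assoc]
        _ = J₁ * (V₁ * word (mpoMul (mpoMul A B) A) v * (W₂ * J₂' * X * (J₂ * V₂)) *
              word (mpoMul (mpoMul A B) A) u * W₁) * J₁' := by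
            rw [← g1, ← Matrix.mul_smul, ← e1]
            simp only [Matrix.mul_assoc]
        _ = 0 := by rw [hz, Matrix.mul_zero, Matrix.zero_mul]
    exact (smul_eq_zero.1 key).resolve_left
      (mul_ne_zero (pow_ne_zero _ hμ) (pow_ne_zero _ hμ))
  have hright : ∀ u : List (p × p), u.length = N → X * word A u = 0 := by
    intro u hu
    have := hA.ext_linear (F := 1) (F' := 0) (H := X * word A u) (H' := 0) N (fun w hw => by
      have hsplit := List.take_append_drop (w.length - N) w
      rw [← hsplit, word_append, Matrix.one_mul, Matrix.mul_assoc, ← Matrix.mul_assoc _ X,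
        hmid _ u (by rw [List.length_drop]; omega) hu]
      simp) 1
    simpa using this
  have := hA.ext_linear (F := X) (F' := 0) (H := 1) (H' := (1 : Matrix ι ι ℂ)) N (fun w hw => by
    have hsplit := List.take_append_drop N w
    rw [← hsplit, word_append, ← Matrix.mul_assoc, hright _ (by rw [List.length_take]; omega)]
    simp) 1
  exact hX0 (by simpa using this)

end invertible

/-! ### Labeling data of a one-block representation -/

section labeling

variable {G p : Type*} [Group G] [Fintype p] [DecidableEq p] [Nonempty p] {E : G → ℕ}
  {T : ∀ g, p × p → Matrix (Fin (E g)) (Fin (E g)) ℂ}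

theorem nonempty_of_isUnit_mpoOp {ι : Type*} [Fintype ι] [DecidableEq ι] {A : p × p → Matrix ι ι ℂ}
    (h : IsUnit (mpoOp A 1)) : Nonempty ι := by
  by_contra hι
  rw [not_nonempty_iff] at hι
  refine h.ne_zero ?_
  ext i j
  simp [mpoOp, Matrix.trace]

theorem LabelingData.regular (hT : IsOneBlockProjRep T) (d : LabelingData T) : d.Regular := by
  have hu : ∀ g (n : ℕ), 0 < n → IsUnit (mpoOp (d.A g) n) := fun g n hn => by
    rw [d.mpoOp_eq g n hn]
    exact hT.1 g n hn
  refine ⟨fun g => ?_, hu⟩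
  have := nonempty_of_isUnit_mpoOp (hu g 1 one_pos)
  exact (d.isNormal g).generates

/-- The operator of the unit element satisfies O² = λ(1,1)ⁿ O and is invertible, hence is the scalar
λ(1,1)ⁿ. -/
theorem IsOneBlockProjRep.exists_mul_inv (hT : IsOneBlockProjRep T) (g : G) :
    ∃ μ : ℂ, μ ≠ 0 ∧ ∀ n, 0 < n → mpoOp (T g) n * mpoOp (T g⁻¹) n = μ ^ n • 1 := by
  obtain ⟨hu, lam, hlam⟩ := hT
  have hcongr : ∀ {x y : G} (n : ℕ), x = y → mpoOp (T x) n = mpoOp (T y) n := by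
    rintro x _ n rfl
    rfl
  have hone : ∀ n, 0 < n → mpoOp (T 1) n = lam 1 1 ^ n • 1 := fun n hn => by
    have h1 := hlam 1 1 n hn
    rw [hcongr n (one_mul 1)] at h1
    refine (hu 1 n hn).mul_right_cancel ?_
    rw [h1, Matrix.smul_mul, Matrix.one_mul]
  have hinv : ∀ n, 0 < n → mpoOp (T g) n * mpoOp (T g⁻¹) n = (lam g g⁻¹ * lam 1 1) ^ n • 1 :=
    fun n hn => by rw [hlam g g⁻¹ n hn, hcongr n (mul_inv_cancel g), hone n hn, smul_smul, mul_pow]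
  refine ⟨_, fun h0 => ?_, hinv⟩
  have h1 := hinv 1 one_pos
  rw [h0, pow_one, zero_smul] at h1
  exact ((hu g 1 one_pos).mul (hu g⁻¹ 1 one_pos)).ne_zero h1

theorem IsOneBlockProjRep.nonempty_labelingData (hT : IsOneBlockProjRep T) :
    Nonempty (LabelingData T) := by
  have hex : ∀ g, ∃ (D : ℕ) (A : p × p → Matrix (Fin D) (Fin D) ℂ), Generates A ∧ IsNormal A ∧
      ∀ n, 0 < n → mpoOp A n = mpoOp (T g) n := by
    intro g
    obtain ⟨μ, hμ, h⟩ := hT.exists_mul_inv g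
    obtain ⟨D, A, hA, hAT⟩ := exists_generates_of_invertible (T g) hμ h
    rw [sameTrace_iff_mpoOp] at hAT
    have := nonempty_of_isUnit_mpoOp (hAT 1 one_pos ▸ hT.1 g 1 one_pos)
    exact ⟨D, A, hA, isNormal_of_invertible (B := T g⁻¹) hA hμ fun n hn => by
      rw [hAT n hn, h n hn], hAT⟩
  choose D A hgen hnormal hAT using hex
  obtain ⟨hu, lam, hlam⟩ := hT
  have hmul : ∀ g h (n : ℕ), 0 < n →
      mpoOp (A g) n * mpoOp (A h) n = lam g h ^ n • mpoOp (A (g * h)) n := fun g h n hn => by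
    rw [hAT g n hn, hAT h n hn, hAT (g * h) n hn, hlam g h n hn]
  have hlam0 : ∀ g h, lam g h ≠ 0 := fun g h h0 => by
    have h1 := hlam g h 1 one_pos
    rw [h0, pow_one, zero_smul] at h1
    exact ((hu g 1 one_pos).mul (hu h 1 one_pos)).ne_zero h1
  have hred : ∀ g h, ∃ (V : Matrix (Fin (D (g * h))) (Fin (D g) × Fin (D h)) ℂ)
      (W : Matrix (Fin (D g) × Fin (D h)) (Fin (D (g * h))) ℂ),
      IsReduction (mpoMul (A g) (A h)) (fun s => lam g h • A (g * h) s) V W := by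
    intro g h
    have := nonempty_of_isUnit_mpoOp (hAT (g * h) 1 one_pos ▸ hu (g * h) 1 one_pos)
    have hst : SameTrace (mpoMul (A g) (A h)) (fun s => lam g h • A (g * h) s) :=
      sameTrace_iff_mpoOp.2 fun n hn => by rw [mpoOp_mpoMul, mpoOp_smul, hmul g h n hn]
    obtain ⟨Q, P, hC⟩ := exists_isCanonical ((hgen (g * h)).smul (hlam0 g h)) hst
    exact ⟨Q, P, hC.isReduction⟩
  choose V W hVW using hred
  exact ⟨⟨D, A, hnormal, hAT, lam, hmul, V, W, hVW⟩⟩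

end labeling

/-! ### Cocycles with values in the nonzero complex numbers -/

section cohomology

variable {G : Type*} [Group G]

theorem d_cochain_eq_zero {ω : G → G → G → ℂˣ}
    (h : ∀ a b c e, ω b c e * ω a (b * c) e * ω a b c = ω a b (c * e) * ω (a * b) c e) :
    inhomogeneousCochains.d (unitsRep G) 3 (cochain ω) = 0 := by
  funext g
  have h1 := congrArg Additive.ofMul (h (g 0) (g 1) (g 2) (g 3))
  simp only [ofMul_mul] at h1
  rw [inhomogeneousCochains.d_hom_apply]
  refine ULift.ext _ _ ?_
  simp [Fin.sum_univ_succ, cochain, Fin.contractNth]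
  change _ = (0 : Additive ℂˣ)
  rw [← sub_eq_zero] at h1
  rw [← h1]
  abel

/-- A function `G² → ℂ*` as an inhomogeneous 2-cochain. -/
def cochainTwo (c : G → G → ℂˣ) : (Fin 2 → G) → unitsRep G :=
  fun x => ULift.up (Additive.ofMul (c (x 0) (x 1)))

theorem cochain_eq_add_d {ω ω' : G → G → G → ℂˣ} {c : G → G → ℂˣ}
    (h : ∀ x y z, ω x y z * (c x y * c (x * y) z) = ω' x y z * (c y z * c x (y * z))) :
    cochain ω = cochain ω' + inhomogeneousCochains.d (unitsRep G) 2 (cochainTwo c) := by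
  funext g
  have h1 := congrArg Additive.ofMul (h (g 0) (g 1) (g 2))
  simp only [ofMul_mul] at h1
  rw [Pi.add_apply, inhomogeneousCochains.d_hom_apply]
  refine ULift.ext _ _ ?_
  simp [Fin.sum_univ_succ, cochain, cochainTwo, Fin.contractNth]
  rw [← sub_eq_zero] at h1 ⊢
  rw [← h1]
  abel

theorem IsCocycleOfClass.of_coboundary {ω ω' : G → G → G → ℂˣ} {c : G → G → ℂˣ} {z : H3 G}
    (hω' : IsCocycleOfClass ω' z)
    (h : ∀ x y z, ω x y z * (c x y * c (x * y) z) = ω' x y z * (c y z * c x (y * z))) :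
    IsCocycleOfClass ω z := by
  obtain ⟨h', hz⟩ := hω'
  have hd : inhomogeneousCochains.d (unitsRep G) 3
      (inhomogeneousCochains.d (unitsRep G) 2 (cochainTwo c)) = 0 := by
    rw [← CategoryTheory.comp_apply, groupCohomology.inhomogeneousCochains.d_comp_d]
    rfl
  have hω : inhomogeneousCochains.d (unitsRep G) 3 (cochain ω) = 0 := by
    rw [cochain_eq_add_d h, map_add, h', hd, add_zero]
  refine ⟨hω, ?_⟩
  have hsum : groupCohomology.cocyclesMk (cochain ω) hω =
      groupCohomology.cocyclesMk (cochain ω') h' +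
        groupCohomology.toCocycles (unitsRep G) 2 3 (cochainTwo c) := by
    -- Cocycles embed into cochains, so the identity may be checked on functions.
    apply (ModuleCat.mono_iff_injective (groupCohomology.iCocycles (unitsRep G) 3)).1 inferInstance
    rw [map_add, groupCohomology.iCocycles_mk, groupCohomology.iCocycles_mk,
      ← CategoryTheory.comp_apply, HomologicalComplex.toCycles_i,
      groupCohomology.inhomogeneousCochains.d_def]
    exact cochain_eq_add_d h
  rw [hsum, map_add, hz]
  have : groupCohomology.π (unitsRep G) 3
      (groupCohomology.toCocycles (unitsRep G) 2 3 (cochainTwo c)) = 0 := by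
    rw [← CategoryTheory.comp_apply]
    have := HomologicalComplex.toCycles_comp_homologyπ
      (groupCohomology.inhomogeneousCochains (unitsRep G)) 2 3
    exact congrArg (fun f => f (cochainTwo c)) this
  rw [this, add_zero]

end cohomology

/-! ### The label of a half-site shifted representation -/

namespace LabelingData

variable {G p q : Type*} [Group G] [Fintype p] [DecidableEq p] [Fintype q] [DecidableEq q]
  [Nonempty p] [Nonempty q] {D₁ D₂ : G → ℕ} {X : ∀ g, p × p → Matrix (Fin (D₁ g)) (Fin (D₂ g)) ℂ}
  {Y : ∀ g, q × q → Matrix (Fin (D₂ g)) (Fin (D₁ g)) ℂ}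

theorem isCocycleOfClass_of_shift (hXY : IsOneBlockProjRep fun g => mpoConcat (X g) (Y g))
    {d : LabelingData fun g => mpoConcat (X g) (Y g)}
    {d' : LabelingData fun g => mpoConcat (Y g) (X g)} {ω ω' : G → G → G → ℂˣ}
    (hω : d.IsAssociator ω) (hω' : d'.IsAssociator ω') {c : H3 G} (hc : IsCocycleOfClass ω' c) :
    IsCocycleOfClass ω c := by
  have hd := d.regular hXY
  have hd' := d'.regular hXY.swap
  have hfact : ∀ g, ∃ (X' : p × p → Matrix (Fin (d.D g)) (Fin (d'.D g)) ℂ)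
      (Y' : q × q → Matrix (Fin (d'.D g)) (Fin (d.D g)) ℂ),
      mpoConcat X' Y' = d.A g ∧ mpoConcat Y' X' = d'.A g := fun g => by
    have := hd.nonempty g
    have := hd'.nonempty g
    exact exists_mpoConcat_factorization (hd.generates g) (hd'.generates g)
      (SameTrace.symm (sameTrace_iff_mpoOp.2 (d.mpoOp_eq g)))
      (SameTrace.symm (sameTrace_iff_mpoOp.2 (d'.mpoOp_eq g)))
  choose X' Y' hA hA' using hfact
  obtain ⟨b, hb⟩ := exists_coboundary hd hd' hA hA' hω hω'
  exact hc.of_coboundary hb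

end LabelingData

/-- Independence of the choices needs no separate argument: all data for one blocking are compared
with one fixed choice for the other. -/
theorem exists_label_of_shift {G p q : Type*} [Group G] [Fintype p] [DecidableEq p] [Fintype q]
    [DecidableEq q] [Nonempty p] [Nonempty q] {D₁ D₂ : G → ℕ}
    {X : ∀ g, p × p → Matrix (Fin (D₁ g)) (Fin (D₂ g)) ℂ}
    {Y : ∀ g, q × q → Matrix (Fin (D₂ g)) (Fin (D₁ g)) ℂ}
    (hXY : IsOneBlockProjRep fun g => mpoConcat (X g) (Y g)) :
    ∃ c : H3 G, IsThirdCohomologyLabel (fun g => mpoConcat (X g) (Y g)) c ∧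
      IsThirdCohomologyLabel (fun g => mpoConcat (Y g) (X g)) c := by
  have hYX := hXY.swap
  obtain ⟨d₀⟩ := hXY.nonempty_labelingData
  obtain ⟨d₁⟩ := hYX.nonempty_labelingData
  obtain ⟨ω₀, hω₀⟩ := (d₀.regular hXY).exists_isAssociator
  obtain ⟨ω₁, hω₁⟩ := (d₁.regular hYX).exists_isAssociator
  have ha₀ := (hω₀ ω₀).2 rfl
  have ha₁ := (hω₁ ω₁).2 rfl
  obtain ⟨c, hc⟩ : ∃ c, IsCocycleOfClass ω₀ c :=
    ⟨_, d_cochain_eq_zero ((d₀.regular hXY).associator_cocycle ha₀), rfl⟩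
  have hc₁ : IsCocycleOfClass ω₁ c := LabelingData.isCocycleOfClass_of_shift hYX ha₁ ha₀ hc
  refine ⟨c, ⟨⟨d₀⟩, fun d => ?_⟩, ⟨⟨d₁⟩, fun d => ?_⟩⟩
  · obtain ⟨ω, hω⟩ := (d.regular hXY).exists_isAssociator
    exact ⟨ω, hω, LabelingData.isCocycleOfClass_of_shift hXY ((hω ω).2 rfl) ha₁ hc₁⟩
  · obtain ⟨ω, hω⟩ := (d.regular hYX).exists_isAssociator
    exact ⟨ω, hω, LabelingData.isCocycleOfClass_of_shift hYX ((hω ω).2 rfl) ha₀ hc⟩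

end TensorNetwork

end

theorem mainTheorem9 {G : Type*} [Group G] :
    -- the shifted representation and its label
    (∀ (d₁ d₂ : ℕ), 0 < d₁ → 0 < d₂ → ∀ (D₁ D₂ : G → ℕ)
      (X : ∀ g, Fin d₁ × Fin d₁ → Matrix (Fin (D₁ g)) (Fin (D₂ g)) ℂ)
      (Y : ∀ g, Fin d₂ × Fin d₂ → Matrix (Fin (D₂ g)) (Fin (D₁ g)) ℂ),
      IsOneBlockProjRep (fun g => mpoConcat (X g) (Y g)) →
        IsOneBlockProjRep (fun g => mpoConcat (Y g) (X g)) ∧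
        ∃ c : H3 G, IsThirdCohomologyLabel (fun g => mpoConcat (X g) (Y g)) c ∧
          IsThirdCohomologyLabel (fun g => mpoConcat (Y g) (X g)) c) ∧
    -- reductions of alternating chains
    (∀ (d₁ d₂ D₁ D₂ E₁ E₂ : ℕ)
      (A : Fin d₁ → Matrix (Fin D₁) (Fin D₂) ℂ) (B : Fin d₂ → Matrix (Fin D₂) (Fin D₁) ℂ)
      (C : Fin d₁ → Matrix (Fin E₁) (Fin E₂) ℂ) (D : Fin d₂ → Matrix (Fin E₂) (Fin E₁) ℂ),
      IsNormal (concat A B) → IsNormal (concat B A) →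
      (∀ n : ℕ, 0 < n → mpsState (concat C D) n = mpsState (concat A B) n) →
        (∀ n : ℕ, 0 < n → mpsState (concat B A) n = mpsState (concat D C) n) ∧
        ∀ (V : Matrix (Fin D₁) (Fin E₁) ℂ) (W : Matrix (Fin E₁) (Fin D₁) ℂ)
          (V' : Matrix (Fin D₂) (Fin E₂) ℂ) (W' : Matrix (Fin E₂) (Fin D₂) ℂ),
          IsReduction (concat C D) (concat A B) V W →
          IsReduction (concat D C) (concat B A) V' W' →
            ∃ lam mu : ℂ, ∃ N : ℕ, ∀ k ≥ N,
              (∀ (w : Fin k → Fin d₁ × Fin d₂) (s : Fin d₁),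
                chain (concat A B) w * A s = lam • (V * (chain (concat C D) w * C s) * W')) ∧
              (∀ (w : Fin k → Fin d₂ × Fin d₁) (t : Fin d₂),
                chain (concat B A) w * B t = mu • (V' * (chain (concat D C) w * D t) * W))) := by
  refine ⟨fun d₁ d₂ h₁ h₂ D₁ D₂ X Y h => ?_, fun d₁ d₂ D₁ D₂ E₁ E₂ A B C D hAB hBA h => ?_⟩
  · have : Nonempty (Fin d₁) := ⟨⟨0, h₁⟩⟩
    have : Nonempty (Fin d₂) := ⟨⟨0, h₂⟩⟩
    exact ⟨h.swap, exists_label_of_shift h⟩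
  · have hst : SameTrace (concat C D) (concat A B) := sameTrace_iff_mpsState.2 h
    refine ⟨sameTrace_iff_mpsState.1 hst.concat_swap.symm, fun V W V' W' hVW hVW' => ?_⟩
    -- The comparison of reductions needs nonempty bond spaces. In dimension zero both identities
    -- are between empty matrices.
    rcases Nat.eq_zero_or_pos D₁ with rfl | hD₁
    · exact ⟨0, 0, 0, fun k _ => ⟨fun w s => Matrix.ext fun i => i.elim0,
        fun w t => Matrix.ext fun _ j => j.elim0⟩⟩
    rcases Nat.eq_zero_or_pos D₂ with rfl | hD₂
    · exact ⟨0, 0, 0, fun k _ => ⟨fun w s => Matrix.ext fun _ j => j.elim0,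
        fun w t => Matrix.ext fun i => i.elim0⟩⟩
    have : Nonempty (Fin D₁) := ⟨⟨0, hD₁⟩⟩
    have : Nonempty (Fin D₂) := ⟨⟨0, hD₂⟩⟩
    obtain ⟨lam, N, hN⟩ := exists_scalar_chain_concat hAB.generates hBA.generates hst hVW hVW'
    obtain ⟨mu, M, hM⟩ := exists_scalar_chain_concat hBA.generates hAB.generates hst.concat_swap
      hVW' hVW
    exact ⟨lam, mu, max N M, fun k hk =>
      ⟨hN k (le_of_max_le_left hk), hM k (le_of_max_le_right hk)⟩⟩
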